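/- **Setting.** Let $k$ be a field and $B$ a unital associative $k$-algebra. A left $B$-bialgebroid is a unital associative $k$-algebra $L$ with an algebra map $s:B\to L$ and an antialgebra map $t:B\to L$ with commuting images (write $b$ for $s(b)$ and $\bar b$ for $t(b)$), together with a $B$-coring structure $\Delta(X)=X_{(1)}\otimes X_{(2)}\in L\diamond_B L:=L\otimes L/\langle \bar bX\otimes Y-X\otimes bY\rangle$, $\varepsilon:L\to B$, for the bimodule structure $a.X.b=a\bar bX$, such that $X_{(1)}\bar b\otimes X_{(2)}=X_{(1)}\otimes X_{(2)}b$, $\Delta$ is a unital algebra map, $\varepsilon(1)=1$ and $\varepsilon(XY)=\varepsilon(X\varepsilon(Y))=\varepsilon(X\overline{\varepsilon(Y)})$. It is a left Hopf algebroid if $\lambda:L\otimes_{\bar B}L:=L\otimes L/\langle X\bar b\otimes Y-X\otimes\bar bY\rangle\to L\diamond_BL$, $X\otimes Y\mapsto X_{(1)}\otimes X_{(2)}Y$, is bijective; write $X_+\otimes X_-=\lambda^{-1}(X\otimes1)$. A left $L$-comodule is a $B$-bimodule $M$ with a coassociative counital map $m\mapsto m_{(-1)}\otimes m_{(0)}\in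 L\diamond_B M:=L\otimes M/\langle\bar bX\otimes m-X\otimes bm\rangle$ such that $m_{(-1)}\bar b\otimes m_{(0)}=m_{(-1)}\otimes m_{(0)}b$ and $b\,m\,b'\mapsto b\,m_{(-1)}b'\otimes m_{(0)}$. A left 2-cocycle on $L$ is a $k$-bilinear map $\Gamma:L\times L\to B$ with $\Gamma(X\bar b,Y)=\Gamma(X,\bar bY)$, $\Gamma(\bar bX,Y)=\Gamma(X,Y)b$, $\Gamma(X,\Gamma(Y_{(1)},Z_{(1)})Y_{(2)}Z_{(2)})=\Gamma(\Gamma(X_{(1)},Y_{(1)})X_{(2)}Y_{(2)},Z)$ and $\Gamma(1,X)=\varepsilon(X)=\Gamma(X,1)$. It is invertible if for all left $L$-comodules $M,N$ the map $\Gamma^{\#}:M\otimes_{B^\Gamma}N\to M\otimes_BN$, $m\otimes n\mapsto\Gamma(m_{(-1)},n_{(-1)})m_{(0)}\otimes n_{(0)}$, is bijective, where $M\otimes_{B^\Gamma}N$ is formed with $b\cdot_\Gamma n=\Gamma(b,n_{(-1)})n_{(0)}$ and $m\cdot_\Gamma b=\Gamma(m_{(-1)},b)m_{(0)}$. **Cotwist.**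 For an invertible left 2-cocycle $\Gamma$ on a left Hopf algebroid $L$ over $B$, $B^\Gamma$ is the vector space $B$ with product $a\cdot_\Gamma b=\Gamma(a,b)$, and $L^\Gamma$ is the vector space $L$ with the same units, $s$ and $t$, the product $$X\cdot_\Gamma Y=\Gamma(X_{(1)},Y_{(1)})\,X_{(2)+}Y_{(2)+}\,\overline{\Gamma(Y_{(2)-},X_{(2)-})},$$ the coproduct $\Delta^\Gamma=(\Gamma^{\#})^{-1}\circ\Delta$, where $\Gamma^{\#}:L^\Gamma\diamond_{B^\Gamma}L^\Gamma\to L\diamond_BL$, $X\otimes Y\mapsto X_+\overline{\Gamma(X_-,Y_{(1)})}\otimes Y_{(2)}$, and the counit $\varepsilon^\Gamma(X)=\Gamma(X_+,X_-)$. Write $\Delta^\Gamma(X)=X_{[1]}\otimes X_{[2]}$. **Statement.** Let $L$ be a left Hopf algebroid over $B$, $\Gamma$ an invertible left 2-cocycle on $L$, and $\Sigma$ an invertible left 2-cocycle on $L^\Gamma$. Put $$(\Sigma\circ\Gamma)(X,Y)=\Gamma\bigl(\Sigma(X_{[1]},Y_{[1]})\cdot_\Gamma X_{[2]},\,Y_{[2]}\bigr).$$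 Then $L^\Gamma$ is a left Hopf algebroid over $B^\Gamma$ and $\Sigma\circ\Gamma$ is an invertible left 2-cocycle on $L$ (so that all the cotwists below are defined), and $$L^{\Sigma\circ\Gamma}=(L^\Gamma)^\Sigma :$$ the base algebras $B^{\Sigma\circ\Gamma}$ and $(B^\Gamma)^\Sigma$ coincide, and so do the products, units, source and target maps, coproducts and counits on the vector space $L$. -/

import Mathlib

open scoped TensorProduct

universe u v

noncomputable section

namespace Cotwist

/-! ### Quotients of vector spaces -/

section Quotients

variable {k : Type v} [Field k] {V W : Type u} [AddCommGroup V] [Module k V]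
  [AddCommGroup W] [Module k W]

/-- A `k`-linear choice of representatives for the classes of a quotient. It is used to write
formulas in Sweedler notation; in the situations of interest these formulas do not depend on the
representatives. -/
def rep (N : Submodule k V) : (V ⧸ N) →ₗ[k] V :=
  Classical.choose (N.mkQ.exists_rightInverse_of_surjective N.range_mkQ)

theorem mkQ_rep (N : Submodule k V) (x : V ⧸ N) : N.mkQ (rep N x) = x :=
  LinearMap.congr_fun
    (Classical.choose_spec (N.mkQ.exists_rightInverse_of_surjective N.range_mkQ)) x

open Classical in
/-- The map `V / N → W / P` induced by `f : V → W` when `f` maps `N` into `P` (zero if it does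
not). -/
def induced (N : Submodule k V) (P : Submodule k W) (f : V →ₗ[k] W) : (V ⧸ N) →ₗ[k] (W ⧸ P) :=
  if h : N ≤ P.comap f then N.mapQ P f h else 0

open Classical in
/-- The inverse of a bijective linear map (zero if the map is not bijective). -/
def inverse (f : V →ₗ[k] W) : W →ₗ[k] V :=
  if h : Function.Bijective f then ((LinearEquiv.ofBijective f h).symm : W →ₗ[k] V) else 0

end Quotients

/-! ### Algebras with source and target maps -/

/-- The operations of an algebra `B`, of an algebra `L`, and of the source and target maps
`s, t : B → L`, on given vector spaces. The laws are in `IsLeftBialgebroid`. The element `t b` is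
the element written `b̄` in `L`. -/
structure RingData (k : Type v) [Field k] (B L : Type u) [AddCommGroup B] [Module k B]
    [AddCommGroup L] [Module k L] where
  mulB : B →ₗ[k] B →ₗ[k] B
  oneB : B
  mul : L →ₗ[k] L →ₗ[k] L
  one : L
  s : B →ₗ[k] L
  t : B →ₗ[k] L

variable {k : Type v} [Field k] {B L : Type u} [AddCommGroup B] [Module k B]
  [AddCommGroup L] [Module k L] {M N : Type u} [AddCommGroup M] [Module k M]
  [AddCommGroup N] [Module k N]

namespace RingData

variable (A : RingData k B L)

/-- For a left action `l` of `B` on `M`, the relations `b̄ X ⊗ m = X ⊗ b m` defining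
`L ⋄_B M` as a quotient of `L ⊗ M`. -/
def diamondRel (l : B →ₗ[k] M →ₗ[k] M) : Submodule k (L ⊗[k] M) :=
  Submodule.span k {z | ∃ (b : B) (X : L) (m : M),
    z = A.mul (A.t b) X ⊗ₜ[k] m - X ⊗ₜ[k] l b m}

/-- The relations `b̄ X ⊗ Y ⊗ m = X ⊗ b Y ⊗ m` and `X ⊗ b̄ Y ⊗ m = X ⊗ Y ⊗ b m` defining
`L ⋄_B L ⋄_B M`. -/
def diamondRel₃ (l : B →ₗ[k] M →ₗ[k] M) : Submodule k (L ⊗[k] (L ⊗[k] M)) :=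
  Submodule.span k
    ({z | ∃ (b : B) (X Y : L) (m : M),
        z = A.mul (A.t b) X ⊗ₜ[k] (Y ⊗ₜ[k] m) - X ⊗ₜ[k] (A.mul (A.s b) Y ⊗ₜ[k] m)} ∪
      {z | ∃ (b : B) (X Y : L) (m : M),
        z = X ⊗ₜ[k] (A.mul (A.t b) Y ⊗ₜ[k] m) - X ⊗ₜ[k] (Y ⊗ₜ[k] l b m)})

/-- Left multiplication by the source, `b X = s(b) X`. -/
abbrev leftS : B →ₗ[k] L →ₗ[k] L := A.mul ∘ₗ A.s

/-- `L ⋄_B L`, the quotient of `L ⊗ L` by `b̄ X ⊗ Y = X ⊗ b Y`. -/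
abbrev Diamond : Type u := (L ⊗[k] L) ⧸ A.diamondRel A.leftS

/-- The relations `X b̄ ⊗ Y = X ⊗ b̄ Y` defining `L ⊗_{B̄} L`. -/
def barRel : Submodule k (L ⊗[k] L) :=
  Submodule.span k {z | ∃ (b : B) (X Y : L),
    z = A.mul X (A.t b) ⊗ₜ[k] Y - X ⊗ₜ[k] A.mul (A.t b) Y}

end RingData

/-! ### Left bialgebroids and left Hopf algebroids -/

/-- The operations of a left bialgebroid `L` over `B`. The laws are in `IsLeftBialgebroid`. -/
structure BialgebroidData (k : Type v) [Field k] (B L : Type u) [AddCommGroup B] [Module k B]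
    [AddCommGroup L] [Module k L] extends RingData k B L where
  comul : L →ₗ[k] toRingData.Diamond
  counit : L →ₗ[k] B

/-- For `δM m = m₍₋₁₎ ⊗ m₍₀₎`, `δN n = n₍₋₁₎ ⊗ n₍₀₎` and a left action `l` of `B` on `M`, the map
`m ⊗ n ↦ Γ(m₍₋₁₎, n₍₋₁₎) m₍₀₎ ⊗ n₍₀₎`. -/
def sharpRaw (Γ : L →ₗ[k] L →ₗ[k] B) (δM : M →ₗ[k] L ⊗[k] M) (l : B →ₗ[k] M →ₗ[k] M)
    (δN : N →ₗ[k] L ⊗[k] N) : M ⊗[k] N →ₗ[k] M ⊗[k] N :=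
  TensorProduct.lift (LinearMap.rTensorHom N ∘ₗ l) ∘ₗ
    TensorProduct.lift
      ((TensorProduct.map₂ Γ (TensorProduct.mk k M N)).compl₁₂ δM δN)

namespace BialgebroidData

variable (H : BialgebroidData k B L)

/-- A representative `X₍₁₎ ⊗ X₍₂₎` of the coproduct of `X`. -/
def sw : L →ₗ[k] L ⊗[k] L := rep (H.diamondRel H.leftS) ∘ₗ H.comul

/-- The class of an element of `L ⊗ L` in `L ⋄_B L`. -/
abbrev cls : L ⊗[k] L →ₗ[k] H.Diamond := (H.diamondRel H.leftS).mkQ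

/-- The laws of a left bialgebroid over `B`: `B` and `L` are unital associative algebras, `s` is an
algebra map and `t` an antialgebra map with commuting images, `comul` and `counit` make `L` a
`B`-coring for the bimodule structure `a.X.b = s(a) t(b) X`, the coproduct takes values in the
Takeuchi product and is an algebra map to it, and the counit is a left character. -/
structure IsLeftBialgebroid : Prop where
  mulB_assoc : ∀ a b c, H.mulB (H.mulB a b) c = H.mulB a (H.mulB b c)
  oneB_mul : ∀ a, H.mulB H.oneB a = a
  mulB_one : ∀ a, H.mulB a H.oneB = a
  mul_assoc : ∀ X Y Z, H.mul (H.mul X Y) Z = H.mul X (H.mul Y Z)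
  one_mul : ∀ X, H.mul H.one X = X
  mul_one : ∀ X, H.mul X H.one = X
  s_mul : ∀ a b, H.s (H.mulB a b) = H.mul (H.s a) (H.s b)
  s_one : H.s H.oneB = H.one
  t_mul : ∀ a b, H.t (H.mulB a b) = H.mul (H.t b) (H.t a)
  t_one : H.t H.oneB = H.one
  s_t_comm : ∀ a b, H.mul (H.s a) (H.t b) = H.mul (H.t b) (H.s a)
  comul_s : ∀ b X, H.comul (H.mul (H.s b) X) = H.cls ((H.mul (H.s b)).rTensor L (H.sw X))
  comul_t : ∀ b X, H.comul (H.mul (H.t b) X) = H.cls ((H.mul (H.t b)).lTensor L (H.sw X))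
  coassoc : ∀ X, (H.diamondRel₃ H.leftS).mkQ
      (TensorProduct.assoc k L L L (H.sw.rTensor L (H.sw X))) =
    (H.diamondRel₃ H.leftS).mkQ (H.sw.lTensor L (H.sw X))
  counit_s : ∀ b X, H.counit (H.mul (H.s b) X) = H.mulB b (H.counit X)
  counit_t : ∀ b X, H.counit (H.mul (H.t b) X) = H.mulB (H.counit X) b
  /-- `s(ε(X₍₁₎)) X₍₂₎ = X` -/
  counit_left : ∀ X, TensorProduct.lift (H.mul ∘ₗ H.s ∘ₗ H.counit) (H.sw X) = X
  /-- `t(ε(X₍₂₎)) X₍₁₎ = X` -/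
  counit_right : ∀ X, TensorProduct.lift (H.mul ∘ₗ H.t ∘ₗ H.counit).flip (H.sw X) = X
  /-- `X₍₁₎ b̄ ⊗ X₍₂₎ = X₍₁₎ ⊗ X₍₂₎ b` -/
  takeuchi : ∀ b X, H.cls ((H.mul.flip (H.t b)).rTensor L (H.sw X)) =
    H.cls ((H.mul.flip (H.s b)).lTensor L (H.sw X))
  comul_one : H.comul H.one = H.cls (H.one ⊗ₜ[k] H.one)
  comul_mul : ∀ X Y, H.comul (H.mul X Y) =
    H.cls (TensorProduct.map₂ H.mul H.mul (H.sw X) (H.sw Y))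
  counit_one : H.counit H.one = H.oneB
  counit_mul_s : ∀ X Y, H.counit (H.mul X Y) = H.counit (H.mul X (H.s (H.counit Y)))
  counit_mul_t : ∀ X Y, H.counit (H.mul X Y) = H.counit (H.mul X (H.t (H.counit Y)))

/-- The canonical map `λ : L ⊗_{B̄} L → L ⋄_B L`, `X ⊗ Y ↦ X₍₁₎ ⊗ X₍₂₎ Y`. -/
def lam : ((L ⊗[k] L) ⧸ H.barRel) →ₗ[k] H.Diamond :=
  induced H.barRel (H.diamondRel H.leftS)
    ((TensorProduct.lift H.mul).lTensor L ∘ₗ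
      (TensorProduct.assoc k L L L).toLinearMap ∘ₗ H.sw.rTensor L)

/-- A left Hopf algebroid over `B`: a left bialgebroid whose canonical map `λ` is invertible. -/
structure IsLeftHopfAlgebroid : Prop extends H.IsLeftBialgebroid where
  lam_bijective : Function.Bijective H.lam

/-- A representative `X₊ ⊗ X₋` of `λ⁻¹(X ⋄ 1)`. -/
def pm : L →ₗ[k] L ⊗[k] L :=
  rep H.barRel ∘ₗ inverse H.lam ∘ₗ H.cls ∘ₗ (TensorProduct.mk k L L).flip H.one

/-! ### Left comodules -/

/-- A left comodule structure over `H` on `M`: a `B`-bimodule structure on `M` (`l b m = b m` and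
`r b m = m b`) and a bimodule map `δ : M → L ×_B M ⊆ L ⋄_B M` which is coassociative and
counital. -/
structure LeftComodule (M : Type u) [AddCommGroup M] [Module k M] where
  l : B →ₗ[k] M →ₗ[k] M
  r : B →ₗ[k] M →ₗ[k] M
  coact : M →ₗ[k] (L ⊗[k] M) ⧸ H.diamondRel l
  one_l : ∀ m, l H.oneB m = m
  mul_l : ∀ a b m, l (H.mulB a b) m = l a (l b m)
  one_r : ∀ m, r H.oneB m = m
  mul_r : ∀ a b m, r (H.mulB a b) m = r b (r a m)
  l_r : ∀ a b m, l a (r b m) = r b (l a m)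
  /-- `δ(b m) = b m₍₋₁₎ ⊗ m₍₀₎` -/
  coact_l : ∀ b m, coact (l b m) =
    (H.diamondRel l).mkQ ((H.mul (H.s b)).rTensor M (rep (H.diamondRel l) (coact m)))
  /-- `δ(m b) = m₍₋₁₎ b ⊗ m₍₀₎` -/
  coact_r : ∀ b m, coact (r b m) =
    (H.diamondRel l).mkQ ((H.mul.flip (H.s b)).rTensor M (rep (H.diamondRel l) (coact m)))
  /-- `m₍₋₁₎ b̄ ⊗ m₍₀₎ = m₍₋₁₎ ⊗ m₍₀₎ b` -/
  takeuchi : ∀ b m,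
    (H.diamondRel l).mkQ ((H.mul.flip (H.t b)).rTensor M (rep (H.diamondRel l) (coact m))) =
    (H.diamondRel l).mkQ ((r b).lTensor L (rep (H.diamondRel l) (coact m)))
  coassoc : ∀ m, (H.diamondRel₃ l).mkQ
      (TensorProduct.assoc k L L M (H.sw.rTensor M (rep (H.diamondRel l) (coact m)))) =
    (H.diamondRel₃ l).mkQ
      ((rep (H.diamondRel l) ∘ₗ coact).lTensor L (rep (H.diamondRel l) (coact m)))
  /-- `ε(m₍₋₁₎) m₍₀₎ = m` -/
  counit_coact : ∀ m,
    TensorProduct.lift (l ∘ₗ H.counit) (rep (H.diamondRel l) (coact m)) = m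

namespace LeftComodule

variable {H} (C : H.LeftComodule M) (D : H.LeftComodule N) (Γ : L →ₗ[k] L →ₗ[k] B)

/-- A representative `m₍₋₁₎ ⊗ m₍₀₎` of the coaction of `m`. -/
def sw : M →ₗ[k] L ⊗[k] M := rep (H.diamondRel C.l) ∘ₗ C.coact

/-- The relations `m b ⊗ n = m ⊗ b n` defining `M ⊗_B N`. -/
def tensorRel : Submodule k (M ⊗[k] N) :=
  Submodule.span k {z | ∃ (b : B) (m : M) (n : N), z = C.r b m ⊗ₜ[k] n - m ⊗ₜ[k] D.l b n}

/-- The twisted left action `b ·_Γ m = Γ(b, m₍₋₁₎) m₍₀₎`. -/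
def twistL (b : B) (m : M) : M :=
  TensorProduct.lift (C.l ∘ₗ Γ (H.s b)) (C.sw m)

/-- The twisted right action `m ·_Γ b = Γ(m₍₋₁₎, b) m₍₀₎`. -/
def twistR (b : B) (m : M) : M :=
  TensorProduct.lift (C.l ∘ₗ Γ.flip (H.s b)) (C.sw m)

/-- The relations `m ·_Γ b ⊗ n = m ⊗ b ·_Γ n` defining `M ⊗_{B^Γ} N`. -/
def twistTensorRel : Submodule k (M ⊗[k] N) :=
  Submodule.span k {z | ∃ (b : B) (m : M) (n : N),
    z = C.twistR Γ b m ⊗ₜ[k] n - m ⊗ₜ[k] D.twistL Γ b n}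

/-- The map `Γ^# : M ⊗_{B^Γ} N → M ⊗_B N`, `m ⊗ n ↦ Γ(m₍₋₁₎, n₍₋₁₎) m₍₀₎ ⊗ n₍₀₎`. -/
def sharp : ((M ⊗[k] N) ⧸ C.twistTensorRel D Γ) →ₗ[k] ((M ⊗[k] N) ⧸ C.tensorRel D) :=
  induced (C.twistTensorRel D Γ) (C.tensorRel D) (sharpRaw Γ C.sw C.l D.sw)

end LeftComodule

/-! ### Left 2-cocycles -/

/-- `Γ(X₍₁₎, Y₍₁₎) X₍₂₎ Y₍₂₎`. -/
def gmul (Γ : L →ₗ[k] L →ₗ[k] B) (X Y : L) : L :=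
  TensorProduct.lift H.leftS (TensorProduct.map₂ Γ H.mul (H.sw X) (H.sw Y))

/-- `Γ` is a left 2-cocycle on `H`: a left `B̄`-linear map `L ⊗_{B̄} L → B` (where `b̄` acts on `B`
by right multiplication by `b`) with the cocycle and the unit condition. -/
structure IsLeftTwoCocycle (Γ : L →ₗ[k] L →ₗ[k] B) : Prop where
  balanced : ∀ b X Y, Γ (H.mul X (H.t b)) Y = Γ X (H.mul (H.t b) Y)
  linear : ∀ b X Y, Γ (H.mul (H.t b) X) Y = H.mulB (Γ X Y) b
  cocycle : ∀ X Y Z, Γ X (H.gmul Γ Y Z) = Γ (H.gmul Γ X Y) Z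
  one_left : ∀ X, Γ H.one X = H.counit X
  one_right : ∀ X, Γ X H.one = H.counit X

/-- `Γ` is an invertible left 2-cocycle: `Γ^#` is bijective for all left comodules `M`, `N`. -/
structure IsInvertibleLeftTwoCocycle (Γ : L →ₗ[k] L →ₗ[k] B) : Prop
    extends H.IsLeftTwoCocycle Γ where
  invertible : ∀ (M N : Type u) [AddCommGroup M] [Module k M] [AddCommGroup N] [Module k N]
    (C : H.LeftComodule M) (D : H.LeftComodule N), Function.Bijective (C.sharp D Γ)

/-! ### The cotwist -/

variable (Γ : L →ₗ[k] L →ₗ[k] B)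

/-- `X₍₁₎ ⊗ X₍₂₎₊ ⊗ X₍₂₎₋`. -/
def swpm : L →ₗ[k] L ⊗[k] (L ⊗[k] L) := H.pm.lTensor L ∘ₗ H.sw

/-- `b ⊗ Z ⊗ c ↦ b Z c̄`. -/
def collapse : B ⊗[k] (L ⊗[k] B) →ₗ[k] L :=
  TensorProduct.lift H.leftS ∘ₗ (TensorProduct.lift (H.mul.compl₂ H.t)).lTensor B

/-- The cotwisted product
`X ·_Γ Y = Γ(X₍₁₎, Y₍₁₎) X₍₂₎₊ Y₍₂₎₊ t(Γ(Y₍₂₎₋, X₍₂₎₋))`. -/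
def twistMul : L →ₗ[k] L →ₗ[k] L :=
  ((TensorProduct.map₂ Γ (TensorProduct.map₂ H.mul Γ.flip)).compl₁₂ H.swpm H.swpm).compr₂
    H.collapse

/-- The algebras `B^Γ` (with product `a ·_Γ b = Γ(a, b)`) and `L^Γ`, with the same units, source
and target maps as before. -/
def twistRing : RingData k B L where
  mulB := Γ.compl₁₂ H.s H.s
  oneB := H.oneB
  mul := H.twistMul Γ
  one := H.one
  s := H.s
  t := H.t

/-- The map `Γ^# : L^Γ ⋄_{B^Γ} L^Γ → L ⋄_B L`, `X ⊗ Y ↦ X₊ t(Γ(X₋, Y₍₁₎)) ⊗ Y₍₂₎`. -/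
def diamondSharp : (H.twistRing Γ).Diamond →ₗ[k] H.Diamond :=
  induced ((H.twistRing Γ).diamondRel (H.twistRing Γ).leftS) (H.diamondRel H.leftS)
    (sharpRaw Γ ((TensorProduct.comm k L L).toLinearMap ∘ₗ H.pm) (H.mul.flip ∘ₗ H.t) H.sw)

/-- The cotwist `L^Γ` over `B^Γ`, with coproduct `(Γ^#)⁻¹(X₍₁₎ ⋄ X₍₂₎)` and counit
`Γ(X₊, X₋)`. -/
def cotwist : BialgebroidData k B L where
  toRingData := H.twistRing Γ
  comul := inverse (H.diamondSharp Γ) ∘ₗ H.comul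
  counit := TensorProduct.lift Γ ∘ₗ H.pm

/-- The composite `(S ∘ Γ)(X, Y) = Γ(S(X₍₁₎, Y₍₁₎) ·_Γ X₍₂₎, Y₍₂₎)` of `Γ` on `L` and `S` on
`L^Γ`, where `X₍₁₎ ⊗ X₍₂₎` stands for the coproduct of `L^Γ`. -/
def comp (S Γ : L →ₗ[k] L →ₗ[k] B) : L →ₗ[k] L →ₗ[k] B :=
  TensorProduct.curry (TensorProduct.lift Γ ∘ₗ
    sharpRaw S (H.cotwist Γ).sw (H.cotwist Γ).leftS (H.cotwist Γ).sw)

end BialgebroidData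

end Cotwist

end

/-! The theorem rests on one operation, the map `Γ^#` for pairs of left comodules. By the cocycle
identity it is well defined on `M ⊗_{B^Γ} N` (`sharpEv_twistR`). It turns the coaction of `M ⊗_B N`
into the one in which the product of `L` is replaced by `X * Y = Γ(X₍₁₎, Y₍₁₎) X₍₂₎ Y₍₂₎`, the map
`gmul` (`sharpEv_coact`), and it is associative (`sharpEv_assoc`).

Two comodules on the space `L` generate everything: the regular one, with `X ↦ X₍₁₎ ⊗ X₍₂₎`, and the
dual one, with `X ↦ X₋ ⊗ X₊`. Their coactions commute. The product of `L^Γ` is obtained by applying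
`Γ^#` to the dual legs and to the regular legs, in either order (`twistMul_eq`, `twistMul_eq_dual`).
The space `L^Γ ⋄_{B^Γ} M` is the tensor product over `B^Γ` of the dual comodule with `M`, so every
comodule `M` acquires the coaction `m ↦ (Γ^#)⁻¹(m₍₋₁₎ ⊗ m₍₀₎)` (`twistSw`) and becomes a comodule
`M^Γ` over `L^Γ` (`twist`). For the regular comodule this coaction is `Δ^Γ`; for the dual one it is
the translation map of `L^Γ`. Therefore the regular and dual comodules of `L^Γ` are the twists of
those of `L` (`regular_cotwist`, `dual_cotwist`). The canonical map of `L^Γ` is the canonical map of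
`L` transported along maps `Γ^#`, hence bijective (`diamondSharp_lam_cotwist`).

The decisive identity is `(Σ ∘ Γ)^# = Γ^# ∘ Σ^#`, where `Σ^#` is taken on `M^Γ` and `N^Γ`
(`sharpEv_comp`). On regular comodules, followed by multiplication and the counit, it reduces the
cocycle identity of `Σ ∘ Γ` to associativity of `Σ^#`. For arbitrary comodules it writes `(Σ ∘ Γ)^#`
as a composite of bijections. Applied to the regular and dual comodules it identifies the products
(`twistMul_comp`) and the coproducts (`ev_twistSw_comp`); the counits are compared by a separate
computation (`counit_cotwist_comp`).

All computations are in Sweedler notation: `ev z β` evaluates `β` on a representative `z`, and two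
elements of a balanced tensor product agree as soon as all balanced functions agree on their
representatives. -/

noncomputable section
namespace Cotwist

/-! ### Sweedler evaluation -/

section Evaluation

variable {k : Type*} [Field k] {M N P Q W W' : Type*} [AddCommGroup M] [Module k M]
  [AddCommGroup N] [Module k N] [AddCommGroup P] [Module k P] [AddCommGroup Q] [Module k Q]
  [AddCommGroup W] [Module k W] [AddCommGroup W'] [Module k W']

variable (k) in
/-- A function of two variables which is linear in each of them. -/
structure Bilin (β : M → N → W) : Prop where
  add_left : ∀ x x' y, β (x + x') y = β x y + β x' y := by intros; simp
  smul_left : ∀ (c : k) x y, β (c • x) y = c • β x y := by intros; simp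
  add_right : ∀ x y y', β x (y + y') = β x y + β x y' := by intros; simp
  smul_right : ∀ (c : k) x y, β x (c • y) = c • β x y := by intros; simp

theorem Bilin.exists_eq {β : M → N → W} (h : Bilin k β) :
    ∃ f : M →ₗ[k] N →ₗ[k] W, β = fun x y => f x y :=
  ⟨LinearMap.mk₂ k β h.add_left h.smul_left h.add_right h.smul_right, rfl⟩

variable (k) in
/-- The bilinear map that agrees with `β` on pairs of basis vectors. -/
def bilinExt : (M → N → W) →ₗ[k] M →ₗ[k] N →ₗ[k] W where
  toFun β := (Module.Basis.ofVectorSpace k M).constr k fun i =>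
    (Module.Basis.ofVectorSpace k N).constr k fun j =>
      β (Module.Basis.ofVectorSpace k M i) (Module.Basis.ofVectorSpace k N j)
  map_add' β γ := by
    refine (Module.Basis.ofVectorSpace k M).ext fun i =>
      (Module.Basis.ofVectorSpace k N).ext fun j => ?_
    simp only [Module.Basis.constr_basis, LinearMap.add_apply, Pi.add_apply]
  map_smul' c β := by
    refine (Module.Basis.ofVectorSpace k M).ext fun i =>
      (Module.Basis.ofVectorSpace k N).ext fun j => ?_
    simp only [Module.Basis.constr_basis, LinearMap.smul_apply, Pi.smul_apply, RingHom.id_apply]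

/-- Extending from bases changes nothing for a bilinear function, so arbitrary values occur only for
functions that are not bilinear. In exchange `ev z β` is linear in `β` without any hypothesis, and
rewriting under nested evaluations creates no side conditions. -/
theorem bilinExt_coe (f : M →ₗ[k] N →ₗ[k] W) : bilinExt k (fun x y => f x y) = f := by
  refine (Module.Basis.ofVectorSpace k M).ext fun i =>
    (Module.Basis.ofVectorSpace k N).ext fun j => ?_
  simp only [bilinExt, LinearMap.coe_mk, AddHom.coe_mk, Module.Basis.constr_basis]

/-- The sum `∑ β(xᵢ, yᵢ)` for `z = ∑ xᵢ ⊗ yᵢ`, with `β` replaced by its bilinear extension from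
bases when it is not bilinear. -/
def ev (z : M ⊗[k] N) (β : M → N → W) : W := TensorProduct.lift (bilinExt k β) z

@[simp] theorem ev_add (z w : M ⊗[k] N) (β : M → N → W) : ev (z + w) β = ev z β + ev w β :=
  map_add _ _ _
@[simp] theorem ev_smul (c : k) (z : M ⊗[k] N) (β : M → N → W) : ev (c • z) β = c • ev z β :=
  map_smul _ _ _
theorem ev_sub (z w : M ⊗[k] N) (β : M → N → W) : ev (z - w) β = ev z β - ev w β :=
  map_sub _ _ _

@[simp] theorem ev_fun_add (z : M ⊗[k] N) (β γ : M → N → W) :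
    ev z (fun x y => β x y + γ x y) = ev z β + ev z γ := by
  change TensorProduct.lift (bilinExt k (β + γ)) z = _
  rw [map_add, show TensorProduct.lift (bilinExt k β + bilinExt k γ) =
    TensorProduct.lift (bilinExt k β) + TensorProduct.lift (bilinExt k γ) from
    TensorProduct.ext' fun x y => by simp only [TensorProduct.lift.tmul, LinearMap.add_apply]]
  rfl
@[simp] theorem ev_fun_smul (z : M ⊗[k] N) (c : k) (β : M → N → W) :
    ev z (fun x y => c • β x y) = c • ev z β := by
  change TensorProduct.lift (bilinExt k (c • β)) z = _
  rw [map_smul, show TensorProduct.lift (c • bilinExt k β) = c • TensorProduct.lift (bilinExt k β) from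
    TensorProduct.ext' fun x y => by simp only [TensorProduct.lift.tmul, LinearMap.smul_apply]]
  rfl
theorem map_ev (f : W →ₗ[k] W') (z : M ⊗[k] N) (β : M → N → W) :
    f (ev z β) = ev z fun x y => f (β x y) := by
  have : (bilinExt k β).compr₂ f = bilinExt k fun x y => f (β x y) := by
    refine (Module.Basis.ofVectorSpace k M).ext fun i =>
      (Module.Basis.ofVectorSpace k N).ext fun j => ?_
    simp only [bilinExt, LinearMap.coe_mk, AddHom.coe_mk, Module.Basis.constr_basis,
      LinearMap.compr₂_apply]
  rw [ev, ev, ← this, TensorProduct.lift_compr₂]; rfl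

theorem ev_eq_lift (f : M →ₗ[k] N →ₗ[k] W) (z : M ⊗[k] N) :
    ev z (fun x y => f x y) = TensorProduct.lift f z := by
  rw [ev, bilinExt_coe]

theorem Bilin.ev_tmul {β : M → N → W} (h : Bilin k β) (x : M) (y : N) :
    ev (x ⊗ₜ[k] y) β = β x y := by
  obtain ⟨f, rfl⟩ := h.exists_eq
  rw [ev_eq_lift, TensorProduct.lift.tmul]

theorem lift_eq_ev (f : M →ₗ[k] N →ₗ[k] W) (z : M ⊗[k] N) :
    TensorProduct.lift f z = ev z fun x y => f x y := (ev_eq_lift f z).symm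

theorem eq_ev_tmul (z : M ⊗[k] N) : z = ev z fun x y => x ⊗ₜ[k] y := by
  refine .trans ?_ (ev_eq_lift (TensorProduct.mk k M N) z).symm
  rw [TensorProduct.lift_mk]; rfl

theorem map_eq_ev (f : M ⊗[k] N →ₗ[k] W) (z : M ⊗[k] N) :
    f z = ev z fun x y => f (x ⊗ₜ[k] y) := by
  conv_lhs => rw [eq_ev_tmul z, map_ev]

theorem ev_apply {α : Type*} {Y : α → Type*} [∀ a, AddCommGroup (Y a)] [∀ a, Module k (Y a)]
    (z : M ⊗[k] N) (β : M → N → ∀ a, Y a) (a : α) :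
    ev z β a = ev z fun x y => β x y a :=
  map_ev (LinearMap.proj a) z β

/-- `ev` as a linear function of its second argument. -/
def evₗ (z : M ⊗[k] N) : (M → N → W) →ₗ[k] W where
  toFun β := ev z β
  map_add' β γ := ev_fun_add z β γ
  map_smul' c β := ev_fun_smul z c β

/-- Only linearity of `ev w` in its function argument is used, so evaluations may be interchanged
whether or not `β` is multilinear. -/
theorem ev_comm (z : M ⊗[k] N) (w : P ⊗[k] Q) (β : M → N → P → Q → W) :
    ev z (fun x y => ev w fun p q => β x y p q) =
      ev w fun p q => ev z fun x y => β x y p q := by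
  have := map_ev (evₗ w : (P → Q → W) →ₗ[k] W) z β
  refine this.symm.trans ?_
  change ev w (ev z β) = _
  congr 1
  funext p q
  rw [ev_apply, ev_apply]

theorem linearMap_ev_apply (z : M ⊗[k] N) (β : M → N → P →ₗ[k] W) (p : P) :
    (ev z β) p = ev z fun x y => β x y p :=
  map_ev (LinearMap.applyₗ p) z β

theorem ev_ev (z : M ⊗[k] N) (T : M → N → P ⊗[k] Q) (β : P → Q → W) :
    ev (ev z T) β = ev z fun x y => ev (T x y) β :=
  map_ev (TensorProduct.lift (bilinExt k β)) z T

theorem Bilin.ev_map {β : P → Q → W} (h : Bilin k β) (f : M →ₗ[k] P) (g : N →ₗ[k] Q)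
    (z : M ⊗[k] N) : ev (TensorProduct.map f g z) β = ev z fun x y => β (f x) (g y) := by
  conv_lhs => rw [map_eq_ev (TensorProduct.map f g) z, ev_ev]
  simp only [TensorProduct.map_tmul, h.ev_tmul]

theorem Bilin.ev_comm_map {β : N → M → W} (h : Bilin k β) (z : M ⊗[k] N) :
    ev (TensorProduct.comm k M N z) β = ev z fun x y => β y x := by
  have := map_eq_ev (TensorProduct.comm k M N).toLinearMap z
  conv_lhs => rw [show TensorProduct.comm k M N z =
    (TensorProduct.comm k M N).toLinearMap z from rfl, this, ev_ev]
  simp only [LinearEquiv.coe_coe, TensorProduct.comm_tmul, h.ev_tmul]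

theorem ev_congr {z : M ⊗[k] N} {β γ : M → N → W} (h : ∀ x y, β x y = γ x y) :
    ev z β = ev z γ :=
  congrArg (ev z) (funext fun x => funext fun y => h x y)

end Evaluation

attribute [irreducible] bilinExt ev

/-! ### Balanced tensor products -/

section Balanced

variable {k : Type*} [Field k] {B M N P W : Type*} [AddCommGroup M] [Module k M]
  [AddCommGroup N] [Module k N] [AddCommGroup P] [Module k P] [AddCommGroup W] [Module k W]

variable (k) in
/-- Bilinear functions with `β(r b x, y) = β(x, l b y)`. -/
structure Bal (r : B → M → M) (l : B → N → N) (β : M → N → W) : Prop extends Bilin k β where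
  bal : ∀ b x y, β (r b x) y = β x (l b y) := by intros; simp

variable (k) in
/-- The relations `r b x ⊗ y = x ⊗ l b y`. -/
def balRel (r : B → M → M) (l : B → N → N) : Submodule k (M ⊗[k] N) :=
  Submodule.span k {z | ∃ b x y, z = r b x ⊗ₜ[k] y - x ⊗ₜ[k] l b y}

variable {r : B → M → M} {l : B → N → N}

theorem Bal.ev_eq_zero {β : M → N → W} (h : Bal k r l β) {z : M ⊗[k] N}
    (hz : z ∈ balRel k r l) : ev z β = 0 := by
  obtain ⟨f, rfl⟩ := h.exists_eq
  rw [ev_eq_lift]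
  have : balRel k r l ≤ LinearMap.ker (TensorProduct.lift f) := by
    refine Submodule.span_le.2 ?_
    rintro _ ⟨b, x, y, rfl⟩
    simp [h.bal b x y]
  exact this hz

theorem Bal.ev_congr {β : M → N → W} (h : Bal k r l β) {z w : M ⊗[k] N}
    (hz : (balRel k r l).mkQ z = (balRel k r l).mkQ w) : ev z β = ev w β := by
  rw [← sub_eq_zero, ← ev_sub]
  exact h.ev_eq_zero ((Submodule.Quotient.eq _).1 hz)

/-- This is the universal balanced function. Together with `Bal.ev_congr` it reduces an equality in
the quotient to equality of evaluations against balanced functions. -/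
theorem bal_mkQ : Bal k r l fun x y => (balRel k r l).mkQ (x ⊗ₜ[k] y) where
  add_left _ _ _ := by rw [TensorProduct.add_tmul, map_add]
  smul_left _ _ _ := by rw [← TensorProduct.smul_tmul', map_smul]
  add_right _ _ _ := by rw [TensorProduct.tmul_add, map_add]
  smul_right _ _ _ := by rw [TensorProduct.tmul_smul, map_smul]
  bal b x y := by
    rw [← sub_eq_zero, ← map_sub, ← LinearMap.mem_ker, Submodule.ker_mkQ]
    exact Submodule.subset_span ⟨b, x, y, rfl⟩

theorem mkQ_eq_iff {z w : M ⊗[k] N} : (balRel k r l).mkQ z = (balRel k r l).mkQ w ↔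
    ev z (fun x y => (balRel k r l).mkQ (x ⊗ₜ[k] y)) =
      ev w fun x y => (balRel k r l).mkQ (x ⊗ₜ[k] y) := by
  rw [← map_eq_ev, ← map_eq_ev]

variable (k) in
/-- Trilinear functions which are balanced in the first two and in the last two variables. -/
structure Bal₃ (r : B → M → M) (l r' : B → N → N) (l' : B → P → P) (γ : M → N → P → W) :
    Prop where
  add₁ : ∀ x x' y z, γ (x + x') y z = γ x y z + γ x' y z := by intros; simp
  smul₁ : ∀ (c : k) x y z, γ (c • x) y z = c • γ x y z := by intros; simp
  add₂ : ∀ x y y' z, γ x (y + y') z = γ x y z + γ x y' z := by intros; simp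
  smul₂ : ∀ (c : k) x y z, γ x (c • y) z = c • γ x y z := by intros; simp
  add₃ : ∀ x y z z', γ x y (z + z') = γ x y z + γ x y z' := by intros; simp
  smul₃ : ∀ (c : k) x y z, γ x y (c • z) = c • γ x y z := by intros; simp
  bal₁ : ∀ b x y z, γ (r b x) y z = γ x (l b y) z := by intros; simp
  bal₂ : ∀ b x y z, γ x (r' b y) z = γ x y (l' b z) := by intros; simp

variable {l' : B → P → P} {r' : B → N → N}

theorem Bal₃.exists_eq {γ : M → N → P → W} (h : Bal₃ k r l r' l' γ) :
    ∃ f : M →ₗ[k] N →ₗ[k] P →ₗ[k] W, γ = fun x y z => f x y z := by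
  have h' : ∀ x, ∃ f : N →ₗ[k] P →ₗ[k] W, γ x = fun y z => f y z := fun x =>
    Bilin.exists_eq ⟨h.add₂ x, fun c => h.smul₂ c x, h.add₃ x, fun c => h.smul₃ c x⟩
  choose f hf using h'
  refine ⟨{ toFun := f, map_add' := fun x x' => ?_, map_smul' := fun c x => ?_ }, ?_⟩
  · ext y z
    have := h.add₁ x x' y z
    simpa only [hf, LinearMap.add_apply] using this
  · ext y z
    have := h.smul₁ c x y z
    simpa only [hf, LinearMap.smul_apply, RingHom.id_apply] using this
  · funext x y z
    simp only [hf, LinearMap.coe_mk, AddHom.coe_mk]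

variable (k) in
/-- The relations `r b x ⊗ y ⊗ z = x ⊗ l b y ⊗ z` and `x ⊗ r' b y ⊗ z = x ⊗ y ⊗ l' b z`. -/
def balRel₃ (r : B → M → M) (l r' : B → N → N) (l' : B → P → P) :
    Submodule k (M ⊗[k] (N ⊗[k] P)) :=
  Submodule.span k ({w | ∃ b x y z, w = r b x ⊗ₜ[k] (y ⊗ₜ[k] z) - x ⊗ₜ[k] (l b y ⊗ₜ[k] z)} ∪
    {w | ∃ b x y z, w = x ⊗ₜ[k] (r' b y ⊗ₜ[k] z) - x ⊗ₜ[k] (y ⊗ₜ[k] l' b z)})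

theorem Bal₃.ev_congr {γ : M → N → P → W} (h : Bal₃ k r l r' l' γ) {z w : M ⊗[k] (N ⊗[k] P)}
    (hz : (balRel₃ k r l r' l').mkQ z = (balRel₃ k r l r' l').mkQ w) :
    ev z (fun x t => ev t fun y p => γ x y p) = ev w fun x t => ev t fun y p => γ x y p := by
  obtain ⟨f, rfl⟩ := h.exists_eq
  have key : ∀ z : M ⊗[k] (N ⊗[k] P), ev z (fun x t => ev t fun y p => f x y p) =
      TensorProduct.lift (TensorProduct.uncurry (.id k) N P W ∘ₗ f) z := by
    intro z
    rw [← ev_eq_lift]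
    congr 1
    funext x t
    rw [ev_eq_lift]
    rfl
  rw [key, key]
  have : balRel₃ k r l r' l' ≤
      LinearMap.ker (TensorProduct.lift (TensorProduct.uncurry (.id k) N P W ∘ₗ f)) := by
    refine Submodule.span_le.2 ?_
    rintro _ (⟨b, x, y, p, rfl⟩ | ⟨b, x, y, p, rfl⟩)
    · simpa [sub_eq_zero] using h.bal₁ b x y p
    · simpa [sub_eq_zero] using h.bal₂ b x y p
  rw [← sub_eq_zero, ← map_sub]
  exact this ((Submodule.Quotient.eq _).1 hz)

theorem bal₃_mkQ : Bal₃ k r l r' l'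
    fun x y z => (balRel₃ k r l r' l').mkQ (x ⊗ₜ[k] (y ⊗ₜ[k] z)) where
  add₁ _ _ _ _ := by rw [TensorProduct.add_tmul, map_add]
  smul₁ _ _ _ _ := by rw [← TensorProduct.smul_tmul', map_smul]
  add₂ _ _ _ _ := by rw [TensorProduct.add_tmul, TensorProduct.tmul_add, map_add]
  smul₂ _ _ _ _ := by
    rw [← TensorProduct.smul_tmul', TensorProduct.tmul_smul, map_smul]
  add₃ _ _ _ _ := by rw [TensorProduct.tmul_add, TensorProduct.tmul_add, map_add]
  smul₃ _ _ _ _ := by rw [TensorProduct.tmul_smul, TensorProduct.tmul_smul, map_smul]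
  bal₁ b x y z := by
    rw [← sub_eq_zero, ← map_sub, ← LinearMap.mem_ker, Submodule.ker_mkQ]
    exact Submodule.subset_span (Or.inl ⟨b, x, y, z, rfl⟩)
  bal₂ b x y z := by
    rw [← sub_eq_zero, ← map_sub, ← LinearMap.mem_ker, Submodule.ker_mkQ]
    exact Submodule.subset_span (Or.inr ⟨b, x, y, z, rfl⟩)

end Balanced

end Cotwist
end

/-! ### Sweedler rules for comodules and bialgebroids -/

noncomputable section
namespace Cotwist

-- With these rules the default proofs of the linearity fields of `Bilin`, `Bal` and `Bal₃` succeed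
-- for functions built from nested evaluations.
attribute [simp] map_ev linearMap_ev_apply ev_ev

section Evaluation

variable {k : Type*} [Field k] {M N P Q W : Type*} [AddCommGroup M] [Module k M]
  [AddCommGroup N] [Module k N] [AddCommGroup P] [Module k P] [AddCommGroup Q] [Module k Q]
  [AddCommGroup W] [Module k W]

theorem Bilin.ev_rTensor {β : P → N → W} (h : Bilin k β) (f : M →ₗ[k] P) (z : M ⊗[k] N) :
    ev (f.rTensor N z) β = ev z fun x y => β (f x) y :=
  h.ev_map f .id z

theorem Bilin.ev_lTensor {β : M → P → W} (h : Bilin k β) (f : N →ₗ[k] P) (z : M ⊗[k] N) :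
    ev (f.lTensor M z) β = ev z fun x y => β x (f y) :=
  h.ev_map .id f z

theorem ev_assoc_rTensor (γ : M →ₗ[k] N →ₗ[k] P →ₗ[k] W) (δ : Q →ₗ[k] M ⊗[k] N)
    (z : Q ⊗[k] P) :
    ev (TensorProduct.assoc k M N P (δ.rTensor P z)) (fun x t => ev t fun y p => γ x y p) =
      ev z fun q p => ev (δ q) fun x y => γ x y p := by
  have hb : Bilin k fun (x : M) (t : N ⊗[k] P) => ev t fun y p => γ x y p := {}
  have h1 : ∀ (w : M ⊗[k] N) (p : P),
      ev (TensorProduct.assoc k M N P (w ⊗ₜ[k] p)) (fun x t => ev t fun y p => γ x y p) =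
        ev w fun x y => γ x y p := by
    intro w p
    have := map_eq_ev ((TensorProduct.assoc k M N P).toLinearMap ∘ₗ
      (TensorProduct.mk k (M ⊗[k] N) P).flip p) w
    refine (congrArg (fun z => ev z fun x t => ev t fun y p => γ x y p) this).trans ?_
    rw [ev_ev]
    refine ev_congr fun x y => ?_
    simp only [LinearMap.comp_apply, LinearMap.flip_apply, TensorProduct.mk_apply,
      LinearEquiv.coe_coe, TensorProduct.assoc_tmul]
    rw [hb.ev_tmul, Bilin.ev_tmul {}]
  have := map_eq_ev ((TensorProduct.assoc k M N P).toLinearMap ∘ₗ δ.rTensor P) z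
  refine (congrArg (fun z => ev z fun x t => ev t fun y p => γ x y p) this).trans ?_
  rw [ev_ev]
  refine ev_congr fun q p => ?_
  exact h1 (δ q) p

theorem ev_lTensor_ev (γ : M →ₗ[k] N →ₗ[k] P →ₗ[k] W) (δ : Q →ₗ[k] N ⊗[k] P)
    (z : M ⊗[k] Q) :
    ev (δ.lTensor M z) (fun x t => ev t fun y p => γ x y p) =
      ev z fun x q => ev (δ q) fun y p => γ x y p :=
  Bilin.ev_lTensor {} δ z

theorem lift_map₂_eq_ev {M' N' P' : Type*} [AddCommGroup M'] [Module k M'] [AddCommGroup N']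
    [Module k N'] [AddCommGroup P'] [Module k P']
    (f : M →ₗ[k] N →ₗ[k] P) (g : M' →ₗ[k] N' →ₗ[k] P')
    (z : M ⊗[k] M') (w : N ⊗[k] N') :
    TensorProduct.map₂ f g z w =
      ev z fun x x' => ev w fun y y' => f x y ⊗ₜ[k] g x' y' := by
  conv_lhs => rw [eq_ev_tmul z, map_ev, linearMap_ev_apply]
  refine ev_congr fun x x' => ?_
  conv_lhs => rw [eq_ev_tmul w, map_ev]
  rfl

end Evaluation

variable {k : Type v} [Field k] {B L : Type u} [AddCommGroup B] [Module k B]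
  [AddCommGroup L] [Module k L] {M N : Type u} [AddCommGroup M] [Module k M]
  [AddCommGroup N] [Module k N] {W : Type*} [AddCommGroup W] [Module k W]

namespace BialgebroidData

variable (H : BialgebroidData k B L)

/-- Functions on `L × M` that factor through `L ⋄_B M`. -/
abbrev DBal (l : B →ₗ[k] M →ₗ[k] M) (β : L → M → W) : Prop :=
  Bal k (fun b X => H.mul (H.t b) X) (fun b m => l b m) β

/-- Functions on `L × L × M` that factor through `L ⋄_B L ⋄_B M`. -/
abbrev DBal₃ (l : B →ₗ[k] M →ₗ[k] M) (γ : L → L → M → W) : Prop :=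
  Bal₃ k (fun b X => H.mul (H.t b) X) (fun b X => H.mul (H.s b) X)
    (fun b X => H.mul (H.t b) X) (fun b m => l b m) γ

/-- Functions on `L × L` that factor through `L ⊗_{B̄} L`. -/
abbrev BarBal (β : L → L → W) : Prop :=
  Bal k (fun b X => H.mul X (H.t b)) (fun b X => H.mul (H.t b) X) β

variable {H}

namespace LeftComodule

variable (C : H.LeftComodule M)

theorem mkQ_sw (m : M) : (H.diamondRel C.l).mkQ (C.sw m) = C.coact m :=
  mkQ_rep _ _

variable {C}

theorem ev_sw_of_coact {β : L → M → W} (hβ : H.DBal C.l β) {m : M} {z : L ⊗[k] M}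
    (h : C.coact m = (H.diamondRel C.l).mkQ z) : ev (C.sw m) β = ev z β :=
  hβ.ev_congr ((C.mkQ_sw m).trans h)

theorem ev_sw_l {β : L → M → W} (hβ : H.DBal C.l β) (b : B) (m : M) :
    ev (C.sw (C.l b m)) β = ev (C.sw m) fun X n => β (H.mul (H.s b) X) n := by
  rw [ev_sw_of_coact hβ (C.coact_l b m), hβ.toBilin.ev_rTensor]; rfl

theorem ev_sw_r {β : L → M → W} (hβ : H.DBal C.l β) (b : B) (m : M) :
    ev (C.sw (C.r b m)) β = ev (C.sw m) fun X n => β (H.mul X (H.s b)) n := by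
  rw [ev_sw_of_coact hβ (C.coact_r b m), hβ.toBilin.ev_rTensor]; rfl

theorem ev_sw_takeuchi {β : L → M → W} (hβ : H.DBal C.l β) (b : B) (m : M) :
    ev (C.sw m) (fun X n => β (H.mul X (H.t b)) n) = ev (C.sw m) fun X n => β X (C.r b n) := by
  have := hβ.ev_congr (C.takeuchi b m)
  rw [hβ.toBilin.ev_rTensor, hβ.toBilin.ev_lTensor] at this
  exact this

theorem ev_sw_coassoc {γ : L → L → M → W} (hγ : H.DBal₃ C.l γ) (m : M) :
    ev (C.sw m) (fun X n => ev (H.sw X) fun Y Z => γ Y Z n) =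
      ev (C.sw m) fun X n => ev (C.sw n) fun Y p => γ X Y p := by
  have := hγ.ev_congr (C.coassoc m)
  obtain ⟨f, rfl⟩ := hγ.exists_eq
  rw [ev_assoc_rTensor, ev_lTensor_ev] at this
  exact this

theorem ev_sw_counit (m : M) : ev (C.sw m) (fun X n => C.l (H.counit X) n) = m := by
  have := C.counit_coact m
  rw [lift_eq_ev] at this
  exact this

theorem map_ev_sw_counit (f : M →ₗ[k] W) (m : M) :
    ev (C.sw m) (fun X n => f (C.l (H.counit X) n)) = f m := by
  rw [← map_ev, ev_sw_counit]

end LeftComodule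

theorem cls_sw (X : L) : H.cls (H.sw X) = H.comul X := mkQ_rep _ _

theorem ev_sw_of_comul {β : L → L → W} (hβ : H.DBal H.leftS β) {X : L} {z : L ⊗[k] L}
    (h : H.comul X = H.cls z) : ev (H.sw X) β = ev z β :=
  hβ.ev_congr ((H.cls_sw X).trans h)

namespace IsLeftBialgebroid

variable (hH : H.IsLeftBialgebroid)
include hH

theorem ev_sw_one {β : L → L → W} (hβ : H.DBal H.leftS β) :
    ev (H.sw H.one) β = β H.one H.one := by
  rw [ev_sw_of_comul hβ hH.comul_one, hβ.toBilin.ev_tmul]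

theorem ev_sw_mul {β : L → L → W} (hβ : H.DBal H.leftS β) (X Y : L) :
    ev (H.sw (H.mul X Y)) β = ev (H.sw X) fun P Q => ev (H.sw Y) fun R T =>
      β (H.mul P R) (H.mul Q T) := by
  rw [ev_sw_of_comul hβ (hH.comul_mul X Y), lift_map₂_eq_ev]
  simp only [ev_ev, hβ.toBilin.ev_tmul]

theorem ev_sw_s_mul {β : L → L → W} (hβ : H.DBal H.leftS β) (b : B) (X : L) :
    ev (H.sw (H.mul (H.s b) X)) β = ev (H.sw X) fun P Q => β (H.mul (H.s b) P) Q := by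
  rw [ev_sw_of_comul hβ (hH.comul_s b X), hβ.toBilin.ev_rTensor]

theorem ev_sw_t_mul {β : L → L → W} (hβ : H.DBal H.leftS β) (b : B) (X : L) :
    ev (H.sw (H.mul (H.t b) X)) β = ev (H.sw X) fun P Q => β P (H.mul (H.t b) Q) := by
  rw [ev_sw_of_comul hβ (hH.comul_t b X), hβ.toBilin.ev_lTensor]

end IsLeftBialgebroid
end BialgebroidData
end Cotwist
end

/-! ### Testing by balanced functions, the regular comodule, and the operations attached to `Γ` -/

noncomputable section
namespace Cotwist

variable {k : Type v} [Field k] {B L : Type u} [AddCommGroup B] [Module k B]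
  [AddCommGroup L] [Module k L] {M N : Type u} [AddCommGroup M] [Module k M]
  [AddCommGroup N] [Module k N] {W W' : Type*} [AddCommGroup W] [Module k W]
  [AddCommGroup W'] [Module k W']

/-- Functions with values in the quotient itself suffice because the class map is one of them; this
keeps the hypothesis in a single universe. -/
theorem mkQ_balRel_eq {B : Type*} {r : B → M → M} {l : B → N → N} {z w : M ⊗[k] N}
    (h : ∀ β : M → N → (M ⊗[k] N) ⧸ balRel k r l, Bal k r l β → ev z β = ev w β) :
    (balRel k r l).mkQ z = (balRel k r l).mkQ w :=
  mkQ_eq_iff.2 (h _ bal_mkQ)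

namespace BialgebroidData

variable {H : BialgebroidData k B L}

theorem mkQ_diamondRel_eq {l : B →ₗ[k] M →ₗ[k] M} {z w : L ⊗[k] M}
    (h : ∀ β : L → M → (L ⊗[k] M) ⧸ H.diamondRel l, H.DBal l β → ev z β = ev w β) :
    (H.diamondRel l).mkQ z = (H.diamondRel l).mkQ w :=
  mkQ_balRel_eq h

theorem mkQ_diamondRel₃_eq {l : B →ₗ[k] M →ₗ[k] M} {z w : L ⊗[k] (L ⊗[k] M)}
    (h : ∀ γ : L → L → M → (L ⊗[k] (L ⊗[k] M)) ⧸ H.diamondRel₃ l, H.DBal₃ l γ →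
      ev z (fun X y => ev y fun Y m => γ X Y m) = ev w fun X y => ev y fun Y m => γ X Y m) :
    (H.diamondRel₃ l).mkQ z = (H.diamondRel₃ l).mkQ w := by
  have key := h _ bal₃_mkQ
  have : ∀ z : L ⊗[k] (L ⊗[k] M), ev z (fun X y => ev y fun Y m =>
      (H.diamondRel₃ l).mkQ (X ⊗ₜ[k] (Y ⊗ₜ[k] m))) = (H.diamondRel₃ l).mkQ z := by
    intro z
    rw [map_eq_ev]
    refine ev_congr fun X y => ?_
    exact (map_eq_ev ((H.diamondRel₃ l).mkQ ∘ₗ TensorProduct.mk k _ _ X) y).symm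
  exact (this z).symm.trans (key.trans (this w))

theorem mkQ_barRel_eq {z w : L ⊗[k] L}
    (h : ∀ β : L → L → (L ⊗[k] L) ⧸ H.barRel, H.BarBal β → ev z β = ev w β) :
    H.barRel.mkQ z = H.barRel.mkQ w :=
  mkQ_balRel_eq h

namespace IsLeftBialgebroid

variable (hH : H.IsLeftBialgebroid)
include hH

theorem ev_sw_takeuchi {β : L → L → W} (hβ : H.DBal H.leftS β) (b : B) (X : L) :
    ev (H.sw X) (fun P Q => β (H.mul P (H.t b)) Q) =
      ev (H.sw X) fun P Q => β P (H.mul Q (H.s b)) := by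
  have := hβ.ev_congr (hH.takeuchi b X)
  rw [hβ.toBilin.ev_rTensor, hβ.toBilin.ev_lTensor] at this
  exact this

theorem ev_sw_coassoc {γ : L → L → L → W} (hγ : H.DBal₃ H.leftS γ) (X : L) :
    ev (H.sw X) (fun P Q => ev (H.sw P) fun R T => γ R T Q) =
      ev (H.sw X) fun P Q => ev (H.sw Q) fun R T => γ P R T := by
  have := hγ.ev_congr (hH.coassoc X)
  obtain ⟨f, rfl⟩ := hγ.exists_eq
  rw [ev_assoc_rTensor, ev_lTensor_ev] at this
  exact this

theorem ev_sw_counit_left (X : L) :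
    ev (H.sw X) (fun P Q => H.mul (H.s (H.counit P)) Q) = X := by
  have := hH.counit_left X
  rw [lift_eq_ev] at this
  exact this

theorem ev_sw_counit_right (X : L) :
    ev (H.sw X) (fun P Q => H.mul (H.t (H.counit Q)) P) = X := by
  have := hH.counit_right X
  rw [lift_eq_ev] at this
  exact this

theorem ev_sw_s {β : L → L → W} (hβ : H.DBal H.leftS β) (b : B) :
    ev (H.sw (H.s b)) β = β (H.s b) H.one := by
  obtain ⟨f, rfl⟩ := hβ.exists_eq
  have hb : ∀ b X Y, f (H.mul (H.t b) X) Y = f X (H.mul (H.s b) Y) := hβ.bal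
  have := hH.ev_sw_s_mul hβ b H.one
  rw [hH.mul_one] at this
  rw [this, hH.ev_sw_one (β := fun P Q => f (H.mul (H.s b) P) Q)
    { bal := fun c X Y => by
        rw [← hH.mul_assoc, hH.s_t_comm, hH.mul_assoc, hb]; rfl }, hH.mul_one]

theorem ev_sw_t {β : L → L → W} (hβ : H.DBal H.leftS β) (b : B) :
    ev (H.sw (H.t b)) β = β H.one (H.t b) := by
  obtain ⟨f, rfl⟩ := hβ.exists_eq
  have hb : ∀ b X Y, f (H.mul (H.t b) X) Y = f X (H.mul (H.s b) Y) := hβ.bal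
  have := hH.ev_sw_t_mul hβ b H.one
  rw [hH.mul_one] at this
  rw [this, hH.ev_sw_one (β := fun P Q => f P (H.mul (H.t b) Q))
    { bal := fun c X Y => by
        rw [hb, ← hH.mul_assoc, hH.s_t_comm, hH.mul_assoc]; rfl }, hH.mul_one]

/-- This is `Δ(X) Δ(b)` with `Δ(b) = b ⊗ 1`. The Takeuchi condition on `X` makes the product of
representatives independent of the one chosen for `Δ(b)`. -/
theorem ev_sw_mul_s {β : L → L → W} (hβ : H.DBal H.leftS β) (b : B) (X : L) :
    ev (H.sw (H.mul X (H.s b))) β = ev (H.sw X) fun P Q => β (H.mul P (H.s b)) Q := by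
  rw [hH.ev_sw_mul hβ]
  obtain ⟨f, rfl⟩ := hβ.exists_eq
  have hb : ∀ b X Y, f (H.mul (H.t b) X) Y = f X (H.mul (H.s b) Y) := hβ.bal
  rw [ev_comm, hH.ev_sw_s (β := fun p q => ev (H.sw X) fun P Q => f (H.mul P p) (H.mul Q q))]
  · simp only [hH.mul_one]
  · refine { bal := fun c Y Z => ?_ }
    simp only [← hH.mul_assoc, LinearMap.comp_apply]
    exact hH.ev_sw_takeuchi (β := fun P Q => f (H.mul P Y) (H.mul Q Z))
      { bal := fun c X Y => by simp only [hH.mul_assoc, hb, LinearMap.comp_apply] } c X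

theorem ev_sw_mul_t {β : L → L → W} (hβ : H.DBal H.leftS β) (b : B) (X : L) :
    ev (H.sw (H.mul X (H.t b))) β = ev (H.sw X) fun P Q => β P (H.mul Q (H.t b)) := by
  rw [hH.ev_sw_mul hβ]
  obtain ⟨f, rfl⟩ := hβ.exists_eq
  have hb : ∀ b X Y, f (H.mul (H.t b) X) Y = f X (H.mul (H.s b) Y) := hβ.bal
  rw [ev_comm, hH.ev_sw_t (β := fun p q => ev (H.sw X) fun P Q => f (H.mul P p) (H.mul Q q))]
  · simp only [hH.mul_one]
  · refine { bal := fun c Y Z => ?_ }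
    simp only [← hH.mul_assoc, LinearMap.comp_apply]
    exact hH.ev_sw_takeuchi (β := fun P Q => f (H.mul P Y) (H.mul Q Z))
      { bal := fun c X Y => by simp only [hH.mul_assoc, hb, LinearMap.comp_apply] } c X

theorem counit_s_self (b : B) : H.counit (H.s b) = b := by
  have := hH.counit_s b H.one
  rwa [hH.mul_one, hH.counit_one, hH.mulB_one] at this

/-- `L` as a left comodule over itself. -/
@[reducible] def regular : H.LeftComodule L where
  l := H.leftS
  r := H.mul.flip ∘ₗ H.s
  coact := H.comul
  one_l m := by simp only [LinearMap.comp_apply, hH.s_one, hH.one_mul]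
  mul_l a b m := by simp only [LinearMap.comp_apply, hH.s_mul, hH.mul_assoc]
  one_r m := by simp only [LinearMap.comp_apply, LinearMap.flip_apply, hH.s_one, hH.mul_one]
  mul_r a b m := by
    simp only [LinearMap.comp_apply, LinearMap.flip_apply, hH.s_mul, hH.mul_assoc]
  l_r a b m := by simp only [LinearMap.comp_apply, LinearMap.flip_apply, hH.mul_assoc]
  coact_l := hH.comul_s
  coact_r b m := by
    change H.comul (H.mul m (H.s b)) = _
    rw [← cls_sw]
    refine mkQ_diamondRel_eq fun β hβ => ?_
    rw [hH.ev_sw_mul_s hβ, hβ.toBilin.ev_rTensor]; rfl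
  takeuchi := hH.takeuchi
  coassoc := hH.coassoc
  counit_coact := hH.counit_left

end IsLeftBialgebroid

variable (Γ : L →ₗ[k] L →ₗ[k] B)

theorem gmul_eq_ev (X Y : L) : H.gmul Γ X Y = ev (H.sw X) fun P Q => ev (H.sw Y) fun R T =>
    H.mul (H.s (Γ P R)) (H.mul Q T) := by
  rw [gmul, lift_map₂_eq_ev, map_ev]
  simp only [map_ev, TensorProduct.lift.tmul, LinearMap.comp_apply]

@[simp] theorem gmul_add_left (X X' Y : L) :
    H.gmul Γ (X + X') Y = H.gmul Γ X Y + H.gmul Γ X' Y := by simp [gmul_eq_ev]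
@[simp] theorem gmul_smul_left (c : k) (X Y : L) :
    H.gmul Γ (c • X) Y = c • H.gmul Γ X Y := by simp [gmul_eq_ev]
@[simp] theorem gmul_add_right (X Y Y' : L) :
    H.gmul Γ X (Y + Y') = H.gmul Γ X Y + H.gmul Γ X Y' := by simp [gmul_eq_ev]
@[simp] theorem gmul_smul_right (c : k) (X Y : L) :
    H.gmul Γ X (c • Y) = c • H.gmul Γ X Y := by simp [gmul_eq_ev]

/-- The product `Γ(X₍₁₎, Y₍₁₎) X₍₂₎ Y₍₂₎` as a bilinear map. -/
def gmulₗ : L →ₗ[k] L →ₗ[k] L :=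
  LinearMap.mk₂ k (H.gmul Γ) (gmul_add_left Γ) (gmul_smul_left Γ) (gmul_add_right Γ)
    (gmul_smul_right Γ)

theorem gmulₗ_apply (X Y : L) : H.gmulₗ Γ X Y = H.gmul Γ X Y := rfl

namespace LeftComodule

variable (C : H.LeftComodule M) (D : H.LeftComodule N)

theorem twistL_eq_ev (b : B) (m : M) :
    C.twistL Γ b m = ev (C.sw m) fun X n => C.l (Γ (H.s b) X) n := by
  rw [twistL, lift_eq_ev]; rfl

theorem twistR_eq_ev (b : B) (m : M) :
    C.twistR Γ b m = ev (C.sw m) fun X n => C.l (Γ X (H.s b)) n := by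
  rw [twistR, lift_eq_ev]; rfl

/-- The twisted left action as a bilinear map. -/
def twistLₗ : B →ₗ[k] M →ₗ[k] M :=
  LinearMap.mk₂ k (C.twistL Γ) (by intros; simp [twistL_eq_ev]) (by intros; simp [twistL_eq_ev])
    (by intros; simp [twistL_eq_ev]) (by intros; simp [twistL_eq_ev])

/-- The twisted right action as a bilinear map. -/
def twistRₗ : B →ₗ[k] M →ₗ[k] M :=
  LinearMap.mk₂ k (C.twistR Γ) (by intros; simp [twistR_eq_ev]) (by intros; simp [twistR_eq_ev])
    (by intros; simp [twistR_eq_ev]) (by intros; simp [twistR_eq_ev])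

/-- The value of `φ` on `Γ(m₍₋₁₎, n₍₋₁₎) m₍₀₎ ⊗ n₍₀₎`. -/
def sharpEv (C : H.LeftComodule M) (D : H.LeftComodule N) (Γ : L →ₗ[k] L →ₗ[k] B) (m : M)
    (n : N) (φ : M → N → W) : W :=
  ev (C.sw m) fun X p => ev (D.sw n) fun Y q => φ (C.l (Γ X Y) p) q

variable (m m' : M) (n n' : N) (φ ψ : M → N → W)

@[simp] theorem sharpEv_add_left :
    C.sharpEv D Γ (m + m') n φ = C.sharpEv D Γ m n φ + C.sharpEv D Γ m' n φ := by simp [sharpEv]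
@[simp] theorem sharpEv_smul_left (c : k) :
    C.sharpEv D Γ (c • m) n φ = c • C.sharpEv D Γ m n φ := by simp [sharpEv]
@[simp] theorem sharpEv_add_right :
    C.sharpEv D Γ m (n + n') φ = C.sharpEv D Γ m n φ + C.sharpEv D Γ m n' φ := by simp [sharpEv]
@[simp] theorem sharpEv_smul_right (c : k) :
    C.sharpEv D Γ m (c • n) φ = c • C.sharpEv D Γ m n φ := by simp [sharpEv]
@[simp] theorem map_sharpEv (f : W →ₗ[k] W') :
    f (C.sharpEv D Γ m n φ) = C.sharpEv D Γ m n fun x y => f (φ x y) := by simp [sharpEv]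

end LeftComodule
end BialgebroidData
end Cotwist
end

/-! ### The product `gmul` and its role as the coaction after `Γ^#` -/

noncomputable section
namespace Cotwist

variable {k : Type v} [Field k] {B L : Type u} [AddCommGroup B] [Module k B]
  [AddCommGroup L] [Module k L] {M N P Q R : Type u} [AddCommGroup M] [Module k M]
  [AddCommGroup N] [Module k N] [AddCommGroup P] [Module k P] [AddCommGroup Q] [Module k Q]
  [AddCommGroup R] [Module k R] {W : Type*} [AddCommGroup W] [Module k W]

namespace BialgebroidData

variable {H : BialgebroidData k B L}

namespace LeftComodule

/-- Functions on `M × N` that factor through `M ⊗_B N`. -/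
abbrev TBal (C : H.LeftComodule M) (D : H.LeftComodule N) (φ : M → N → W) : Prop :=
  Bal k (fun b m => C.r b m) (fun b n => D.l b n) φ

/-- Functions on `M × N` that factor through `M ⊗_{B^Γ} N`. -/
abbrev TwistBal (C : H.LeftComodule M) (D : H.LeftComodule N) (Γ : L →ₗ[k] L →ₗ[k] B)
    (φ : M → N → W) : Prop :=
  Bal k (C.twistR Γ) (D.twistL Γ) φ

end LeftComodule

namespace IsLeftTwoCocycle

open IsLeftBialgebroid LeftComodule

variable {Γ : L →ₗ[k] L →ₗ[k] B} (hΓ : H.IsLeftTwoCocycle Γ) (hH : H.IsLeftBialgebroid)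
include hΓ hH

theorem gmul_bal_left (Y S : L) : H.DBal H.leftS fun P Q => H.mul (H.s (Γ P Y)) (H.mul Q S) where
  bal b X Z := by simp only [hΓ.linear, hH.s_mul, hH.mul_assoc, LinearMap.comp_apply]

theorem gmul_bal_left' (Y : L) : H.DBal H.leftS fun P Q => H.mul (H.s (Γ P Y)) Q where
  bal b X Z := by simp only [hΓ.linear, hH.s_mul, hH.mul_assoc, LinearMap.comp_apply]

theorem gmul_bal_right (X : L) : H.DBal H.leftS fun R S =>
    ev (H.sw X) fun P Q => H.mul (H.s (Γ P R)) (H.mul Q S) where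
  bal b Y Z := by
    simp only [← hΓ.balanced, LinearMap.comp_apply]
    rw [hH.ev_sw_takeuchi (hΓ.gmul_bal_left hH Y Z)]
    simp only [hH.mul_assoc]

theorem gmul_s_left (b : B) (X : L) :
    H.gmul Γ (H.s b) X = ev (H.sw X) fun P Q => H.mul (H.s (Γ (H.s b) P)) Q := by
  rw [gmul_eq_ev, ev_comm]
  refine ev_congr fun P Q => ?_
  rw [hH.ev_sw_s (hΓ.gmul_bal_left hH P Q), hH.one_mul]

theorem gmul_s_right (b : B) (X : L) :
    H.gmul Γ X (H.s b) = ev (H.sw X) fun P Q => H.mul (H.s (Γ P (H.s b))) Q := by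
  rw [gmul_eq_ev, ev_comm, hH.ev_sw_s (hΓ.gmul_bal_right hH X)]
  simp only [hH.mul_one]

theorem gmul_one_left (X : L) : H.gmul Γ H.one X = X := by
  rw [← hH.s_one, hΓ.gmul_s_left hH, hH.s_one]
  simp only [hΓ.one_left]
  exact hH.ev_sw_counit_left X

theorem gmul_one_right (X : L) : H.gmul Γ X H.one = X := by
  rw [← hH.s_one, hΓ.gmul_s_right hH, hH.s_one]
  simp only [hΓ.one_right]
  exact hH.ev_sw_counit_left X

theorem gmul_s_s (a b : B) : H.gmul Γ (H.s a) (H.s b) = H.s (Γ (H.s a) (H.s b)) := by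
  rw [hΓ.gmul_s_left hH, hH.ev_sw_s, hH.mul_one]
  refine { bal := fun c Y Z => ?_ }
  simp only [← hΓ.balanced, LinearMap.comp_apply, ← hH.mul_assoc]
  rw [hH.s_t_comm, hΓ.linear, hH.s_mul]

/-- Since `ε(X₍₂₎ Y₍₂₎) = ε(X₍₂₎ ε(Y₍₂₎))`, the Takeuchi condition and the balancing of `Γ` carry
`ε(Y₍₂₎)` to the other leg of `Y`, where the counit laws absorb it. Thus `Γ` can be recovered from
`gmul`, and identities for a cocycle can be read off from identities for the product. -/
theorem counit_gmul (X Y : L) : H.counit (H.gmul Γ X Y) = Γ X Y := by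
  rw [gmul_eq_ev, ev_comm]
  simp only [map_ev, hH.counit_s]
  have hb : ∀ Y, H.DBal H.leftS fun P Q => H.mulB (Γ P Y) (H.counit Q) := fun Y =>
    { bal := fun b X Z => by
        simp only [hΓ.linear, hH.mulB_assoc, LinearMap.comp_apply, hH.counit_s] }
  have h1 : ∀ S T, ev (H.sw X) (fun P Q => H.mulB (Γ P S) (H.counit (H.mul Q T))) =
      Γ X (H.mul (H.t (H.counit T)) S) := by
    intro S T
    simp only [hH.counit_mul_s _ T]
    rw [← hH.ev_sw_takeuchi (hb S) (H.counit T) X]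
    simp only [hΓ.balanced, ← hΓ.linear]
    conv_rhs => rw [← hH.ev_sw_counit_right X, map_ev, linearMap_ev_apply]
  simp only [h1]
  rw [← map_ev, hH.ev_sw_counit_right]

/-- The coaction of `Γ(m₍₋₁₎, n₍₋₁₎) m₍₀₎ ⊗ n₍₀₎` is given by the product `gmul`. -/
theorem sharpEv_coact {C : H.LeftComodule M} {D : H.LeftComodule N} {Ψ : L → M → N → W}
    (hΨ : Bal₃ k (fun b X => H.mul (H.t b) X) (fun b m => C.l b m) (fun b m => C.r b m)
      (fun b n => D.l b n) Ψ) (m : M) (n : N) :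
    C.sharpEv D Γ m n (fun m' n' =>
        ev (C.sw m') fun X p => ev (D.sw n') fun Y q => Ψ (H.mul X Y) p q) =
      ev (C.sw m) fun X p => ev (D.sw n) fun Y q => Ψ (H.gmul Γ X Y) p q := by
  obtain ⟨f, rfl⟩ := hΨ.exists_eq
  have hb₁ : ∀ b X p q, f (H.mul (H.t b) X) p q = f X (C.l b p) q := hΨ.bal₁
  have hb₂ : ∀ b X p q, f X (C.r b p) q = f X p (D.l b q) := hΨ.bal₂
  have h1 : ∀ X Y p q, ev (C.sw (C.l (Γ X Y) p))
      (fun X' p' => ev (D.sw q) fun Y' q' => f (H.mul X' Y') p' q') =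
      ev (C.sw p) fun X' p' => ev (D.sw q) fun Y' q' =>
        f (H.mul (H.s (Γ X Y)) (H.mul X' Y')) p' q' := by
    intro X Y p q
    rw [ev_sw_l (β := fun X' p' => ev (D.sw q) fun Y' q' => f (H.mul X' Y') p' q')
      { bal := fun b X p => by simp only [hH.mul_assoc, hb₁] }]
    simp only [hH.mul_assoc]
  simp only [sharpEv, h1]
  simp only [ev_comm (D.sw n) (C.sw _)]
  -- Coassociativity of `C` makes the two coefficients of `m` the two legs of one coproduct: the
  -- first goes into `Γ`, the second into the product.
  have h2 := ev_sw_coassoc (C := C) (γ := fun X Z p => ev (D.sw n) fun Y q => ev (D.sw q)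
      fun Y' q' => f (H.mul (H.s (Γ X Y)) (H.mul Z Y')) p q')
    { bal₁ := fun b X Z p => by simp only [hΓ.linear, hH.s_mul, hH.mul_assoc]
      bal₂ := fun b X Z p => by
        simp only [← hb₁, ← hH.mul_assoc, hH.s_t_comm] } m
  rw [← h2]
  have h3 : ∀ Y Y' p q, H.DBal H.leftS fun X' Z =>
      f (H.mul (H.s (Γ X' Y)) (H.mul Z Y')) p q := fun Y Y' p q =>
    { bal := fun c X Z => by
        simp only [hΓ.linear, hH.s_mul, hH.mul_assoc, LinearMap.comp_apply] }
  have h4 : ∀ Y Y' q, H.DBal C.l fun X p => ev (H.sw X) fun X' Z =>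
      f (H.mul (H.s (Γ X' Y)) (H.mul Z Y')) p q := fun Y Y' q =>
    { bal := fun c X p => by
        rw [hH.ev_sw_t_mul (h3 Y Y' p q)]
        simp only [← hb₁, ← hH.mul_assoc, hH.s_t_comm] }
  -- The balancing needed to apply coassociativity of `D` in the same way. The first relation uses
  -- the Takeuchi condition of `L`, the second that of `C`.
  have h5 : H.DBal₃ D.l fun Y Y' q => ev (C.sw m) fun X p => ev (H.sw X) fun X' Z =>
      f (H.mul (H.s (Γ X' Y)) (H.mul Z Y')) p q :=
    { bal₁ := fun b Y Y' q => by
        refine ev_congr fun X p => ?_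
        simp only [← hΓ.balanced]
        rw [hH.ev_sw_takeuchi (h3 Y Y' p q)]
        simp only [hH.mul_assoc]
      bal₂ := fun b Y Y' q => by
        simp only [← hb₂]
        rw [← ev_sw_takeuchi (h4 Y Y' q)]
        refine ev_congr fun X p => ?_
        rw [hH.ev_sw_mul_t (h3 Y Y' p q)]
        simp only [hH.mul_assoc] }
  simp only [ev_comm (H.sw _) (D.sw n)]
  rw [ev_comm (C.sw m) (D.sw n)]
  simp only [ev_comm (H.sw _) (D.sw _)]
  simp only [ev_comm (C.sw m) (D.sw _)]
  rw [← ev_sw_coassoc h5]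
  simp only [ev_comm (H.sw _) (C.sw m)]
  refine ev_congr fun Y q => ?_
  refine ev_congr fun X p => ?_
  rw [ev_comm (H.sw Y) (H.sw X), gmul_eq_ev]
  simp only [map_ev, linearMap_ev_apply]

end IsLeftTwoCocycle

end BialgebroidData
end Cotwist
end

/-! ### Comodule maps, associativity of `Γ^#`, and the twisted base actions -/

noncomputable section
set_option linter.unusedSectionVars false
namespace Cotwist

variable {k : Type v} [Field k] {B L : Type u} [AddCommGroup B] [Module k B]
  [AddCommGroup L] [Module k L] {M N P Q R : Type u} [AddCommGroup M] [Module k M]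
  [AddCommGroup N] [Module k N] [AddCommGroup P] [Module k P] [AddCommGroup Q] [Module k Q]
  [AddCommGroup R] [Module k R] {W : Type*} [AddCommGroup W] [Module k W]

namespace BialgebroidData

variable {H : BialgebroidData k B L}

namespace LeftComodule

/-- A linear map of left comodules. -/
structure IsColinear (C : H.LeftComodule M) (D : H.LeftComodule N) (f : M →ₗ[k] N) : Prop where
  map_l : ∀ b m, f (C.l b m) = D.l b (f m)
  ev_sw : ∀ (m : M) (β : L → N → (L ⊗[k] N) ⧸ H.diamondRel D.l), H.DBal D.l β →
    ev (D.sw (f m)) β = ev (C.sw m) fun X n => β X (f n)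

/-- A bilinear map `M × N → P` that factors through a comodule map `M ⊗_B N → P`. -/
structure IsCobilinear (C : H.LeftComodule M) (D : H.LeftComodule N) (E : H.LeftComodule P)
    (f : M →ₗ[k] N →ₗ[k] P) : Prop where
  bal : ∀ b m n, f (C.r b m) n = f m (D.l b n)
  map_l : ∀ b m n, f (C.l b m) n = E.l b (f m n)
  ev_sw : ∀ (m : M) (n : N) (β : L → P → (L ⊗[k] P) ⧸ H.diamondRel E.l), H.DBal E.l β →
    ev (E.sw (f m n)) β = ev (C.sw m) fun X p => ev (D.sw n) fun Y q => β (H.mul X Y) (f p q)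

variable {C : H.LeftComodule M} {D : H.LeftComodule N} {E : H.LeftComodule P}

/-- Frees the target: what is known for functions valued in the quotient holds for balanced
functions into any vector space. It lets the coaction laws in `IsColinear` and `IsCobilinear` be
stated for one target and used for all. -/
theorem ev_eq_of_mkQ {B : Type*} {r : B → M → M} {l : B → N → N} {z w : M ⊗[k] N}
    (h : ∀ β : M → N → (M ⊗[k] N) ⧸ balRel k r l, Bal k r l β → ev z β = ev w β)
    {β : M → N → W} (hβ : Bal k r l β) : ev z β = ev w β :=
  hβ.ev_congr (mkQ_balRel_eq h)

theorem IsColinear.ev_sw' {f : M →ₗ[k] N} (hf : C.IsColinear D f) (m : M) {β : L → N → W}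
    (hβ : H.DBal D.l β) : ev (D.sw (f m)) β = ev (C.sw m) fun X n => β X (f n) := by
  have h := ev_eq_of_mkQ (z := D.sw (f m)) (w := ev (C.sw m) fun X n => X ⊗ₜ[k] f n)
    (fun β hβ => by
      refine (hf.ev_sw m β hβ).trans ?_
      rw [ev_ev]; simp only [hβ.toBilin.ev_tmul]; rfl) hβ
  rw [h, ev_ev]; simp only [hβ.toBilin.ev_tmul]

theorem IsCobilinear.ev_sw' {f : M →ₗ[k] N →ₗ[k] P} (hf : C.IsCobilinear D E f) (m : M) (n : N)
    {β : L → P → W} (hβ : H.DBal E.l β) : ev (E.sw (f m n)) β =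
      ev (C.sw m) fun X p => ev (D.sw n) fun Y q => β (H.mul X Y) (f p q) := by
  have h := ev_eq_of_mkQ (z := E.sw (f m n)) (w := ev (C.sw m) fun X p => ev (D.sw n) fun Y q =>
      H.mul X Y ⊗ₜ[k] f p q)
    (fun β hβ => by
      refine (hf.ev_sw m n β hβ).trans ?_
      simp only [ev_ev, hβ.toBilin.ev_tmul]; rfl) hβ
  rw [h]; simp only [ev_ev, hβ.toBilin.ev_tmul]

end LeftComodule

namespace IsLeftTwoCocycle

open IsLeftBialgebroid LeftComodule

variable {Γ : L →ₗ[k] L →ₗ[k] B} (hΓ : H.IsLeftTwoCocycle Γ) (hH : H.IsLeftBialgebroid)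

include hΓ hH

variable {C : H.LeftComodule M} {D : H.LeftComodule N} {E : H.LeftComodule P}
  {F : H.LeftComodule Q} {G : H.LeftComodule R}

/-- Coassociativity joins the coefficient used in the action with the remaining one into a single
coproduct, and `b ·_Γ m` has coaction `(b * m₍₋₁₎) ⊗ m₍₀₎`. -/
theorem ev_sw_twistL {β : L → M → W} (hβ : H.DBal C.l β) (b : B) (m : M) :
    ev (C.sw (C.twistL Γ b m)) β = ev (C.sw m) fun X n => β (H.gmul Γ (H.s b) X) n := by
  obtain ⟨f, rfl⟩ := hβ.exists_eq
  have hb : ∀ b X p, f (H.mul (H.t b) X) p = f X (C.l b p) := hβ.bal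
  have h1 : ∀ X, H.DBal C.l fun Y p => f (H.mul (H.s (Γ (H.s b) X)) Y) p := fun X =>
    { bal := fun c Y p => by simp only [← hb, ← hH.mul_assoc, hH.s_t_comm] }
  rw [twistL_eq_ev, map_ev, ev_ev]
  simp only [ev_sw_l hβ]
  rw [← ev_sw_coassoc (γ := fun X Y p => f (H.mul (H.s (Γ (H.s b) X)) Y) p)]
  · simp only [hΓ.gmul_s_left hH, map_ev, linearMap_ev_apply]
  · refine { bal₁ := fun c X Y p => ?_, bal₂ := fun c X Y p => (h1 X).bal c Y p }
    simp only [← hΓ.balanced, ← hH.mul_assoc]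
    rw [hH.s_t_comm, hΓ.linear, hH.s_mul]

theorem ev_sw_twistR {β : L → M → W} (hβ : H.DBal C.l β) (b : B) (m : M) :
    ev (C.sw (C.twistR Γ b m)) β = ev (C.sw m) fun X n => β (H.gmul Γ X (H.s b)) n := by
  obtain ⟨f, rfl⟩ := hβ.exists_eq
  have hb : ∀ b X p, f (H.mul (H.t b) X) p = f X (C.l b p) := hβ.bal
  have h1 : ∀ X, H.DBal C.l fun Y p => f (H.mul (H.s (Γ X (H.s b))) Y) p := fun X =>
    { bal := fun c Y p => by simp only [← hb, ← hH.mul_assoc, hH.s_t_comm] }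
  rw [twistR_eq_ev, map_ev, ev_ev]
  simp only [ev_sw_l hβ]
  rw [← ev_sw_coassoc (γ := fun X Y p => f (H.mul (H.s (Γ X (H.s b))) Y) p)]
  · simp only [hΓ.gmul_s_right hH, map_ev, linearMap_ev_apply]
  · refine { bal₁ := fun c X Y p => ?_, bal₂ := fun c X Y p => (h1 X).bal c Y p }
    simp only [hΓ.linear, hH.s_mul, hH.mul_assoc]

theorem sharpEv_bal_inner {φ : M → N → W} (hφ : C.TBal D φ) (n : N) :
    H.DBal C.l fun X p => ev (D.sw n) fun Y q => φ (C.l (Γ X Y) p) q := by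
  obtain ⟨f, rfl⟩ := hφ.exists_eq
  exact { bal := fun b X p => by simp only [hΓ.linear, C.mul_l] }

theorem sharpEv_bal_outer {φ : M → N → W} (hφ : C.TBal D φ) (m : M) :
    H.DBal D.l fun Y q => ev (C.sw m) fun X p => φ (C.l (Γ X Y) p) q := by
  obtain ⟨f, rfl⟩ := hφ.exists_eq
  have hb : ∀ b p q, f (C.r b p) q = f p (D.l b q) := hφ.bal
  refine { bal := fun b Y q => ?_ }
  have h1 : H.DBal C.l fun X p => f (C.l (Γ X Y) p) q :=
    { bal := fun b X p => by simp only [hΓ.linear, C.mul_l] }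
  simp only [← hΓ.balanced, ← hb, ← C.l_r]
  rw [ev_sw_takeuchi h1]

/-- Once the coactions of `m ·_Γ b` and `b ·_Γ n` are expressed through `gmul`, this is the cocycle
identity with `s(b)` as middle argument. It is why `Γ^#` descends to `M ⊗_{B^Γ} N`. -/
theorem sharpEv_twistR {φ : M → N → W} (hφ : C.TBal D φ) (b : B) (m : M) (n : N) :
    C.sharpEv D Γ (C.twistR Γ b m) n φ = C.sharpEv D Γ m (D.twistL Γ b n) φ := by
  rw [sharpEv, hΓ.ev_sw_twistR hH (hΓ.sharpEv_bal_inner hH hφ n), sharpEv,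
    ev_comm (C.sw m) (D.sw (D.twistL Γ b n)),
    hΓ.ev_sw_twistL hH (hΓ.sharpEv_bal_outer hH hφ m), ev_comm (C.sw m) (D.sw n)]
  simp only [hΓ.cocycle]

theorem sharpEv_twistBal {φ : M → N → W} (hφ : C.TBal D φ) :
    C.TwistBal D Γ fun m n => C.sharpEv D Γ m n φ :=
  { bal := fun b m n => hΓ.sharpEv_twistR hH hφ b m n }

theorem ev_sw_sharpEv {f : M →ₗ[k] N →ₗ[k] P} (hf : C.IsCobilinear D E f) {β : L → P → W}
    (hβ : H.DBal E.l β) (m : M) (n : N) :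
    ev (E.sw (C.sharpEv D Γ m n fun p q => f p q)) β =
      ev (C.sw m) fun X p => ev (D.sw n) fun Y q => β (H.gmul Γ X Y) (f p q) := by
  rw [map_sharpEv]
  -- Evaluation at `β` as an honest linear map in `z`, so that it can be moved inside `sharpEv`.
  have h : ∀ z : L ⊗[k] P, ev z β = (TensorProduct.lift hβ.exists_eq.choose) z := fun z => by
    conv_lhs => rw [hβ.exists_eq.choose_spec]
    rw [ev_eq_lift]
  rw [h, map_sharpEv]
  simp only [← h, hf.ev_sw' _ _ hβ]
  obtain ⟨g, rfl⟩ := hβ.exists_eq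
  have hb : ∀ b X p, g (H.mul (H.t b) X) p = g X (E.l b p) := hβ.bal
  exact hΓ.sharpEv_coact hH (Ψ := fun X p q => g X (f p q))
    { bal₁ := fun b X p q => by simp only [hb, hf.map_l]
      bal₂ := fun b X p q => by simp only [hf.bal] } m n

/-- Associativity of the operation `m ⊗ n ↦ Γ(m₍₋₁₎, n₍₋₁₎) m₍₀₎ ⊗ n₍₀₎`. -/
theorem sharpEv_assoc {f : M →ₗ[k] N →ₗ[k] Q} (hf : C.IsCobilinear D F f)
    {g : N →ₗ[k] P →ₗ[k] R} (hg : D.IsCobilinear E G g) {ψ : Q → P → W} (hψ : F.TBal E ψ)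
    {χ : M → R → W} (hχ : C.TBal G χ) (h : ∀ m n p, ψ (f m n) p = χ m (g n p))
    (m : M) (n : N) (p : P) :
    F.sharpEv E Γ (C.sharpEv D Γ m n fun x y => f x y) p ψ =
      C.sharpEv G Γ m (D.sharpEv E Γ n p fun x y => g x y) χ := by
  rw [sharpEv, hΓ.ev_sw_sharpEv hH hf (hΓ.sharpEv_bal_inner hH hψ p), sharpEv,
    ev_comm (C.sw m) (G.sw _), hΓ.ev_sw_sharpEv hH hg (hΓ.sharpEv_bal_outer hH hχ m)]
  -- Both sides now carry `Γ` with one argument a `gmul`; the cocycle identity matches the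
  -- coefficients and `h` the arguments.
  simp only [hΓ.cocycle, ← h, hf.map_l]
  rw [ev_comm (C.sw m) (D.sw n)]
  refine ev_congr fun Y q => ?_
  rw [ev_comm (C.sw m) (E.sw p)]

/-- The cocycle identity at `s(a)`, `s(b)`, using `s(a) * s(b) = s(a ·_Γ b)`. This law, its
right-handed analogue, the commutation of the two actions and the unit laws make `M` a
`B^Γ`-bimodule. -/
theorem twistL_mulB (a b : B) (m : M) :
    C.twistL Γ (Γ (H.s a) (H.s b)) m = C.twistL Γ a (C.twistL Γ b m) := by
  have h1 : H.DBal C.l fun X n => C.l (Γ (H.s a) X) n :=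
    { bal := fun c X n => by
        rw [← hΓ.balanced, hH.s_t_comm, hΓ.linear, C.mul_l] }
  rw [twistL_eq_ev, twistL_eq_ev, hΓ.ev_sw_twistL hH h1]
  simp only [hΓ.cocycle, hΓ.gmul_s_s hH]

theorem twistR_mulB (a b : B) (m : M) :
    C.twistR Γ (Γ (H.s a) (H.s b)) m = C.twistR Γ b (C.twistR Γ a m) := by
  have h1 : H.DBal C.l fun X n => C.l (Γ X (H.s b)) n :=
    { bal := fun c X n => by rw [hΓ.linear, C.mul_l] }
  rw [twistR_eq_ev, twistR_eq_ev, hΓ.ev_sw_twistR hH h1]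
  simp only [← hΓ.cocycle, hΓ.gmul_s_s hH]

theorem twistL_twistR (a b : B) (m : M) :
    C.twistL Γ a (C.twistR Γ b m) = C.twistR Γ b (C.twistL Γ a m) := by
  have h1 : H.DBal C.l fun X n => C.l (Γ X (H.s b)) n :=
    { bal := fun c X n => by rw [hΓ.linear, C.mul_l] }
  have h2 : H.DBal C.l fun X n => C.l (Γ (H.s a) X) n :=
    { bal := fun c X n => by
        rw [← hΓ.balanced, hH.s_t_comm, hΓ.linear, C.mul_l] }
  rw [twistR_eq_ev Γ C b (C.twistL Γ a m), hΓ.ev_sw_twistL hH h1, twistL_eq_ev, hΓ.ev_sw_twistR hH h2]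
  simp only [hΓ.cocycle]

theorem twistL_one (m : M) : C.twistL Γ H.oneB m = m := by
  rw [twistL_eq_ev, hH.s_one]
  simp only [hΓ.one_left]
  exact ev_sw_counit m

theorem twistR_one (m : M) : C.twistR Γ H.oneB m = m := by
  rw [twistR_eq_ev, hH.s_one]
  simp only [hΓ.one_right]
  exact ev_sw_counit m

end IsLeftTwoCocycle

end BialgebroidData
end Cotwist
end

/-! ### The translation map `X ↦ X₊ ⊗ X₋` -/

noncomputable section
set_option linter.unusedSectionVars false
namespace Cotwist

section Quotients

variable {k : Type v} [Field k] {V W : Type u} [AddCommGroup V] [Module k V]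
  [AddCommGroup W] [Module k W]

theorem induced_mkQ {N : Submodule k V} {P : Submodule k W} {f : V →ₗ[k] W}
    (h : N ≤ P.comap f) (x : V) : induced N P f (N.mkQ x) = P.mkQ (f x) := by
  rw [induced, dif_pos h]; rfl

theorem apply_inverse {f : V →ₗ[k] W} (h : Function.Bijective f) (y : W) :
    f (inverse f y) = y := by
  rw [inverse, dif_pos h]
  exact LinearEquiv.apply_symm_apply (LinearEquiv.ofBijective f h) y

theorem inverse_apply {f : V →ₗ[k] W} (h : Function.Bijective f) (x : V) :
    inverse f (f x) = x :=
  h.1 (apply_inverse h (f x))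

end Quotients

variable {k : Type v} [Field k] {B L : Type u} [AddCommGroup B] [Module k B]
  [AddCommGroup L] [Module k L] {W : Type*} [AddCommGroup W] [Module k W]

namespace BialgebroidData

variable {H : BialgebroidData k B L}

variable (H) in
/-- The value of `β` on `X₍₁₎ ⊗ X₍₂₎ Y`. -/
def lamEv (β : L → L → W) (X Y : L) : W := ev (H.sw X) fun P Q => β P (H.mul Q Y)

theorem lamEv_bilin {β : L → L → W} (hβ : Bilin k β) : Bilin k (H.lamEv β) := by
  obtain ⟨f, rfl⟩ := hβ.exists_eq
  constructor <;> simp [lamEv]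

variable (H) in
/-- The map `X ⊗ Y ↦ X₍₁₎ ⊗ X₍₂₎ Y` on representatives. -/
def lamRaw : L ⊗[k] L →ₗ[k] L ⊗[k] L :=
  (TensorProduct.lift H.mul).lTensor L ∘ₗ
    (TensorProduct.assoc k L L L).toLinearMap ∘ₗ H.sw.rTensor L

theorem ev_lamRaw {β : L → L → W} (hβ : Bilin k β) (z : L ⊗[k] L) :
    ev (H.lamRaw z) β = ev z (H.lamEv β) := by
  obtain ⟨f, rfl⟩ := hβ.exists_eq
  rw [lamRaw, LinearMap.comp_apply, hβ.ev_lTensor]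
  simp only [lift_eq_ev, map_ev]
  exact ev_assoc_rTensor (W := W) (LinearMap.mk₂ k (fun X Y => f X ∘ₗ H.mul Y)
    (by intros; ext; simp) (by intros; ext; simp) (by intros; ext; simp)
    (by intros; ext; simp)) H.sw z

namespace IsLeftBialgebroid

variable (hH : H.IsLeftBialgebroid)
include hH

theorem mul_right_dbal {β : L → L → W} (hβ : H.DBal H.leftS β) (Y : L) :
    H.DBal H.leftS fun P Q => β P (H.mul Q Y) := by
  obtain ⟨f, rfl⟩ := hβ.exists_eq
  have hb : ∀ b X Y, f (H.mul (H.t b) X) Y = f X (H.mul (H.s b) Y) := hβ.bal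
  exact { bal := fun b P Q => by simp only [hb, hH.mul_assoc, LinearMap.comp_apply] }

theorem lamEv_barBal {β : L → L → W} (hβ : H.DBal H.leftS β) : H.BarBal (H.lamEv β) where
  toBilin := lamEv_bilin hβ.toBilin
  bal b X Y := by
    simp only [lamEv]
    rw [hH.ev_sw_mul_t (hH.mul_right_dbal hβ Y)]
    simp only [hH.mul_assoc]

theorem barRel_le : H.barRel ≤ (H.diamondRel H.leftS).comap H.lamRaw := by
  refine Submodule.span_le.2 ?_
  rintro _ ⟨b, X, Y, rfl⟩
  rw [SetLike.mem_coe, Submodule.mem_comap, map_sub]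
  refine (Submodule.Quotient.eq _).1 (mkQ_diamondRel_eq fun β hβ => ?_)
  rw [ev_lamRaw hβ.toBilin, ev_lamRaw hβ.toBilin, (lamEv_bilin hβ.toBilin).ev_tmul,
    (lamEv_bilin hβ.toBilin).ev_tmul, (hH.lamEv_barBal hβ).bal]

theorem lam_mkQ (z : L ⊗[k] L) : H.lam (H.barRel.mkQ z) = H.cls (H.lamRaw z) :=
  induced_mkQ hH.barRel_le z

end IsLeftBialgebroid

namespace IsLeftHopfAlgebroid

variable (hH : H.IsLeftHopfAlgebroid)
include hH

/-- Injectivity of `λ`: an identity in `L ⊗_{B̄} L` may be checked after applying `λ`. -/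
theorem ev_eq_of_lam {z w : L ⊗[k] L} (h : ∀ β : L → L → H.Diamond, H.DBal H.leftS β →
      ev z (H.lamEv β) = ev w (H.lamEv β)) {β : L → L → W} (hβ : H.BarBal β) :
    ev z β = ev w β := by
  refine hβ.ev_congr (hH.lam_bijective.1 ?_)
  refine (hH.lam_mkQ z).trans (.trans ?_ (hH.lam_mkQ w).symm)
  refine mkQ_diamondRel_eq fun β hβ => ?_
  rw [ev_lamRaw hβ.toBilin, ev_lamRaw hβ.toBilin]
  exact h β hβ

/-- `X₊₍₁₎ ⊗ X₊₍₂₎ X₋ = X ⊗ 1` -/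
theorem ev_pm_lam {β : L → L → W} (hβ : H.DBal H.leftS β) (X : L) :
    ev (H.pm X) (H.lamEv β) = β X H.one := by
  rw [← ev_lamRaw hβ.toBilin, ← hβ.toBilin.ev_tmul]
  refine hβ.ev_congr ?_
  refine (hH.lam_mkQ _).symm.trans ?_
  rw [pm, LinearMap.comp_apply, mkQ_rep, LinearMap.comp_apply,
    apply_inverse hH.lam_bijective]
  rfl

theorem ev_pm_lam' {β : L → L → W} (hβ : H.DBal H.leftS β) (X Y : L) :
    ev (H.pm X) (fun p q => ev (H.sw p) fun P Q => β P (H.mul Q (H.mul q Y))) = β X Y := by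
  have := hH.ev_pm_lam (hH.mul_right_dbal hβ Y) X
  rw [hH.one_mul] at this
  rw [← this]
  refine ev_congr fun p q => ?_
  simp only [lamEv, hH.mul_assoc]

/-- `X₊ ⊗ X₋` is the only class that `λ` sends to `X ⊗ 1`. Formulas for the translation map of an
element are verified by applying `λ` to the proposed value. -/
theorem ev_pm_eq {X : L} {w : L ⊗[k] L} (h : ∀ β : L → L → H.Diamond, H.DBal H.leftS β →
      ev w (H.lamEv β) = β X H.one) {β : L → L → W} (hβ : H.BarBal β) :
    ev (H.pm X) β = ev w β :=
  hH.ev_eq_of_lam (fun β hβ => by rw [hH.ev_pm_lam hβ, h β hβ]) hβ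

/-- `X₍₁₎₊ ⊗ X₍₁₎₋ X₍₂₎ = X ⊗ 1` -/
theorem ev_sw_pm {β : L → L → W} (hβ : H.BarBal β) (X Y : L) :
    ev (H.sw X) (fun P Q => ev (H.pm P) fun p q => β p (H.mul q (H.mul Q Y))) = β X Y := by
  have := hH.ev_eq_of_lam (z := ev (H.sw X) fun P Q => ev (H.pm P) fun p q =>
    p ⊗ₜ[k] H.mul q (H.mul Q Y)) (w := X ⊗ₜ[k] Y) (fun β hβ => ?_) hβ
  · simpa only [ev_ev, hβ.toBilin.ev_tmul] using this
  · simp only [ev_ev, (lamEv_bilin hβ.toBilin).ev_tmul]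
    simp only [lamEv]
    refine ev_congr fun P Q => ?_
    exact hH.ev_pm_lam' hβ P _

theorem ev_sw_pm_one {β : L → L → W} (hβ : H.BarBal β) (X : L) :
    ev (H.sw X) (fun P Q => ev (H.pm P) fun p q => β p (H.mul q Q)) = β X H.one := by
  have := hH.ev_sw_pm hβ X H.one
  simpa only [hH.mul_one] using this

/-- `b̄ X₊ ⊗ X₋ = X₊ ⊗ X₋ b̄` -/
theorem ev_pm_takeuchi {β : L → L → W} (hβ : H.BarBal β) (b : B) (X : L) :
    ev (H.pm X) (fun p q => β (H.mul (H.t b) p) q) =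
      ev (H.pm X) fun p q => β p (H.mul q (H.t b)) := by
  have := hH.ev_eq_of_lam (z := ev (H.pm X) fun p q => H.mul (H.t b) p ⊗ₜ[k] q)
    (w := ev (H.pm X) fun p q => p ⊗ₜ[k] H.mul q (H.t b)) (fun β hβ => ?_) hβ
  · simpa only [ev_ev, hβ.toBilin.ev_tmul] using this
  · simp only [ev_ev, (lamEv_bilin hβ.toBilin).ev_tmul]
    have h1 := hH.ev_pm_lam' hβ X (H.t b)
    simp only [lamEv]
    rw [h1]
    simp only [hH.ev_sw_t_mul (hH.mul_right_dbal hβ _), hH.mul_assoc]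
    have hb : H.DBal H.leftS fun P Q => β P (H.mul (H.t b) Q) := by
      obtain ⟨f, rfl⟩ := hβ.exists_eq
      have hb : ∀ b X Y, f (H.mul (H.t b) X) Y = f X (H.mul (H.s b) Y) := hβ.bal
      exact { bal := fun c P Q => by
                simp only [hb, ← hH.mul_assoc, LinearMap.comp_apply, hH.s_t_comm] }
    have h2 := hH.ev_pm_lam hb X
    rw [hH.mul_one] at h2
    exact h2

theorem ev_pm_s_mul {β : L → L → W} (hβ : H.BarBal β) (b : B) (X : L) :
    ev (H.pm (H.mul (H.s b) X)) β = ev (H.pm X) fun p q => β (H.mul (H.s b) p) q := by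
  have := hH.ev_pm_eq (X := H.mul (H.s b) X)
    (w := ev (H.pm X) fun p q => H.mul (H.s b) p ⊗ₜ[k] q) (fun β hβ => ?_) hβ
  · simpa only [ev_ev, hβ.toBilin.ev_tmul] using this
  · simp only [ev_ev, (lamEv_bilin hβ.toBilin).ev_tmul]
    simp only [lamEv, hH.ev_sw_s_mul (hH.mul_right_dbal hβ _)]
    obtain ⟨f, rfl⟩ := hβ.exists_eq
    have hb : ∀ b X Y, f (H.mul (H.t b) X) Y = f X (H.mul (H.s b) Y) := hβ.bal
    exact hH.ev_pm_lam (β := fun P Q => f (H.mul (H.s b) P) Q)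
      { bal := fun c P Q => by
          rw [← hH.mul_assoc, hH.s_t_comm, hH.mul_assoc, hb]; rfl } X

theorem ev_pm_mul_s {β : L → L → W} (hβ : H.BarBal β) (b : B) (X : L) :
    ev (H.pm (H.mul X (H.s b))) β = ev (H.pm X) fun p q => β (H.mul p (H.s b)) q := by
  have := hH.ev_pm_eq (X := H.mul X (H.s b))
    (w := ev (H.pm X) fun p q => H.mul p (H.s b) ⊗ₜ[k] q) (fun β hβ => ?_) hβ
  · simpa only [ev_ev, hβ.toBilin.ev_tmul] using this
  · simp only [ev_ev, (lamEv_bilin hβ.toBilin).ev_tmul]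
    simp only [lamEv, hH.ev_sw_mul_s (hH.mul_right_dbal hβ _)]
    obtain ⟨f, rfl⟩ := hβ.exists_eq
    have hb : ∀ b X Y, f (H.mul (H.t b) X) Y = f X (H.mul (H.s b) Y) := hβ.bal
    exact hH.ev_pm_lam (β := fun P Q => f (H.mul P (H.s b)) Q)
      { bal := fun c P Q => by
          rw [hH.mul_assoc, hb]; rfl } X

theorem ev_pm_t_mul {β : L → L → W} (hβ : H.BarBal β) (b : B) (X : L) :
    ev (H.pm (H.mul (H.t b) X)) β = ev (H.pm X) fun p q => β p (H.mul q (H.s b)) := by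
  have := hH.ev_pm_eq (X := H.mul (H.t b) X)
    (w := ev (H.pm X) fun p q => p ⊗ₜ[k] H.mul q (H.s b)) (fun β hβ => ?_) hβ
  · simpa only [ev_ev, hβ.toBilin.ev_tmul] using this
  · simp only [ev_ev, (lamEv_bilin hβ.toBilin).ev_tmul]
    simp only [lamEv, hH.ev_pm_lam' hβ]
    rw [hβ.bal, LinearMap.comp_apply, hH.mul_one]

theorem ev_pm_mul_t {β : L → L → W} (hβ : H.BarBal β) (b : B) (X : L) :
    ev (H.pm (H.mul X (H.t b))) β = ev (H.pm X) fun p q => β p (H.mul (H.s b) q) := by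
  have := hH.ev_pm_eq (X := H.mul X (H.t b))
    (w := ev (H.pm X) fun p q => p ⊗ₜ[k] H.mul (H.s b) q) (fun β hβ => ?_) hβ
  · simpa only [ev_ev, hβ.toBilin.ev_tmul] using this
  · simp only [ev_ev, (lamEv_bilin hβ.toBilin).ev_tmul]
    simp only [lamEv, ← hH.mul_assoc]
    have h1 : ∀ p q, ev (H.sw p) (fun P Q => β P (H.mul (H.mul Q (H.s b)) q)) =
        ev (H.sw p) fun P Q => β (H.mul P (H.t b)) (H.mul Q q) := fun p q =>
      (hH.ev_sw_takeuchi (hH.mul_right_dbal hβ q) b p).symm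
    simp only [h1]
    obtain ⟨f, rfl⟩ := hβ.exists_eq
    have hb : ∀ b X Y, f (H.mul (H.t b) X) Y = f X (H.mul (H.s b) Y) := hβ.bal
    exact hH.ev_pm_lam (β := fun P Q => f (H.mul P (H.t b)) Q)
      { bal := fun c P Q => by rw [hH.mul_assoc, hb]; rfl } X

/-- `(X Y)₊ ⊗ (X Y)₋ = X₊ Y₊ ⊗ Y₋ X₋` -/
theorem ev_pm_mul {β : L → L → W} (hβ : H.BarBal β) (X Y : L) :
    ev (H.pm (H.mul X Y)) β = ev (H.pm X) fun p q => ev (H.pm Y) fun r s =>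
      β (H.mul p r) (H.mul s q) := by
  have := hH.ev_pm_eq (X := H.mul X Y)
    (w := ev (H.pm X) fun p q => ev (H.pm Y) fun r s => H.mul p r ⊗ₜ[k] H.mul s q)
    (fun β hβ => ?_) hβ
  · simpa only [ev_ev, hβ.toBilin.ev_tmul] using this
  · simp only [ev_ev, (lamEv_bilin hβ.toBilin).ev_tmul]
    simp only [lamEv, hH.ev_sw_mul (hH.mul_right_dbal hβ _)]
    obtain ⟨f, rfl⟩ := hβ.exists_eq
    have hb : ∀ b X Y, f (H.mul (H.t b) X) Y = f X (H.mul (H.s b) Y) := hβ.bal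
    -- The inner pair `Y₊`, `Y₋` cancels first, leaving an expression in which the translation map
    -- of `X` cancels.
    have h1 : ∀ p q, ev (H.pm Y) (fun r s => ev (H.sw p) fun P Q => ev (H.sw r) fun R S =>
        f (H.mul P R) (H.mul (H.mul Q S) (H.mul s q))) =
        ev (H.sw p) fun P Q => f (H.mul P Y) (H.mul Q q) := by
      intro p q
      have h2 : H.DBal H.leftS fun R S => ev (H.sw p) fun P Q => f (H.mul P R) (H.mul Q S) := by
        refine { bal := fun b R S => ?_ }
        simp only [← hH.mul_assoc, LinearMap.comp_apply]
        rw [hH.ev_sw_takeuchi (β := fun P Q => f (H.mul P R) (H.mul Q S))]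
        exact { bal := fun c P Q => by simp only [hH.mul_assoc, hb, LinearMap.comp_apply] }
      have h3 := hH.ev_pm_lam' h2 Y q
      rw [← h3]
      refine ev_congr fun r s => ?_
      rw [ev_comm]
      simp only [hH.mul_assoc]
    simp only [h1]
    have h4 := hH.ev_pm_lam (β := fun P Q => f (H.mul P Y) Q)
      { bal := fun c P Q => by rw [hH.mul_assoc, hb]; rfl } X
    exact h4

/-- `X₊ t(ε(X₋)) = X` -/
theorem ev_pm_counit (X : L) :
    ev (H.pm X) (fun p q => H.mul p (H.t (H.counit q))) = X := by
  have hb : H.DBal H.leftS fun P Q => H.mul (H.t (H.counit Q)) P :=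
    { bal := fun b P Q => by
        rw [LinearMap.comp_apply, hH.counit_s, hH.t_mul, hH.mul_assoc] }
  have h1 := hH.ev_pm_lam hb X
  rw [hH.counit_one, hH.t_one, hH.one_mul] at h1
  refine .trans ?_ h1
  refine ev_congr fun p q => ?_
  simp only [lamEv]
  simp only [hH.counit_mul_t _ q]
  rw [← hH.ev_sw_mul_t hb, hH.ev_sw_counit_right]

theorem ev_pm_one {β : L → L → W} (hβ : H.BarBal β) : ev (H.pm H.one) β = β H.one H.one := by
  rw [← hβ.toBilin.ev_tmul]
  refine hH.ev_pm_eq (fun β hβ => ?_) hβ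
  rw [(lamEv_bilin hβ.toBilin).ev_tmul, lamEv, hH.ev_sw_one (hH.mul_right_dbal hβ _), hH.one_mul]

theorem ev_pm_s {β : L → L → W} (hβ : H.BarBal β) (b : B) :
    ev (H.pm (H.s b)) β = β (H.s b) H.one := by
  rw [← hβ.toBilin.ev_tmul]
  refine hH.ev_pm_eq (fun β hβ => ?_) hβ
  rw [(lamEv_bilin hβ.toBilin).ev_tmul, lamEv, hH.ev_sw_s (hH.mul_right_dbal hβ _), hH.one_mul]

theorem ev_pm_t {β : L → L → W} (hβ : H.BarBal β) (b : B) :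
    ev (H.pm (H.t b)) β = β H.one (H.s b) := by
  rw [← hβ.toBilin.ev_tmul]
  refine hH.ev_pm_eq (fun β hβ => ?_) hβ
  rw [(lamEv_bilin hβ.toBilin).ev_tmul, lamEv, hH.ev_sw_one (hH.mul_right_dbal hβ _),
    hH.one_mul]
  have := hβ.bal b H.one H.one
  rw [LinearMap.comp_apply, hH.mul_one, hH.mul_one] at this
  exact this.symm

end IsLeftHopfAlgebroid

end BialgebroidData
end Cotwist
end

/-! ### Mixed coassociativity of the translation map and the dual comodule -/

noncomputable section
set_option linter.unusedSectionVars false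
namespace Cotwist

variable {k : Type v} [Field k] {B L : Type u} [AddCommGroup B] [Module k B]
  [AddCommGroup L] [Module k L] {M : Type u} [AddCommGroup M] [Module k M]
  {W : Type*} [AddCommGroup W] [Module k W]

namespace BialgebroidData

variable {H : BialgebroidData k B L}

namespace IsLeftHopfAlgebroid

variable (hH : H.IsLeftHopfAlgebroid)
include hH

/-- `X₍₁₎ ⊗ X₍₂₎₊ ⊗ X₍₂₎₋ = X₊₍₁₎ ⊗ X₊₍₂₎ ⊗ X₋` -/
theorem ev_sw_ev_pm {γ : L → L → L → W}
    (hγ : Bal₃ k (fun b X => H.mul (H.t b) X) (fun b X => H.mul (H.s b) X)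
      (fun b X => H.mul X (H.t b)) (fun b X => H.mul (H.t b) X) γ) (X : L) :
    ev (H.sw X) (fun P Q => ev (H.pm Q) fun p q => γ P p q) =
      ev (H.pm X) fun p q => ev (H.sw p) fun P Q => γ P Q q := by
  obtain ⟨f, rfl⟩ := hγ.exists_eq
  have hb₁ : ∀ b X Y Z, f (H.mul (H.t b) X) Y Z = f X (H.mul (H.s b) Y) Z := hγ.bal₁
  have hb₂ : ∀ b X Y Z, f X (H.mul Y (H.t b)) Z = f X Y (H.mul (H.t b) Z) := hγ.bal₂
  have hB : ∀ P Z, H.BarBal fun u v => f P u (H.mul v Z) := fun P Z =>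
    { bal := fun b u v => by simp only [hb₂, hH.mul_assoc] }
  have h1 : ∀ Y, H.DBal H.leftS fun P Q => ev (H.pm Q) fun u v => f P u (H.mul v Y) := fun Y =>
    { bal := fun b P Q => by
        rw [LinearMap.comp_apply, hH.ev_pm_s_mul (hB P Y)]
        simp only [hb₁] }
  have h2 : H.DBal H.leftS fun Z Y => ev (H.sw Z) fun P Q => ev (H.pm Q) fun u v =>
      f P u (H.mul v Y) :=
    { bal := fun b Z Y => by
        rw [hH.ev_sw_t_mul (h1 Y)]
        refine ev_congr fun P Q => ?_
        rw [hH.ev_pm_t_mul (hB P Y)]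
        simp only [hH.mul_assoc, LinearMap.comp_apply] }
  -- The left side is the value of `Z ⊗ Y ↦ Z₍₁₎ ⊗ Z₍₂₎₊ ⊗ Z₍₂₎₋ Y` at `X ⊗ 1`. Replacing `X ⊗ 1` by
  -- `X₊₍₁₎ ⊗ X₊₍₂₎ X₋` and using coassociativity exposes a cancelling translation pair.
  have h3 := hH.ev_pm_lam h2 X
  simp only [hH.mul_one] at h3
  rw [← h3]
  refine ev_congr fun p q => ?_
  rw [lamEv, hH.ev_sw_coassoc (γ := fun R T Q => ev (H.pm T) fun u v =>
    f R u (H.mul v (H.mul Q q)))]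
  · refine ev_congr fun P Q => ?_
    exact hH.ev_sw_pm (β := fun u v => f P u v) { bal := fun b u v => hb₂ b P u v } Q q
  · exact { bal₁ := fun b R T Q => (h1 _).bal b R T
            bal₂ := fun b R T Q => by
              rw [hH.ev_pm_t_mul (hB R _)]
              simp only [hH.mul_assoc, LinearMap.comp_apply] }

/-- `X₊ ⊗ X₋₍₁₎ ⊗ X₋₍₂₎ = X₊₊ ⊗ X₋ ⊗ X₊₋` -/
theorem ev_pm_ev_sw {γ : L → L → L → W}
    (hγ : Bal₃ k (fun b X => H.mul (H.t b) X) (fun b X => H.mul (H.s b) X)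
      (fun b X => H.mul (H.t b) X) (fun b X => H.mul X (H.t b)) γ) (X : L) :
    ev (H.pm X) (fun p q => ev (H.sw q) fun P Q => γ P Q p) =
      ev (H.pm X) fun p q => ev (H.pm p) fun u v => γ q v u := by
  obtain ⟨f, rfl⟩ := hγ.exists_eq
  have hb₁ : ∀ b X Y Z, f (H.mul (H.t b) X) Y Z = f X (H.mul (H.s b) Y) Z := hγ.bal₁
  have hb₂ : ∀ b X Y Z, f X (H.mul (H.t b) Y) Z = f X Y (H.mul Z (H.t b)) := hγ.bal₂
  have h1 : ∀ y Z, H.BarBal fun u v => f y (H.mul v Z) u := fun y Z =>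
    { bal := fun b u v => by simp only [← hb₂, hH.mul_assoc] }
  have h2 : ∀ Z, H.BarBal fun x y => ev (H.pm x) fun u v => f y (H.mul v Z) u := fun Z =>
    { bal := fun b x y => by
        rw [hH.ev_pm_mul_t (h1 y Z)]
        simp only [hb₁, hH.mul_assoc] }
  have h2' : ∀ Y Z, H.BarBal fun x y => ev (H.pm x) fun u v => f (H.mul y Y) (H.mul v Z) u :=
    fun Y Z =>
    { bal := fun b x y => by
        rw [hH.ev_pm_mul_t (h1 _ Z)]
        simp only [hb₁, hH.mul_assoc] }
  have h3 : ∀ X, H.DBal H.leftS fun Y Z => ev (H.pm X) fun p q => ev (H.pm p) fun u v =>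
      f (H.mul q Y) (H.mul v Z) u := fun X =>
    { bal := fun b Y Z => by
        simp only [LinearMap.comp_apply, ← hH.mul_assoc]
        rw [← hH.ev_pm_takeuchi (β := fun p q => ev (H.pm p) fun u v =>
          f (H.mul q Y) (H.mul v Z) u) (h2' Y Z)]
        refine ev_congr fun p q => ?_
        rw [hH.ev_pm_t_mul (h1 _ Z)] }
  have h4 : H.DBal H.leftS fun X Q => ev (H.sw Q) fun Y Z => ev (H.pm X) fun p q =>
      ev (H.pm p) fun u v => f (H.mul q Y) (H.mul v Z) u :=
    { bal := fun b X Q => by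
        rw [LinearMap.comp_apply, hH.ev_sw_s_mul (h3 X)]
        refine ev_congr fun Y Z => ?_
        rw [hH.ev_pm_t_mul (h2' Y Z)]
        simp only [hH.mul_assoc] }
  -- The function of `h4` at `X ⊗ 1` gives the right side. At `X₊₍₁₎ ⊗ X₊₍₂₎ X₋` the two nested
  -- translation maps cancel one after the other against the coproduct legs of `X₊`, and only the
  -- coproduct of `X₋` survives.
  have h5 := hH.ev_pm_lam h4 X
  rw [hH.ev_sw_one (h3 X)] at h5
  simp only [hH.mul_one] at h5
  rw [← h5]
  refine ev_congr fun p q => ?_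
  simp only [lamEv, hH.ev_sw_mul (h3 _)]
  simp only [ev_comm (H.sw _) (H.sw q)]
  refine ev_congr fun a c => ?_
  rw [← hH.ev_sw_coassoc (γ := fun P R T => ev (H.pm P) fun p q =>
    ev (H.pm p) fun u v => f (H.mul q (H.mul R a)) (H.mul v (H.mul T c)) u)]
  · have h6 : ∀ P Q, ev (H.sw P) (fun R T => ev (H.pm R) fun p q => ev (H.pm p) fun u v =>
        f (H.mul q (H.mul T a)) (H.mul v (H.mul Q c)) u) = ev (H.pm P) fun u v =>
          f a (H.mul v (H.mul Q c)) u := fun P Q => hH.ev_sw_pm (h2 (H.mul Q c)) P a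
    simp only [h6]
    exact (hH.ev_sw_pm (β := fun u v => f a v u)
      { bal := fun b u v => (hb₂ b a v u).symm } p c).symm
  · exact { bal₁ := fun b P R T => by
              rw [hH.ev_pm_t_mul (h2' _ _)]
              simp only [hH.mul_assoc]
            bal₂ := fun b P R T => by
              have := (h3 P).bal b (H.mul R a) (H.mul T c)
              simpa only [hH.mul_assoc, LinearMap.comp_apply] using this }

omit hH in
theorem barBal_swap {β : L → L → W} (hβ : H.DBal (H.mul.flip ∘ₗ H.t) β) :
    H.BarBal fun p q => β q p where
  add_left x x' y := hβ.add_right y x x'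
  smul_left c x y := hβ.smul_right c y x
  add_right x y y' := hβ.add_left y y' x
  smul_right c x y := hβ.smul_left c y x
  bal b x y := (hβ.bal b y x).symm

omit hH in
theorem ev_rep_comm_pm {β : L → L → W} (hβ : H.DBal (H.mul.flip ∘ₗ H.t) β) (X : L) :
    ev (rep (H.diamondRel (H.mul.flip ∘ₗ H.t)) (((H.diamondRel (H.mul.flip ∘ₗ H.t)).mkQ ∘ₗ
      (TensorProduct.comm k L L).toLinearMap ∘ₗ H.pm) X)) β = ev (H.pm X) fun p q => β q p := by
  refine (hβ.ev_congr (mkQ_rep _ _)).trans ?_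
  exact hβ.toBilin.ev_comm_map (H.pm X)

/-- `L` as a left comodule with coaction `X ↦ X₋ ⊗ X₊` and bimodule structure
`b.X.c = c̄ X b̄`. -/
@[reducible] def dual : H.LeftComodule L where
  l := H.mul.flip ∘ₗ H.t
  r := H.mul ∘ₗ H.t
  coact := (H.diamondRel (H.mul.flip ∘ₗ H.t)).mkQ ∘ₗ
    (TensorProduct.comm k L L).toLinearMap ∘ₗ H.pm
  one_l X := by simp only [LinearMap.comp_apply, LinearMap.flip_apply, hH.t_one, hH.mul_one]
  mul_l a b X := by
    simp only [LinearMap.comp_apply, LinearMap.flip_apply, hH.t_mul, hH.mul_assoc]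
  one_r X := by simp only [LinearMap.comp_apply, hH.t_one, hH.one_mul]
  mul_r a b X := by simp only [LinearMap.comp_apply, hH.t_mul, hH.mul_assoc]
  l_r a b X := by simp only [LinearMap.comp_apply, LinearMap.flip_apply, hH.mul_assoc]
  coact_l b X := by
    refine mkQ_diamondRel_eq fun β hβ => ?_
    have hβ' := barBal_swap hβ
    rw [hβ.toBilin.ev_rTensor]
    obtain ⟨f, rfl⟩ := hβ.exists_eq
    have hb : ∀ b X Y, f (H.mul (H.t b) X) Y = f X (H.mul Y (H.t b)) := hβ.bal
    have h1 : H.DBal (H.mul.flip ∘ₗ H.t) fun P Q => f (H.mul (H.s b) P) Q :=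
      { bal := fun c P Q => by
          rw [← hH.mul_assoc, hH.s_t_comm, hH.mul_assoc, hb]; rfl }
    rw [ev_rep_comm_pm h1]
    exact (hβ.toBilin.ev_comm_map _).trans (hH.ev_pm_mul_t hβ' b X)
  coact_r b X := by
    refine mkQ_diamondRel_eq fun β hβ => ?_
    have hβ' := barBal_swap hβ
    rw [hβ.toBilin.ev_rTensor]
    obtain ⟨f, rfl⟩ := hβ.exists_eq
    have hb : ∀ b X Y, f (H.mul (H.t b) X) Y = f X (H.mul Y (H.t b)) := hβ.bal
    have h1 : H.DBal (H.mul.flip ∘ₗ H.t) fun P Q => f (H.mul.flip (H.s b) P) Q :=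
      { bal := fun c P Q => by rw [LinearMap.flip_apply, hH.mul_assoc, hb]; rfl }
    rw [ev_rep_comm_pm h1]
    exact (hβ.toBilin.ev_comm_map _).trans (hH.ev_pm_t_mul hβ' b X)
  takeuchi b X := by
    refine mkQ_diamondRel_eq fun β hβ => ?_
    have hβ' := barBal_swap hβ
    rw [hβ.toBilin.ev_rTensor, hβ.toBilin.ev_lTensor]
    obtain ⟨f, rfl⟩ := hβ.exists_eq
    have hb : ∀ b X Y, f (H.mul (H.t b) X) Y = f X (H.mul Y (H.t b)) := hβ.bal
    have h1 : H.DBal (H.mul.flip ∘ₗ H.t) fun P Q => f (H.mul.flip (H.t b) P) Q :=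
      { bal := fun c P Q => by rw [LinearMap.flip_apply, hH.mul_assoc, hb]; rfl }
    have h2 : H.DBal (H.mul.flip ∘ₗ H.t) fun P Q => f P ((H.mul ∘ₗ H.t) b Q) :=
      { bal := fun c P Q => by
          rw [hb]; simp only [LinearMap.comp_apply, LinearMap.flip_apply, hH.mul_assoc] }
    rw [ev_rep_comm_pm h1, ev_rep_comm_pm h2]
    exact (hH.ev_pm_takeuchi hβ' b X).symm
  coassoc X := by
    refine mkQ_diamondRel₃_eq fun γ hγ => ?_
    have hγ' := hH.ev_pm_ev_sw hγ X
    obtain ⟨f, rfl⟩ := hγ.exists_eq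
    have hb₁ : ∀ b X Y Z, f (H.mul (H.t b) X) Y Z = f X (H.mul (H.s b) Y) Z := hγ.bal₁
    have hb₂ : ∀ b X Y Z, f X (H.mul (H.t b) Y) Z = f X Y (H.mul Z (H.t b)) := hγ.bal₂
    have h0 : ∀ X, H.DBal (H.mul.flip ∘ₗ H.t) fun Y Z => f X Y Z := fun X =>
      { bal := fun b Y Z => hb₂ b X Y Z }
    rw [ev_assoc_rTensor, ev_lTensor_ev]
    rw [ev_rep_comm_pm, ev_rep_comm_pm]
    · refine hγ'.trans (ev_congr fun p q => ?_)
      exact (ev_rep_comm_pm (h0 q) p).symm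
    · refine { bal := fun b X Y => ?_ }
      refine (ev_rep_comm_pm (h0 _) _).trans (.trans ?_ (ev_rep_comm_pm (h0 _) _).symm)
      refine .trans ?_ (hH.ev_pm_mul_t (barBal_swap (h0 _)) b Y).symm
      simp only [hb₁]
    · refine { bal := fun b X Y => ?_ }
      rw [hH.ev_sw_t_mul]
      · simp only [hb₂]; rfl
      · exact { bal := fun b P Q => hb₁ b P Q Y }
  counit_coact X := by
    rw [lift_eq_ev]
    refine (ev_rep_comm_pm { bal := fun b P Q => ?_ } X).trans (hH.ev_pm_counit X)
    simp only [LinearMap.comp_apply, LinearMap.flip_apply, hH.counit_t, hH.t_mul, hH.mul_assoc]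

theorem ev_dual_sw {β : L → L → W} (hβ : H.DBal hH.dual.l β) (X : L) :
    ev (hH.dual.sw X) β = ev (H.pm X) fun p q => β q p :=
  ev_rep_comm_pm hβ X

/-- `m₍₋₁₎₋ m₍₀₎₍₋₁₎ ⊗ m₍₋₁₎₊ ⊗ m₍₀₎₍₀₎ = 1 ⊗ m₍₋₁₎ ⊗ m₍₀₎` -/
theorem ev_coinvariant {C : H.LeftComodule M} {Ψ : L → L → M → W}
    (hΨ : Bal₃ k (fun b X => H.mul (H.t b) X) (fun b X => hH.dual.l b X)
      (fun b X => hH.dual.r b X) (fun b m => C.l b m) Ψ) (m : M) :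
    ev (C.sw m) (fun X n => ev (hH.dual.sw X) fun q p => ev (C.sw n) fun Y n' =>
      Ψ (H.mul q Y) p n') = ev (C.sw m) fun X n => Ψ H.one X n := by
  obtain ⟨f, rfl⟩ := hΨ.exists_eq
  have hb₁ : ∀ b X Y Z, f (H.mul (H.t b) X) Y Z = f X (H.mul Y (H.t b)) Z := hΨ.bal₁
  have hb₂ : ∀ b X Y Z, f X (H.mul (H.t b) Y) Z = f X Y (C.l b Z) := hΨ.bal₂
  have h0 : ∀ Y n, H.DBal hH.dual.l fun q p => f (H.mul q Y) p n := fun Y n =>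
    { bal := fun b q p => by
        simp only [hH.mul_assoc, hb₁, LinearMap.comp_apply, LinearMap.flip_apply] }
  have h1 : ∀ X n, ev (hH.dual.sw X) (fun q p => ev (C.sw n) fun Y n' =>
      f (H.mul q Y) p n') = ev (C.sw n) fun Y n' => ev (H.pm X) fun p q =>
        f (H.mul q Y) p n' := by
    intro X n
    rw [ev_comm]
    refine ev_congr fun Y n' => ?_
    exact hH.ev_dual_sw (h0 Y n') X
  simp only [h1]
  -- After coassociativity the expression is `X₍₁₎₋ X₍₂₎ ⊗ X₍₁₎₊` for a single coefficient `X`,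
  -- which is `1 ⊗ X`.
  rw [← LeftComodule.ev_sw_coassoc (C := C) (γ := fun X Y n => ev (H.pm X) fun p q =>
    f (H.mul q Y) p n)]
  · refine ev_congr fun X n => ?_
    exact hH.ev_sw_pm_one (β := fun p q => f q p n)
      { bal := fun b p q => (hb₁ b q p n).symm } X
  · refine { bal₁ := fun b X Y n => ?_, bal₂ := fun b X Y n => ?_ }
    · rw [hH.ev_pm_t_mul (barBal_swap (h0 Y n))]
      simp only [hH.mul_assoc]
    · simp only [← hb₂, ← hH.mul_assoc]
      exact (hH.ev_pm_takeuchi (barBal_swap (h0 Y n)) b X).symm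

end IsLeftHopfAlgebroid

end BialgebroidData
end Cotwist
end

/-! ### The inverse of `Γ^#` and the cotwisted coaction -/

noncomputable section
set_option linter.unusedSectionVars false
namespace Cotwist

variable {k : Type v} [Field k] {B L : Type u} [AddCommGroup B] [Module k B]
  [AddCommGroup L] [Module k L] {M N P Q : Type u} [AddCommGroup M] [Module k M]
  [AddCommGroup N] [Module k N] [AddCommGroup P] [Module k P] [AddCommGroup Q] [Module k Q]
  {W : Type*} [AddCommGroup W] [Module k W]

theorem sharpRaw_tmul (Γ : L →ₗ[k] L →ₗ[k] B) (δM : M →ₗ[k] L ⊗[k] M)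
    (l : B →ₗ[k] M →ₗ[k] M) (δN : N →ₗ[k] L ⊗[k] N) (m : M) (n : N) :
    sharpRaw Γ δM l δN (m ⊗ₜ[k] n) =
      ev (δM m) fun X p => ev (δN n) fun Y q => l (Γ X Y) p ⊗ₜ[k] q := by
  rw [sharpRaw, LinearMap.comp_apply, TensorProduct.lift.tmul, LinearMap.compl₁₂_apply,
    lift_map₂_eq_ev, map_ev]
  simp only [map_ev]
  rfl

theorem ev_sharpRaw (Γ : L →ₗ[k] L →ₗ[k] B) (δM : M →ₗ[k] L ⊗[k] M)
    (l : B →ₗ[k] M →ₗ[k] M) (δN : N →ₗ[k] L ⊗[k] N) {φ : M → N → W} (hφ : Bilin k φ)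
    (z : M ⊗[k] N) :
    ev (sharpRaw Γ δM l δN z) φ =
      ev z fun m n => ev (δM m) fun X p => ev (δN n) fun Y q => φ (l (Γ X Y) p) q := by
  rw [map_eq_ev (sharpRaw Γ δM l δN) z]
  simp only [sharpRaw_tmul, ev_ev, hφ.ev_tmul]

namespace BialgebroidData

variable {H : BialgebroidData k B L}

namespace LeftComodule

variable (C : H.LeftComodule M) (D : H.LeftComodule N) (Γ : L →ₗ[k] L →ₗ[k] B)

/-- The inverse of `Γ^#` on representatives. -/
def unsharp : M ⊗[k] N →ₗ[k] M ⊗[k] N :=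
  rep (C.twistTensorRel D Γ) ∘ₗ inverse (C.sharp D Γ) ∘ₗ (C.tensorRel D).mkQ

/-- The value of `φ` on `(Γ^#)⁻¹(m ⊗ n)`. -/
def unsharpEv (C : H.LeftComodule M) (D : H.LeftComodule N) (Γ : L →ₗ[k] L →ₗ[k] B)
    (m : M) (n : N) (φ : M → N → W) : W :=
  ev (C.unsharp D Γ (m ⊗ₜ[k] n)) φ

variable (m m' : M) (n n' : N) (φ ψ : M → N → W)

@[simp] theorem unsharpEv_add_left :
    C.unsharpEv D Γ (m + m') n φ = C.unsharpEv D Γ m n φ + C.unsharpEv D Γ m' n φ := by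
  simp only [unsharpEv, TensorProduct.add_tmul, map_add, ev_add]
@[simp] theorem unsharpEv_smul_left (c : k) :
    C.unsharpEv D Γ (c • m) n φ = c • C.unsharpEv D Γ m n φ := by
  simp only [unsharpEv, ← TensorProduct.smul_tmul', map_smul, ev_smul]
@[simp] theorem unsharpEv_add_right :
    C.unsharpEv D Γ m (n + n') φ = C.unsharpEv D Γ m n φ + C.unsharpEv D Γ m n' φ := by
  simp only [unsharpEv, TensorProduct.tmul_add, map_add, ev_add]
@[simp] theorem unsharpEv_smul_right (c : k) :
    C.unsharpEv D Γ m (c • n) φ = c • C.unsharpEv D Γ m n φ := by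
  simp only [unsharpEv, TensorProduct.tmul_smul, map_smul, ev_smul]
@[simp] theorem unsharpEv_fun_add :
    C.unsharpEv D Γ m n (fun x y => φ x y + ψ x y) =
      C.unsharpEv D Γ m n φ + C.unsharpEv D Γ m n ψ := by simp [unsharpEv]
@[simp] theorem unsharpEv_fun_smul (c : k) :
    C.unsharpEv D Γ m n (fun x y => c • φ x y) = c • C.unsharpEv D Γ m n φ := by
  simp [unsharpEv]

theorem ev_unsharp (z : M ⊗[k] N) :
    ev (C.unsharp D Γ z) φ = ev z fun m n => C.unsharpEv D Γ m n φ := by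
  conv_lhs => rw [map_eq_ev (C.unsharp D Γ) z, ev_ev]
  rfl

theorem unsharpEv_tBal : C.TBal D fun m n => C.unsharpEv D Γ m n φ where
  add_left _ _ _ := unsharpEv_add_left _ _ _ _ _ _ _
  smul_left _ _ _ := unsharpEv_smul_left _ _ _ _ _ _ _
  add_right _ _ _ := unsharpEv_add_right _ _ _ _ _ _ _
  smul_right _ _ _ := unsharpEv_smul_right _ _ _ _ _ _ _
  bal b m n := by
    simp only [unsharpEv, unsharp, LinearMap.comp_apply]
    congr 3
    exact (Submodule.Quotient.eq _).2 (Submodule.subset_span ⟨b, m, n, rfl⟩)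

variable {C D Γ}

theorem IsColinear.sharpEv {f : N →ₗ[k] P} {E : H.LeftComodule P} (hf : D.IsColinear E f)
    {φ : M → P → W} (hφ : C.TBal E φ) (hΓ : H.IsLeftTwoCocycle Γ) (hH : H.IsLeftBialgebroid)
    (m : M) (n : N) : C.sharpEv E Γ m (f n) φ = C.sharpEv D Γ m n fun x y => φ x (f y) := by
  rw [LeftComodule.sharpEv, LeftComodule.sharpEv, ev_comm, ev_comm (C.sw m),
    hf.ev_sw' _ (hΓ.sharpEv_bal_outer hH hφ m)]

end LeftComodule

namespace IsLeftTwoCocycle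

open LeftComodule

variable {Γ : L →ₗ[k] L →ₗ[k] B} (hΓ : H.IsLeftTwoCocycle Γ)
  (hH : H.IsLeftBialgebroid) {C : H.LeftComodule M} {D : H.LeftComodule N}
include hΓ hH

theorem twistTensorRel_le : C.twistTensorRel D Γ ≤
    (C.tensorRel D).comap (sharpRaw Γ C.sw C.l D.sw) := by
  refine Submodule.span_le.2 ?_
  rintro _ ⟨b, m, n, rfl⟩
  rw [SetLike.mem_coe, Submodule.mem_comap, map_sub]
  refine (Submodule.Quotient.eq _).1 (mkQ_balRel_eq fun φ hφ => ?_)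
  rw [sharpRaw_tmul, sharpRaw_tmul]
  simp only [ev_ev, hφ.toBilin.ev_tmul]
  exact hΓ.sharpEv_twistR hH hφ b m n

theorem sharp_mkQ (z : M ⊗[k] N) : C.sharp D Γ ((C.twistTensorRel D Γ).mkQ z) =
    (C.tensorRel D).mkQ (sharpRaw Γ C.sw C.l D.sw z) :=
  induced_mkQ (hΓ.twistTensorRel_le hH) z

end IsLeftTwoCocycle

namespace IsInvertibleLeftTwoCocycle

open LeftComodule

variable {Γ : L →ₗ[k] L →ₗ[k] B} (hΓ : H.IsInvertibleLeftTwoCocycle Γ)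
  (hH : H.IsLeftBialgebroid) {C : H.LeftComodule M} {D : H.LeftComodule N}
include hΓ hH

theorem ev_unsharp_sharpEv {φ : M → N → W} (hφ : C.TBal D φ) (z : M ⊗[k] N) :
    ev (C.unsharp D Γ z) (fun m n => C.sharpEv D Γ m n φ) = ev z φ := by
  refine (ev_sharpRaw Γ C.sw C.l D.sw hφ.toBilin _).symm.trans (hφ.ev_congr ?_)
  refine (hΓ.sharp_mkQ hH _).symm.trans ?_
  rw [unsharp, LinearMap.comp_apply, mkQ_rep, LinearMap.comp_apply,
    apply_inverse (hΓ.invertible M N C D)]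
  rfl

theorem unsharpEv_sharpEv {φ : M → N → W} (hφ : C.TBal D φ) (m : M) (n : N) :
    C.unsharpEv D Γ m n (fun m n => C.sharpEv D Γ m n φ) = φ m n := by
  rw [unsharpEv, hΓ.ev_unsharp_sharpEv hH hφ, hφ.toBilin.ev_tmul]

/-- Every function balanced over `B^Γ` is thus the pullback along `Γ^#` of a function balanced over
`B`. Statements about the cotwisted coaction are proved by choosing this form of the test function,
so that `Γ^#` cancels its inverse. -/
theorem sharpEv_unsharpEv {φ : M → N → W} (hφ : C.TwistBal D Γ φ) (m : M) (n : N) :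
    C.sharpEv D Γ m n (fun m n => C.unsharpEv D Γ m n φ) = φ m n := by
  have h1 : C.sharpEv D Γ m n (fun m n => C.unsharpEv D Γ m n φ) =
      ev (C.unsharp D Γ (sharpRaw Γ C.sw C.l D.sw (m ⊗ₜ[k] n))) φ := by
    rw [ev_unsharp, ev_sharpRaw Γ C.sw C.l D.sw (unsharpEv_tBal C D Γ φ).toBilin]
    refine (Bilin.ev_tmul (β := fun m n => C.sharpEv D Γ m n fun m n => C.unsharpEv D Γ m n φ)
      {} m n).symm
  rw [h1, ← hφ.toBilin.ev_tmul]
  refine hφ.ev_congr ?_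
  refine (mkQ_rep _ _).trans ?_
  rw [LinearMap.comp_apply, ← hΓ.sharp_mkQ hH, inverse_apply (hΓ.invertible M N C D)]
  rfl

/-- `Γ^#` is natural in comodule maps, hence so is its inverse. -/
theorem unsharpEv_colinear {f : N →ₗ[k] P} {E : H.LeftComodule P} (hf : D.IsColinear E f)
    {φ : M → P → W} (hφ : C.TwistBal E Γ φ) (m : M) (n : N) :
    C.unsharpEv E Γ m (f n) φ = C.unsharpEv D Γ m n fun x y => φ x (f y) := by
  have h1 := unsharpEv_tBal C E Γ φ
  have h2 : C.TBal D fun x y => C.unsharpEv E Γ x (f y) φ :=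
    { bal := fun b x y => by rw [hf.map_l]; exact h1.bal b x (f y) }
  rw [← hΓ.unsharpEv_sharpEv hH h2]
  simp only [← hf.sharpEv h1 hΓ.toIsLeftTwoCocycle hH, hΓ.sharpEv_unsharpEv hH hφ]

end IsInvertibleLeftTwoCocycle

namespace LeftComodule

/-- A representative of the cotwisted coaction `m ↦ (Γ^#)⁻¹(m₍₋₁₎ ⊗ m₍₀₎)`. -/
def twistSw (C : H.LeftComodule M) (hH : H.IsLeftHopfAlgebroid) (Γ : L →ₗ[k] L →ₗ[k] B) :
    M →ₗ[k] L ⊗[k] M :=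
  hH.dual.unsharp C Γ ∘ₗ C.sw

/-- Functions on `L × M` that factor through `L^Γ ⋄_{B^Γ} M`. -/
abbrev TwBal (C : H.LeftComodule M) (hH : H.IsLeftHopfAlgebroid) (Γ : L →ₗ[k] L →ₗ[k] B)
    (φ : L → M → W) : Prop :=
  hH.dual.TwistBal C Γ φ

theorem ev_twistSw (C : H.LeftComodule M) (hH : H.IsLeftHopfAlgebroid)
    (Γ : L →ₗ[k] L →ₗ[k] B) (φ : L → M → W) (m : M) :
    ev (C.twistSw hH Γ m) φ = ev (C.sw m) fun X n => hH.dual.unsharpEv C Γ X n φ :=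
  ev_unsharp _ _ _ _ _

end LeftComodule

namespace IsInvertibleLeftTwoCocycle

open LeftComodule

variable {Γ : L →ₗ[k] L →ₗ[k] B} (hΓ : H.IsInvertibleLeftTwoCocycle Γ)
  (hH : H.IsLeftHopfAlgebroid) {C : H.LeftComodule M} {D : H.LeftComodule N}
include hΓ

/-- `Γ^#(m₍₋₁₎ ⊗ m₍₀₎)`, for the cotwisted coaction, is the coaction of `m`. -/
theorem ev_twistSw_sharpEv {φ : L → M → W} (hφ : H.DBal C.l φ) (m : M) :
    ev (C.twistSw hH Γ m) (fun X n => hH.dual.sharpEv C Γ X n φ) = ev (C.sw m) φ :=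
  hΓ.ev_unsharp_sharpEv hH.toIsLeftBialgebroid hφ (C.sw m)

theorem ev_twistSw_colinear {f : M →ₗ[k] N} (hf : C.IsColinear D f) {φ : L → N → W}
    (hφ : D.TwBal hH Γ φ) (m : M) :
    ev (D.twistSw hH Γ (f m)) φ = ev (C.twistSw hH Γ m) fun X n => φ X (f n) := by
  rw [ev_twistSw, ev_twistSw, hf.ev_sw' m (unsharpEv_tBal hH.dual D Γ φ)]
  simp only [hΓ.unsharpEv_colinear hH.toIsLeftBialgebroid hf hφ]

/-- A family of comodule maps from `M` to `N`, given by a map `τ : M → N ⊗ Q`, is compatible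
with the cotwisted coactions. -/
theorem ev_twistSw_comm {τ : M →ₗ[k] N ⊗[k] Q} {e : B → N →ₗ[k] N} {e' : B → Q → Q}
    (he : ∀ b, D.IsColinear D (e b))
    (hl : ∀ (χ : N → Q → W), Bal k (fun b n => e b n) e' χ → ∀ b m,
      ev (τ (C.l b m)) χ = ev (τ m) fun n q => χ (D.l b n) q)
    (hτ : ∀ γ : L → N → Q → W, Bal₃ k (fun b X => H.mul (H.t b) X) (fun b n => D.l b n)
        (fun b n => e b n) e' γ → ∀ m,
      ev (τ m) (fun n q => ev (D.sw n) fun X p => γ X p q) =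
        ev (C.sw m) fun X p => ev (τ p) fun n q => γ X n q)
    {γ : L → N → Q → W}
    (hγ : Bal₃ k (hH.dual.twistR Γ) (D.twistL Γ) (fun b n => e b n) e' γ) (m : M) :
    ev (τ m) (fun n q => ev (D.twistSw hH Γ n) fun X p => γ X p q) =
      ev (C.twistSw hH Γ m) fun X p => ev (τ p) fun n q => γ X n q := by
  have hB := hH.toIsLeftBialgebroid
  obtain ⟨f, rfl⟩ := hγ.exists_eq
  have hb₁ : ∀ b X n q, f (hH.dual.twistR Γ b X) n q = f X (D.twistL Γ b n) q := hγ.bal₁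
  have hb₂ : ∀ b X n q, f X (e b n) q = f X n (e' b q) := hγ.bal₂
  have h1 : ∀ q, D.TwBal hH Γ fun X n => f X n q := fun q => { bal := fun b X n => hb₁ b X n q }
  have h2 : ∀ q, H.DBal D.l fun X n => hH.dual.unsharpEv D Γ X n fun X n => f X n q := fun q =>
    unsharpEv_tBal hH.dual D Γ _
  have h3 : ∀ b X n q, (hH.dual.unsharpEv D Γ X (e b n) fun X n => f X n q) =
      hH.dual.unsharpEv D Γ X n fun X n => f X n (e' b q) := fun b X n q => by
    rw [hΓ.unsharpEv_colinear hB (he b) (h1 q)]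
    simp only [hb₂]
  have h4 := hτ (fun X n q => hH.dual.unsharpEv D Γ X n fun X n => f X n q)
    { bal₁ := fun b X n q => (h2 q).bal b X n
      bal₂ := h3 } m
  simp only [ev_twistSw D]
  rw [h4]
  have h5 : ∀ X, Bal k (fun b n => e b n) e' fun n q =>
      hH.dual.unsharpEv D Γ X n fun X n => f X n q := fun X => { bal := fun b n q => h3 b X n q }
  have h6 : H.DBal C.l fun X p => ev (τ p) fun n q =>
      hH.dual.unsharpEv D Γ X n fun X n => f X n q :=
    { bal := fun b X p => by
        rw [hl _ (h5 X)]
        refine ev_congr fun n q => ?_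
        exact (h2 q).bal b X n }
  -- The untwisted coaction of `m` is rewritten as `Γ^#` of the cotwisted one. A second use of `hτ`,
  -- inside `Γ^#`, then lets `Γ^#` meet its inverse on `N`.
  rw [← hΓ.ev_twistSw_sharpEv hH h6]
  refine ev_congr fun X p => ?_
  rw [sharpEv]
  simp only [ev_comm (hH.dual.sw X) (C.sw p)]
  simp only [ev_comm (hH.dual.sw X) (τ _)]
  rw [← hτ (fun Y n q => ev (hH.dual.sw X) fun U Z =>
    hH.dual.unsharpEv D Γ (hH.dual.l (Γ U Y) Z) n fun X n => f X n q)]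
  · refine ev_congr fun n q => ?_
    rw [ev_comm]
    exact hΓ.sharpEv_unsharpEv hB (h1 q) X n
  · exact { bal₁ := fun b Y n q => (hΓ.sharpEv_bal_outer (C := hH.dual) (D := D) hB (h2 q) X).bal b Y n
            bal₂ := fun b Y n q => by simp only [h3] }

end IsInvertibleLeftTwoCocycle

end BialgebroidData

/-! ### The product of the cotwist -/

namespace BialgebroidData

variable {H : BialgebroidData k B L}

open LeftComodule

namespace IsLeftHopfAlgebroid

variable (hH : H.IsLeftHopfAlgebroid)
include hH

/-- `X₍₁₎ ⊗ X₍₂₎₋ ⊗ X₍₂₎₊ = X₊₍₁₎ ⊗ X₋ ⊗ X₊₍₂₎` -/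
theorem ev_sw_ev_dual {γ : L → L → L → W}
    (hγ : Bal₃ k (fun b X => H.mul (H.t b) X) (fun b X => hH.dual.l b X)
      (fun b X => H.mul (H.s b) X) (fun b X => H.mul (H.t b) X) fun q p P => γ P q p) (X : L) :
    ev (H.sw X) (fun P Q => ev (hH.dual.sw Q) fun q p => γ P q p) =
      ev (hH.dual.sw X) fun q p => ev (H.sw p) fun P Q => γ P q Q := by
  obtain ⟨f, hf⟩ := hγ.exists_eq
  have hf' : γ = fun P q p => f q p P := by
    funext P q p
    exact congrFun (congrFun (congrFun hf q) p) P
  subst hf'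
  have hb₁ : ∀ b X Y Z, f (H.mul (H.t b) X) Y Z = f X (H.mul Y (H.t b)) Z := hγ.bal₁
  have hb₂ : ∀ b X Y Z, f X (H.mul (H.s b) Y) Z = f X Y (H.mul (H.t b) Z) := hγ.bal₂
  have h1 : ∀ P, H.DBal hH.dual.l fun q p => f q p P := fun P =>
    { bal := fun b q p => hb₁ b q p P }
  have h2 : ∀ q, H.DBal H.leftS fun P p => f q p P := fun q =>
    { bal := fun b P p => (hb₂ b q p P).symm }
  have h3 : H.DBal hH.dual.l fun q p => ev (H.sw p) fun P Q => f q Q P :=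
    { bal := fun b q p => by
        change _ = ev (H.sw (H.mul p (H.t b))) _
        rw [hH.ev_sw_mul_t (h2 q)]
        simp only [hb₁] }
  simp only [hH.ev_dual_sw (h1 _)]
  rw [hH.ev_dual_sw h3]
  exact hH.ev_sw_ev_pm (γ := fun P p q => f q p P)
    { bal₁ := fun b X Y Z => (hb₂ b Z Y X).symm
      bal₂ := fun b X Y Z => (hb₁ b Z Y X).symm } X

/-- `X₍₁₎ ⊗ X₍₂₎₋ ⊗ X₍₂₎₊ = X₊₍₁₎ ⊗ X₋ ⊗ X₊₍₂₎` for two elements. -/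
theorem ev_sw_ev_dual₂ {γ : L → L → L → L → L → L → W} (X Y : L)
    (h₁ : Bal₃ k (fun b X => H.mul (H.t b) X) (fun b X => hH.dual.l b X)
      (fun b X => H.mul (H.s b) X) (fun b X => H.mul (H.t b) X) fun q p P =>
        ev (H.sw Y) fun R T => ev (hH.dual.sw T) fun t r => γ P q p R t r)
    (h₂ : Bal₃ k (fun b X => H.mul (H.t b) X) (fun b X => hH.dual.l b X)
      (fun b X => H.mul (H.s b) X) (fun b X => H.mul (H.t b) X) fun t r R =>
        ev (hH.dual.sw X) fun q p => ev (H.sw p) fun P Q => γ P q Q R t r) :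
    ev (H.sw X) (fun P Q => ev (H.sw Y) fun R T => ev (hH.dual.sw Q) fun q p =>
        ev (hH.dual.sw T) fun t r => γ P q p R t r) =
      ev (hH.dual.sw X) fun q p => ev (hH.dual.sw Y) fun t r => ev (H.sw p) fun P Q =>
        ev (H.sw r) fun R T => γ P q Q R t T := by
  refine (ev_congr fun P Q => ev_comm _ _ _).trans ((hH.ev_sw_ev_dual h₁ X).trans ?_)
  refine ((ev_congr fun q p => ev_comm _ _ _).trans (ev_comm _ _ _)).trans ?_
  refine (ev_congr fun R T => (ev_congr fun q p => ev_comm _ _ _).trans (ev_comm _ _ _)).trans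
    ((hH.ev_sw_ev_dual h₂ Y).trans ?_)
  refine (ev_congr fun t r => ev_comm _ _ _).trans ((ev_comm _ _ _).trans ?_)
  exact ev_congr fun q p => ev_congr fun t r => ev_comm _ _ _

/-- The rule `(X Y)₊ ⊗ (X Y)₋ = X₊ Y₊ ⊗ Y₋ X₋` reverses the order on the coacting side, so it is the
opposite multiplication that respects the dual coaction. -/
theorem isCobilinear_mul_flip : hH.dual.IsCobilinear hH.dual hH.dual H.mul.flip where
  bal b y x := by
    simp only [LinearMap.flip_apply, LinearMap.comp_apply, hH.mul_assoc]
  map_l b y x := by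
    simp only [LinearMap.flip_apply, LinearMap.comp_apply, hH.mul_assoc]
  ev_sw y x β hβ := by
    have hβ' := barBal_swap hβ
    simp only [LinearMap.flip_apply]
    rw [hH.ev_dual_sw hβ, hH.ev_pm_mul hβ']
    obtain ⟨f, rfl⟩ := hβ.exists_eq
    have hb : ∀ b X Y, f (H.mul (H.t b) X) Y = f X (H.mul Y (H.t b)) := hβ.bal
    have h1 : ∀ q p, H.DBal hH.dual.l fun t r => f (H.mul t q) (H.mul p r) := fun q p =>
      { bal := fun b t r => by
          simp only [hH.mul_assoc, hb, LinearMap.comp_apply, LinearMap.flip_apply] }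
    have h2 : H.DBal hH.dual.l fun q p => ev (hH.dual.sw y) fun t r =>
        f (H.mul t q) (H.mul p r) :=
      { bal := fun b q p => by
          simp only [← hH.mul_assoc, LinearMap.comp_apply, LinearMap.flip_apply]
          rw [ev_sw_takeuchi (C := hH.dual) (β := fun t r => f (H.mul t q) (H.mul p r)) (h1 q p)]
          simp only [hH.mul_assoc, LinearMap.comp_apply] }
    rw [ev_comm (hH.dual.sw y), hH.ev_dual_sw h2]
    simp only [hH.ev_dual_sw (h1 _ _)]

theorem isColinear_s_mul (b : B) : hH.dual.IsColinear hH.dual (H.mul (H.s b)) where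
  map_l c X := by
    simp only [LinearMap.comp_apply, LinearMap.flip_apply, hH.mul_assoc]
  ev_sw X β hβ := by
    obtain ⟨f, rfl⟩ := hβ.exists_eq
    have hb : ∀ b X Y, f (H.mul (H.t b) X) Y = f X (H.mul Y (H.t b)) := hβ.bal
    rw [hH.ev_dual_sw hβ, hH.ev_pm_s_mul (barBal_swap hβ), hH.ev_dual_sw]
    exact { bal := fun c P Q => by
              simp only [LinearMap.comp_apply, LinearMap.flip_apply, hb, hH.mul_assoc] }

theorem isColinear_mul_s (b : B) : hH.dual.IsColinear hH.dual (H.mul.flip (H.s b)) where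
  map_l c X := by
    simp only [LinearMap.comp_apply, LinearMap.flip_apply, hH.mul_assoc, hH.s_t_comm]
  ev_sw X β hβ := by
    obtain ⟨f, rfl⟩ := hβ.exists_eq
    have hb : ∀ b X Y, f (H.mul (H.t b) X) Y = f X (H.mul Y (H.t b)) := hβ.bal
    rw [hH.ev_dual_sw hβ, LinearMap.flip_apply, hH.ev_pm_mul_s (barBal_swap hβ), hH.ev_dual_sw]
    · rfl
    · exact { bal := fun c P Q => by
                simp only [LinearMap.comp_apply, LinearMap.flip_apply, hb, hH.mul_assoc,
                  hH.s_t_comm] }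

end IsLeftHopfAlgebroid

namespace IsLeftBialgebroid

variable (hH : H.IsLeftBialgebroid)
include hH

theorem isColinear_t_mul (b : B) : hH.regular.IsColinear hH.regular (H.mul (H.t b)) where
  map_l c X := by simp only [LinearMap.comp_apply, ← hH.mul_assoc, hH.s_t_comm]
  ev_sw X β hβ := hH.ev_sw_t_mul hβ b X

theorem isColinear_mul_t (b : B) : hH.regular.IsColinear hH.regular (H.mul.flip (H.t b)) where
  map_l c X := by simp only [LinearMap.comp_apply, LinearMap.flip_apply, hH.mul_assoc]
  ev_sw X β hβ := hH.ev_sw_mul_t hβ b X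

end IsLeftBialgebroid

namespace LeftComodule

variable {C : H.LeftComodule M} {D : H.LeftComodule N} {E : H.LeftComodule P}

theorem IsCobilinear.tBal {f : M →ₗ[k] N →ₗ[k] P} (hf : C.IsCobilinear D E f) :
    C.TBal D fun m n => f m n :=
  { bal := hf.bal }

variable {Γ : L →ₗ[k] L →ₗ[k] B}

theorem IsColinear.sharpEv_left {f : M →ₗ[k] P} (hf : C.IsColinear E f) {φ : P → N → W}
    (hφ : E.TBal D φ) (hΓ : H.IsLeftTwoCocycle Γ) (hH : H.IsLeftBialgebroid)
    (m : M) (n : N) : E.sharpEv D Γ (f m) n φ = C.sharpEv D Γ m n fun x y => φ (f x) y := by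
  rw [LeftComodule.sharpEv, LeftComodule.sharpEv, hf.ev_sw' _ (hΓ.sharpEv_bal_inner hH hφ n)]
  simp only [hf.map_l]

/-- Meant for elements with coaction `s(b) ⊗ n'`: the elements `s(b)` of the regular comodule and
`t(b)` of the dual one. On them `Γ^#` reduces to a twisted base action. -/
theorem sharpEv_of_sw_right {φ : M → N → W} (hφ : C.TBal D φ) (hΓ : H.IsLeftTwoCocycle Γ)
    (hH : H.IsLeftBialgebroid) {b : B} {n n' : N}
    (h : ∀ β : L → N → W, H.DBal D.l β → ev (D.sw n) β = β (H.s b) n') (m : M) :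
    C.sharpEv D Γ m n φ = φ (C.twistR Γ b m) n' := by
  rw [sharpEv, ev_comm, h _ (hΓ.sharpEv_bal_outer hH hφ m), twistR_eq_ev]
  obtain ⟨f, rfl⟩ := hφ.exists_eq
  simp only [map_ev, linearMap_ev_apply]

theorem sharpEv_of_sw_left {φ : M → N → W} (hφ : C.TBal D φ) (hΓ : H.IsLeftTwoCocycle Γ)
    (hH : H.IsLeftBialgebroid) {b : B} {m m' : M}
    (h : ∀ β : L → M → W, H.DBal C.l β → ev (C.sw m) β = β (H.s b) m')
    (hm : ∀ b, C.l b m' = C.r b m') (n : N) :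
    C.sharpEv D Γ m n φ = φ m' (D.twistL Γ b n) := by
  rw [sharpEv, h _ (hΓ.sharpEv_bal_inner hH hφ n), twistL_eq_ev]
  obtain ⟨f, rfl⟩ := hφ.exists_eq
  have hb : ∀ b p q, f (C.r b p) q = f p (D.l b q) := hφ.bal
  simp only [map_ev, hm, hb]

end LeftComodule

namespace IsLeftTwoCocycle

variable {Γ : L →ₗ[k] L →ₗ[k] B} (hΓ : H.IsLeftTwoCocycle Γ) (hH : H.IsLeftBialgebroid)
include hΓ hH

theorem gmul_t_mul (b : B) (X Y : L) :
    H.gmul Γ (H.mul (H.t b) X) Y = H.mul (H.t b) (H.gmul Γ X Y) := by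
  rw [gmul_eq_ev, gmul_eq_ev, ev_comm, ev_comm (H.sw X), map_ev]
  refine ev_congr fun R T => ?_
  rw [hH.ev_sw_t_mul (hΓ.gmul_bal_left hH R T), map_ev]
  simp only [← hH.mul_assoc, hH.s_t_comm]

theorem gmul_mul_t (b : B) (X Y : L) :
    H.gmul Γ X (H.mul Y (H.t b)) = H.mul (H.gmul Γ X Y) (H.t b) := by
  rw [gmul_eq_ev, gmul_eq_ev, ev_comm, ev_comm (H.sw X), hH.ev_sw_mul_t (hΓ.gmul_bal_right hH X)]
  simp only [map_ev, linearMap_ev_apply, hH.mul_assoc]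

theorem gmul_bal_t (b : B) (X Y : L) :
    H.gmul Γ (H.mul X (H.t b)) Y = H.gmul Γ X (H.mul (H.t b) Y) := by
  rw [gmul_eq_ev, gmul_eq_ev, ev_comm, ev_comm (H.sw X), hH.ev_sw_t_mul (hΓ.gmul_bal_right hH X)]
  refine ev_congr fun R T => ?_
  rw [hH.ev_sw_mul_t (hΓ.gmul_bal_left hH R T)]
  simp only [hH.mul_assoc]

end IsLeftTwoCocycle

namespace IsLeftHopfAlgebroid

variable (hH : H.IsLeftHopfAlgebroid) {Γ : L →ₗ[k] L →ₗ[k] B}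

/-- The product `X₊ Y₊ t(Γ(Y₋, X₋))`. -/
def circₗ (Γ : L →ₗ[k] L →ₗ[k] B) : L →ₗ[k] L →ₗ[k] L :=
  LinearMap.mk₂ k (fun X Y => hH.dual.sharpEv hH.dual Γ Y X fun y x => H.mul x y)
    (by intros; simp) (by intros; simp) (by intros; simp) (by intros; simp)

theorem circₗ_apply (X Y : L) : hH.circₗ Γ X Y =
    hH.dual.sharpEv hH.dual Γ Y X fun y x => H.mul x y := rfl

variable (hΓ : H.IsLeftTwoCocycle Γ)
include hΓ

theorem circₗ_s_mul (b : B) (X Y : L) :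
    hH.circₗ Γ (H.mul (H.s b) X) Y = H.mul (H.s b) (hH.circₗ Γ X Y) := by
  refine ((hH.isColinear_s_mul b).sharpEv hH.isCobilinear_mul_flip.tBal hΓ
    hH.toIsLeftBialgebroid Y X).trans ?_
  rw [circₗ_apply, map_sharpEv]
  simp only [LinearMap.flip_apply, hH.mul_assoc]

theorem circₗ_mul_s (b : B) (X Y : L) :
    hH.circₗ Γ (H.mul X (H.s b)) Y = hH.circₗ Γ X (H.mul (H.s b) Y) := by
  refine ((hH.isColinear_mul_s b).sharpEv hH.isCobilinear_mul_flip.tBal hΓ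
    hH.toIsLeftBialgebroid Y X).trans (.trans ?_ ((hH.isColinear_s_mul b).sharpEv_left
      hH.isCobilinear_mul_flip.tBal hΓ hH.toIsLeftBialgebroid Y X).symm)
  simp only [LinearMap.flip_apply, hH.mul_assoc]

/-- Associativity of `Γ^#` for three copies of the dual comodule with the opposite multiplication.
-/
theorem circₗ_assoc (X Y Z : L) :
    hH.circₗ Γ (hH.circₗ Γ X Y) Z = hH.circₗ Γ X (hH.circₗ Γ Y Z) := by
  have := hΓ.sharpEv_assoc hH.toIsLeftBialgebroid hH.isCobilinear_mul_flip
    hH.isCobilinear_mul_flip hH.isCobilinear_mul_flip.tBal hH.isCobilinear_mul_flip.tBal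
    (fun m n p => by simp only [LinearMap.flip_apply, hH.mul_assoc]) Z Y X
  exact this.symm

theorem one_circₗ (X : L) : hH.circₗ Γ H.one X = X := by
  refine (sharpEv_of_sw_right (b := H.oneB) (n' := H.one) hH.isCobilinear_mul_flip.tBal hΓ
    hH.toIsLeftBialgebroid (fun β hβ => ?_) X).trans ?_
  · rw [hH.ev_dual_sw hβ, hH.ev_pm_one (barBal_swap hβ), hH.s_one]
  · rw [hΓ.twistR_one hH.toIsLeftBialgebroid, LinearMap.flip_apply, hH.one_mul]

theorem circₗ_one (X : L) : hH.circₗ Γ X H.one = X := by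
  refine (sharpEv_of_sw_left (b := H.oneB) (m' := H.one) hH.isCobilinear_mul_flip.tBal hΓ
    hH.toIsLeftBialgebroid (fun β hβ => ?_) (fun b => ?_) X).trans ?_
  · rw [hH.ev_dual_sw hβ, hH.ev_pm_one (barBal_swap hβ), hH.s_one]
  · simp only [LinearMap.comp_apply, LinearMap.flip_apply, hH.one_mul, hH.mul_one]
  · rw [hΓ.twistL_one hH.toIsLeftBialgebroid, LinearMap.flip_apply, hH.mul_one]

/-- The regular and dual coactions commute, so for each argument the coproduct may be taken after
the translation map instead of before. The colinearity of `circₗ` and the second description of the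
product both come from this. -/
theorem ev_sw_circₗ {Φ : L → L → L → W}
    (hΦ : Bal₃ k (fun b R => H.mul (H.t b) R) (fun b P => H.mul P (H.t b))
      (fun b P => H.mul (H.t b) P) (fun b Z => H.mul (H.s b) Z) fun R P Z => Φ P R Z) (X Y : L) :
    ev (H.sw X) (fun P Q => ev (H.sw Y) fun R T => Φ P R (hH.circₗ Γ Q T)) =
      hH.dual.sharpEv hH.dual Γ Y X fun y x =>
        ev (H.sw x) fun P Q => ev (H.sw y) fun R T => Φ P R (H.mul Q T) := by
  obtain ⟨f, hf⟩ := hΦ.exists_eq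
  have hf' : Φ = fun P R Z => f R P Z := by
    funext P R Z
    exact congrFun (congrFun (congrFun hf R) P) Z
  subst hf'
  have hb₁ : ∀ b R P Z, f (H.mul (H.t b) R) P Z = f R (H.mul P (H.t b)) Z := hΦ.bal₁
  have hb₂ : ∀ b R P Z, f R (H.mul (H.t b) P) Z = f R P (H.mul (H.s b) Z) := hΦ.bal₂
  have h1 : ∀ x R Z, H.DBal H.leftS fun P Q => f R P (H.mul Q (H.mul Z x)) := fun x R Z =>
    { bal := fun b P Q => by simp only [hb₂, hH.mul_assoc, LinearMap.comp_apply] }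
  have h1' : ∀ R Z, H.DBal H.leftS fun P Q => f R P (H.mul Q Z) := fun R Z =>
    { bal := fun b P Q => by simp only [hb₂, hH.mul_assoc, LinearMap.comp_apply] }
  have h2 : ∀ x, H.DBal H.leftS fun R T => ev (H.sw x) fun P Q => f R P (H.mul Q T) := fun x =>
    { bal := fun b R T => by
        simp only [hb₁]
        rw [hH.ev_sw_takeuchi (h1' R T)]
        simp only [hH.mul_assoc, LinearMap.comp_apply] }
  have h3 : ∀ p q P R, H.DBal hH.dual.l fun t r => f R P (H.mul p (H.mul r (H.t (Γ t q)))) :=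
    fun p q P R =>
    { bal := fun b t r => by
        simp only [hΓ.linear, hH.t_mul, hH.mul_assoc, LinearMap.comp_apply,
          LinearMap.flip_apply] }
  have key := hH.ev_sw_ev_dual₂ (γ := fun P q p R t r =>
    f R P (H.mul p (H.mul r (H.t (Γ t q))))) X Y
    { bal₁ := fun b q p P => by
        refine ev_congr fun R T => ?_
        simp only [← hΓ.balanced]
        rw [LeftComodule.ev_sw_takeuchi (C := hH.dual) (h3 p q P R)]
        simp only [LinearMap.comp_apply, LinearMap.flip_apply, hH.mul_assoc]
      bal₂ := fun b q p P => by simp only [hb₂, hH.mul_assoc] }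
    { bal₁ := fun b t r R => by
        simp only [hΓ.linear, hH.t_mul, hH.mul_assoc, LinearMap.comp_apply,
          LinearMap.flip_apply]
      bal₂ := fun b t r R => by
        simp only [hb₁]
        refine ev_congr fun q p => ?_
        rw [hH.ev_sw_takeuchi (h1' R _)]
        simp only [hH.mul_assoc] }
  simp only [circₗ_apply, map_sharpEv]
  simp only [sharpEv]
  refine .trans (ev_congr fun P Q => ev_congr fun R T => ev_comm _ _ _) (key.trans ?_)
  rw [ev_comm]
  refine ev_congr fun t r => ev_congr fun q p => ?_
  refine .trans ?_ (ev_comm _ _ _)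
  refine .trans ?_ (hH.ev_sw_mul_t (h2 p) _ _).symm
  rw [ev_comm]

theorem isCobilinear_circₗ : hH.regular.IsCobilinear hH.regular hH.regular (hH.circₗ Γ) where
  bal b X Y := hH.circₗ_mul_s hΓ b X Y
  map_l b X Y := hH.circₗ_s_mul hΓ b X Y
  ev_sw X Y β hβ := by
    obtain ⟨f, rfl⟩ := hβ.exists_eq
    have hb : ∀ b X Y, f (H.mul (H.t b) X) Y = f X (H.mul (H.s b) Y) := hβ.bal
    refine .trans ?_ (hH.ev_sw_circₗ hΓ (Φ := fun P R Z => f (H.mul P R) Z)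
      { bal₁ := fun b R P Z => by simp only [hH.mul_assoc]
        bal₂ := fun b R P Z => by simp only [hH.mul_assoc, hb] } X Y).symm
    rw [circₗ_apply, map_sharpEv]
    simp only [sharpEv, ev_ev]
    simp only [← hH.ev_sw_mul hβ]
    rfl

/-- The product of `L^Γ` as `Γ^#` on regular legs applied to `circₗ`, which already contains `Γ` on
the dual legs. In this form associativity and the unit laws come from general facts on `Γ^#`. -/
theorem twistMul_eq (X Y : L) : H.twistMul Γ X Y =
    hH.regular.sharpEv hH.regular Γ X Y fun x y => hH.circₗ Γ x y := by
  have h0 : ∀ b z, H.collapse (b ⊗ₜ[k] z) = ev z fun Z c => H.mul (H.s b) (H.mul Z (H.t c)) := by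
    intro b z
    exact map_eq_ev (H.collapse ∘ₗ TensorProduct.mk k B _ b) z
  have h1 : ∀ Q T : L, hH.circₗ Γ Q T = ev (H.pm Q) fun p q => ev (H.pm T) fun r s =>
      H.mul (H.mul p r) (H.t (Γ s q)) := by
    intro Q T
    rw [circₗ_apply, sharpEv, ev_comm, hH.ev_dual_sw]
    · refine ev_congr fun p q => ?_
      rw [hH.ev_dual_sw]
      · simp only [hH.mul_assoc, LinearMap.comp_apply, LinearMap.flip_apply]
      · exact { bal := fun b t r => by
                  simp only [hΓ.linear, hH.t_mul, hH.mul_assoc, LinearMap.comp_apply,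
                    LinearMap.flip_apply] }
    · exact hΓ.sharpEv_bal_outer hH.toIsLeftBialgebroid hH.isCobilinear_mul_flip.tBal T
  rw [twistMul, LinearMap.compr₂_apply, LinearMap.compl₁₂_apply, lift_map₂_eq_ev]
  simp only [map_ev, h0, lift_map₂_eq_ev, ev_ev]
  have h2 : ∀ b Z c, ev (Z ⊗ₜ[k] c) (fun Z c => H.mul (H.s b) (H.mul Z (H.t c))) =
      H.mul (H.s b) (H.mul Z (H.t c)) := fun b Z c => Bilin.ev_tmul {} Z c
  simp only [LinearMap.flip_apply, h2]
  rw [swpm, LinearMap.comp_apply, Bilin.ev_lTensor {}, sharpEv]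
  refine ev_congr fun P Q => ?_
  rw [LinearMap.comp_apply, Bilin.ev_lTensor {}]
  refine ev_congr fun R T => ?_
  refine .trans ?_ (hH.circₗ_s_mul hΓ _ _ _).symm
  rw [h1]
  simp only [map_ev]

/-- The two deformations in the opposite order, by commutation of the coactions. This form governs
multiplication by `t(b)` and the translation map of products. -/
theorem twistMul_eq_dual (X Y : L) : H.twistMul Γ X Y =
    hH.dual.sharpEv hH.dual Γ Y X fun y x => H.gmul Γ x y := by
  rw [hH.twistMul_eq hΓ, sharpEv]
  refine .trans (ev_congr fun P Q => ev_congr fun R T => hH.circₗ_s_mul hΓ _ _ _)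
    ((hH.ev_sw_circₗ hΓ (Φ := fun P R Z => H.mul (H.s (Γ P R)) Z) ?_ X Y).trans ?_)
  · exact { bal₁ := fun b R P Z => by simp only [hΓ.balanced]
            bal₂ := fun b R P Z => by simp only [hΓ.linear, hH.s_mul, hH.mul_assoc] }
  · simp only [gmul_eq_ev]

theorem isCobilinear_gmul_flip : hH.dual.IsCobilinear hH.dual hH.dual (H.gmulₗ Γ).flip where
  bal b y x := (hΓ.gmul_bal_t hH.toIsLeftBialgebroid b x y).symm
  map_l b y x := hΓ.gmul_mul_t hH.toIsLeftBialgebroid b x y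
  ev_sw y x β hβ := by
    simp only [LinearMap.flip_apply, gmulₗ_apply, gmul_eq_ev]
    simp only [map_ev, ev_ev]
    obtain ⟨f, rfl⟩ := hβ.exists_eq
    have hb : ∀ b X Y, f (H.mul (H.t b) X) Y = f X (H.mul Y (H.t b)) := hβ.bal
    have h1 : ∀ q p P R, H.DBal hH.dual.l fun t r =>
        f (H.mul t q) (H.mul (H.s (Γ P R)) (H.mul p r)) := fun q p P R =>
      { bal := fun b t r => by
          simp only [hH.mul_assoc, hb, LinearMap.comp_apply, LinearMap.flip_apply] }
    have h2 : ∀ z R r, H.DBal H.leftS fun P Q =>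
        f z (H.mul (H.s (Γ P R)) (H.mul Q r)) := fun z R r =>
      { bal := fun b P Q => by
          simp only [hΓ.linear, hH.s_mul, hH.mul_assoc, LinearMap.comp_apply] }
    have key := hH.ev_sw_ev_dual₂ (γ := fun P q p R t r =>
        f (H.mul t q) (H.mul (H.s (Γ P R)) (H.mul p r))) x y
      { bal₁ := fun b q p P => by
          refine ev_congr fun R T => ?_
          simp only [← hH.mul_assoc _ _ q]
          rw [LeftComodule.ev_sw_takeuchi (C := hH.dual) (h1 q p P R)]
          simp only [LinearMap.comp_apply, LinearMap.flip_apply, hH.mul_assoc]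
        bal₂ := fun b q p P => by simp only [hΓ.linear, hH.s_mul, hH.mul_assoc] }
      { bal₁ := fun b t r R => by
          simp only [hH.mul_assoc, hb, LinearMap.comp_apply, LinearMap.flip_apply]
        bal₂ := fun b t r R => by
          simp only [← hΓ.balanced]
          refine ev_congr fun q p => ?_
          rw [hH.ev_sw_takeuchi (h2 _ _ _)]
          simp only [hH.mul_assoc] }
    rw [ev_comm (hH.dual.sw y)]
    simp only [map_ev]
    refine .trans ?_ key
    refine ev_congr fun P Q => ev_congr fun R T => ?_
    rw [(hH.isColinear_s_mul _).ev_sw' _ hβ]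
    refine (hH.isCobilinear_mul_flip.ev_sw' T Q ?_).trans (ev_comm _ _ _)
    exact { bal := fun b q p => by
              simp only [hb, LinearMap.comp_apply, LinearMap.flip_apply, hH.mul_assoc] }

/-- The element `t(b)` has dual coaction `s(b) ⊗ 1`. Multiplication by `t(b)` in `L^Γ` is therefore
a twisted action on the dual comodule, as multiplication by `s(b)` is one on the regular comodule.
The relations of `L^Γ ⋄_{B^Γ} M` become those of a tensor product of comodules over `B^Γ`. -/
theorem twistMul_t_left (b : B) (X : L) : H.twistMul Γ (H.t b) X = hH.dual.twistR Γ b X := by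
  rw [hH.twistMul_eq_dual hΓ]
  refine (sharpEv_of_sw_right (b := b) (n' := H.one) (hH.isCobilinear_gmul_flip hΓ).tBal hΓ
    hH.toIsLeftBialgebroid (fun β hβ => ?_) X).trans ?_
  · rw [hH.ev_dual_sw hβ, hH.ev_pm_t (barBal_swap hβ)]
  · exact hΓ.gmul_one_left hH.toIsLeftBialgebroid _

theorem twistMul_t_right (b : B) (X : L) : H.twistMul Γ X (H.t b) = hH.dual.twistL Γ b X := by
  rw [hH.twistMul_eq_dual hΓ]
  refine (sharpEv_of_sw_left (b := b) (m' := H.one) (hH.isCobilinear_gmul_flip hΓ).tBal hΓ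
    hH.toIsLeftBialgebroid (fun β hβ => ?_) (fun b => ?_) X).trans ?_
  · rw [hH.ev_dual_sw hβ, hH.ev_pm_t (barBal_swap hβ)]
  · simp only [LinearMap.comp_apply, LinearMap.flip_apply, hH.one_mul, hH.mul_one]
  · exact hΓ.gmul_one_right hH.toIsLeftBialgebroid _

theorem twistMul_s_left (b : B) (X : L) :
    H.twistMul Γ (H.s b) X = hH.regular.twistL Γ b X := by
  rw [hH.twistMul_eq hΓ]
  refine (sharpEv_of_sw_left (b := b) (m' := H.one) (hH.isCobilinear_circₗ hΓ).tBal hΓ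
    hH.toIsLeftBialgebroid (fun β hβ => ?_) (fun b => ?_) X).trans ?_
  · exact hH.ev_sw_s hβ b
  · simp only [LinearMap.comp_apply, LinearMap.flip_apply, hH.one_mul, hH.mul_one]
  · exact hH.one_circₗ hΓ _

theorem twistMul_s_right (b : B) (X : L) :
    H.twistMul Γ X (H.s b) = hH.regular.twistR Γ b X := by
  rw [hH.twistMul_eq hΓ]
  refine (sharpEv_of_sw_right (b := b) (n' := H.one) (hH.isCobilinear_circₗ hΓ).tBal hΓ
    hH.toIsLeftBialgebroid (fun β hβ => ?_) X).trans ?_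
  · exact hH.ev_sw_s hβ b
  · exact hH.circₗ_one hΓ _

include hH in
theorem one_twistMul (X : L) : H.twistMul Γ H.one X = X := by
  rw [← hH.s_one, hH.twistMul_s_left hΓ, hΓ.twistL_one hH.toIsLeftBialgebroid]

include hH in
theorem twistMul_one (X : L) : H.twistMul Γ X H.one = X := by
  rw [← hH.s_one, hH.twistMul_s_right hΓ, hΓ.twistR_one hH.toIsLeftBialgebroid]

include hH in
theorem twistMul_assoc (X Y Z : L) :
    H.twistMul Γ (H.twistMul Γ X Y) Z = H.twistMul Γ X (H.twistMul Γ Y Z) := by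
  simp only [hH.twistMul_eq hΓ]
  exact hΓ.sharpEv_assoc hH.toIsLeftBialgebroid (hH.isCobilinear_circₗ hΓ)
    (hH.isCobilinear_circₗ hΓ) (hH.isCobilinear_circₗ hΓ).tBal (hH.isCobilinear_circₗ hΓ).tBal
    (hH.circₗ_assoc hΓ) X Y Z

end IsLeftHopfAlgebroid

namespace IsLeftBialgebroid

theorem isCobilinear_mul (hH : H.IsLeftBialgebroid) :
    hH.regular.IsCobilinear hH.regular hH.regular H.mul where
  bal b X Y := by simp only [LinearMap.comp_apply, LinearMap.flip_apply, hH.mul_assoc]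
  map_l b X Y := by simp only [LinearMap.comp_apply, hH.mul_assoc]
  ev_sw X Y β hβ := hH.ev_sw_mul hβ X Y

theorem tBal_coact (hH : H.IsLeftBialgebroid) {C : H.LeftComodule M} {D : H.LeftComodule N}
    {Ψ : L → M → N → W} (hΨ : Bal₃ k (fun b X => H.mul (H.t b) X) (fun b m => C.l b m)
      (fun b m => C.r b m) (fun b n => D.l b n) Ψ) :
    C.TBal D fun m n => ev (C.sw m) fun X p => ev (D.sw n) fun Y q => Ψ (H.mul X Y) p q := by
  obtain ⟨f, rfl⟩ := hΨ.exists_eq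
  have hb₁ : ∀ b X p q, f (H.mul (H.t b) X) p q = f X (C.l b p) q := hΨ.bal₁
  have hb₂ : ∀ b X p q, f X (C.r b p) q = f X p (D.l b q) := hΨ.bal₂
  have h1 : ∀ Y q, H.DBal C.l fun X p => f (H.mul X Y) p q := fun Y q =>
    { bal := fun b X p => by simp only [hH.mul_assoc, hb₁] }
  have h2 : ∀ m, H.DBal D.l fun Y q => ev (C.sw m) fun X p => f (H.mul X Y) p q := fun m =>
    { bal := fun b Y q => by
        simp only [← hb₂]
        rw [← LeftComodule.ev_sw_takeuchi (h1 Y q)]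
        simp only [hH.mul_assoc] }
  exact { bal := fun b m n => by
            rw [ev_comm, ev_comm (C.sw m), ev_sw_l (h2 m)]
            refine ev_congr fun Y q => ?_
            rw [ev_sw_r (h1 Y q)]
            simp only [hH.mul_assoc] }

end IsLeftBialgebroid

namespace IsLeftTwoCocycle

variable {Γ : L →ₗ[k] L →ₗ[k] B} (hΓ : H.IsLeftTwoCocycle Γ)
include hΓ

theorem gmul_assoc (hH : H.IsLeftBialgebroid) (X Y Z : L) :
    H.gmul Γ (H.gmul Γ X Y) Z = H.gmul Γ X (H.gmul Γ Y Z) := by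
  have h : ∀ X Y, H.gmul Γ X Y = hH.regular.sharpEv hH.regular Γ X Y fun x y => H.mul x y := by
    intro X Y
    rw [gmul_eq_ev, sharpEv]
    simp only [LinearMap.comp_apply, hH.mul_assoc]
    rfl
  simp only [h]
  exact hΓ.sharpEv_assoc hH hH.isCobilinear_mul hH.isCobilinear_mul hH.isCobilinear_mul.tBal
    hH.isCobilinear_mul.tBal hH.mul_assoc X Y Z

variable (hH : H.IsLeftHopfAlgebroid)
include hH

/-- `X₊ * X₋ = s(Γ(X₊, X₋))` -/
theorem ev_dual_gmul (X : L) : ev (hH.dual.sw X) (fun q p => H.gmul Γ p q) =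
    H.s (ev (hH.dual.sw X) fun q p => Γ p q) := by
  have hB := hH.toIsLeftBialgebroid
  have hb : H.DBal hH.dual.l fun q p => Γ p q :=
    { bal := fun b q p => by
        simp only [LinearMap.comp_apply, LinearMap.flip_apply, hΓ.balanced] }
  have hb' : H.DBal hH.dual.l fun q p => H.gmul Γ p q :=
    { bal := fun b q p => by
        simp only [LinearMap.comp_apply, LinearMap.flip_apply, hΓ.gmul_bal_t hB] }
  rw [hH.ev_dual_sw hb', hH.ev_dual_sw hb]
  simp only [gmul_eq_ev]
  refine (ev_congr fun p q => ev_comm _ _ _).trans ?_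
  -- The coproduct of `X₋` is traded for a second translation map on `X₊`, which cancels against the
  -- coproduct of `X₊`.
  rw [hH.ev_pm_ev_sw (γ := fun R T p => ev (H.sw p) fun P Q => H.mul (H.s (Γ P R)) (H.mul Q T))]
  · rw [map_ev]
    refine ev_congr fun p q => ?_
    have := hH.ev_pm_lam (hΓ.gmul_bal_left' hB q) p
    simp only [hH.mul_one] at this
    exact this
  · exact { bal₁ := fun b R T p => (hΓ.gmul_bal_right hB p).bal b R T
            bal₂ := fun b R T p => by
              rw [hH.ev_sw_mul_t (hΓ.gmul_bal_left hB R T)]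
              simp only [hH.mul_assoc] }

theorem ev_dual_twistL {β : L → L → W} (hβ : H.DBal hH.dual.l β) (b : B) (X : L) :
    ev (hH.dual.sw (hH.regular.twistL Γ b X)) β =
      ev (hH.dual.sw X) fun q p => β q (hH.regular.twistL Γ b p) := by
  rw [twistL_eq_ev, map_ev, ev_ev]
  obtain ⟨f, rfl⟩ := hβ.exists_eq
  have hb : ∀ b X Y, f (H.mul (H.t b) X) Y = f X (H.mul Y (H.t b)) := hβ.bal
  refine (ev_congr fun P Q => (hH.isColinear_s_mul _).ev_sw' _ hβ).trans ?_
  refine (hH.ev_sw_ev_dual (γ := fun P q p => f q (H.mul (H.s (Γ (H.s b) P)) p)) ?_ X).trans ?_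
  · exact { bal₁ := fun c q p P => by
              simp only [LinearMap.comp_apply, LinearMap.flip_apply, hb, hH.mul_assoc]
            bal₂ := fun c q p P => by
              simp only [← hΓ.balanced, hH.s_t_comm, hΓ.linear, hH.s_mul, hH.mul_assoc] }
  · refine ev_congr fun q p => ?_
    rw [twistL_eq_ev]; exact (map_ev (f q) _ _).symm

theorem ev_dual_twistR {β : L → L → W} (hβ : H.DBal hH.dual.l β) (b : B) (X : L) :
    ev (hH.dual.sw (hH.regular.twistR Γ b X)) β =
      ev (hH.dual.sw X) fun q p => β q (hH.regular.twistR Γ b p) := by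
  rw [twistR_eq_ev, map_ev, ev_ev]
  obtain ⟨f, rfl⟩ := hβ.exists_eq
  have hb : ∀ b X Y, f (H.mul (H.t b) X) Y = f X (H.mul Y (H.t b)) := hβ.bal
  refine (ev_congr fun P Q => (hH.isColinear_s_mul _).ev_sw' _ hβ).trans ?_
  refine (hH.ev_sw_ev_dual (γ := fun P q p => f q (H.mul (H.s (Γ P (H.s b))) p)) ?_ X).trans ?_
  · exact { bal₁ := fun c q p P => by
              simp only [LinearMap.comp_apply, LinearMap.flip_apply, hb, hH.mul_assoc]
            bal₂ := fun c q p P => by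
              simp only [hΓ.linear, hH.s_mul, hH.mul_assoc] }
  · refine ev_congr fun q p => ?_
    rw [twistR_eq_ev]; exact (map_ev (f q) _ _).symm

theorem twistL_regular (b : B) (X : L) : hH.regular.twistL Γ b X = H.gmul Γ (H.s b) X := by
  rw [twistL_eq_ev, hΓ.gmul_s_left hH.toIsLeftBialgebroid]; rfl

theorem twistR_regular (b : B) (X : L) : hH.regular.twistR Γ b X = H.gmul Γ X (H.s b) := by
  rw [twistR_eq_ev, hΓ.gmul_s_right hH.toIsLeftBialgebroid]; rfl

end IsLeftTwoCocycle

namespace LeftComodule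

variable (C : H.LeftComodule M) (Γ : L →ₗ[k] L →ₗ[k] B)

@[simp] theorem twistL_add (b : B) (m m' : M) :
    C.twistL Γ b (m + m') = C.twistL Γ b m + C.twistL Γ b m' := map_add (C.twistLₗ Γ b) m m'
@[simp] theorem twistL_smul (b : B) (c : k) (m : M) :
    C.twistL Γ b (c • m) = c • C.twistL Γ b m := map_smul (C.twistLₗ Γ b) c m
@[simp] theorem twistR_add (b : B) (m m' : M) :
    C.twistR Γ b (m + m') = C.twistR Γ b m + C.twistR Γ b m' := map_add (C.twistRₗ Γ b) m m'
@[simp] theorem twistR_smul (b : B) (c : k) (m : M) :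
    C.twistR Γ b (c • m) = c • C.twistR Γ b m := map_smul (C.twistRₗ Γ b) c m

end LeftComodule

namespace IsLeftTwoCocycle

variable {Γ : L →ₗ[k] L →ₗ[k] B} (hΓ : H.IsLeftTwoCocycle Γ) (hH : H.IsLeftHopfAlgebroid)
  {C : H.LeftComodule M}
include hΓ hH

theorem twistL_t_mul (b c : B) (X : L) : hH.regular.twistL Γ b (H.mul (H.t c) X) =
    H.mul (H.t c) (hH.regular.twistL Γ b X) := by
  have hB := hH.toIsLeftBialgebroid
  rw [hΓ.twistL_regular hH, hΓ.twistL_regular hH, ← hΓ.gmul_bal_t hB, hH.s_t_comm, hΓ.gmul_t_mul hB]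

theorem twistL_mul_t (b c : B) (X : L) : hH.regular.twistL Γ b (H.mul X (H.t c)) =
    H.mul (hH.regular.twistL Γ b X) (H.t c) := by
  rw [hΓ.twistL_regular hH, hΓ.twistL_regular hH, hΓ.gmul_mul_t hH.toIsLeftBialgebroid]

theorem twistR_t_mul (b c : B) (X : L) : hH.regular.twistR Γ b (H.mul (H.t c) X) =
    H.mul (H.t c) (hH.regular.twistR Γ b X) := by
  rw [hΓ.twistR_regular hH, hΓ.twistR_regular hH, hΓ.gmul_t_mul hH.toIsLeftBialgebroid]

theorem twistR_mul_t (b c : B) (X : L) : hH.regular.twistR Γ b (H.mul X (H.t c)) =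
    H.mul (hH.regular.twistR Γ b X) (H.t c) := by
  have hB := hH.toIsLeftBialgebroid
  rw [hΓ.twistR_regular hH, hΓ.twistR_regular hH, hΓ.gmul_bal_t hB, ← hH.s_t_comm, hΓ.gmul_mul_t hB]

theorem sharpEv_twistL_left {χ : L → M → W} (hχ : H.DBal C.l χ) (b : B) (X : L) (m : M) :
    hH.dual.sharpEv C Γ (hH.regular.twistL Γ b X) m χ =
      hH.dual.sharpEv C Γ X m fun x n => χ (hH.regular.twistL Γ b x) n := by
  rw [sharpEv, hΓ.ev_dual_twistL hH
    (hΓ.sharpEv_bal_inner (C := hH.dual) hH.toIsLeftBialgebroid hχ m), sharpEv]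
  simp only [LinearMap.comp_apply, LinearMap.flip_apply, hΓ.twistL_mul_t hH]

theorem sharpEv_twistR_left {χ : L → M → W} (hχ : H.DBal C.l χ) (b : B) (X : L) (m : M) :
    hH.dual.sharpEv C Γ (hH.regular.twistR Γ b X) m χ =
      hH.dual.sharpEv C Γ X m fun x n => χ (hH.regular.twistR Γ b x) n := by
  rw [sharpEv, hΓ.ev_dual_twistR hH
    (hΓ.sharpEv_bal_inner (C := hH.dual) hH.toIsLeftBialgebroid hχ m), sharpEv]
  simp only [LinearMap.comp_apply, LinearMap.flip_apply, hΓ.twistR_mul_t hH]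

theorem dbal_twistL {χ : L → M → W} (hχ : H.DBal C.l χ) (b : B) :
    H.DBal C.l fun x n => χ (hH.regular.twistL Γ b x) n := by
  obtain ⟨f, rfl⟩ := hχ.exists_eq
  have hb : ∀ b X p, f (H.mul (H.t b) X) p = f X (C.l b p) := hχ.bal
  exact { bal := fun c X p => by simp only [hΓ.twistL_t_mul hH, hb] }

theorem dbal_twistR {χ : L → M → W} (hχ : H.DBal C.l χ) (b : B) :
    H.DBal C.l fun x n => χ (hH.regular.twistR Γ b x) n := by
  obtain ⟨f, rfl⟩ := hχ.exists_eq
  have hb : ∀ b X p, f (H.mul (H.t b) X) p = f X (C.l b p) := hχ.bal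
  exact { bal := fun c X p => by simp only [hΓ.twistR_t_mul hH, hb] }

end IsLeftTwoCocycle

/-! ### Takeuchi condition and left counit for the cotwisted coaction -/

namespace IsInvertibleLeftTwoCocycle

variable {Γ : L →ₗ[k] L →ₗ[k] B} (hΓ : H.IsInvertibleLeftTwoCocycle Γ)
  (hH : H.IsLeftHopfAlgebroid) {C : H.LeftComodule M} {D : H.LeftComodule N}
  {E : H.LeftComodule P}
include hΓ

/-- By `sharpEv_coact` the products `*` on the left are coefficients of the coaction after `Γ^#`; on
the cotwisted coaction, `Γ^#` returns `m₍₋₁₎ ⊗ m₍₀₎`, whose total coaction is trivial by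
`ev_coinvariant`. The practical effect is that `X₋ * n₍₋₁₎` may be replaced by `1`, and the laws of
the cotwisted coaction are obtained this way. -/
theorem ev_twistSw_gmul {Ψ : L → L → M → W}
    (hΨ : Bal₃ k (fun b X => H.mul (H.t b) X) (fun b X => hH.dual.l b X)
      (fun b X => hH.dual.r b X) (fun b m => C.l b m) Ψ) (m : M) :
    ev (C.twistSw hH Γ m) (fun X n => ev (hH.dual.sw X) fun q x => ev (C.sw n) fun Y p =>
      Ψ (H.gmul Γ q Y) x p) = ev (C.sw m) fun X n => Ψ H.one X n := by
  rw [← hH.ev_coinvariant hΨ]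
  simp only [← hΓ.sharpEv_coact hH.toIsLeftBialgebroid hΨ]
  exact hΓ.ev_twistSw_sharpEv hH (hH.tBal_coact hΨ) m

theorem unsharpEv_twistL {φ : L → M → W} (hφ : C.TwBal hH Γ φ) (b : B) (X : L) (m : M) :
    hH.dual.unsharpEv C Γ (hH.regular.twistL Γ b X) m φ =
      hH.dual.unsharpEv C Γ X m fun x n => φ (hH.regular.twistL Γ b x) n := by
  have h1 : H.DBal C.l fun x n => hH.dual.unsharpEv C Γ x n φ := unsharpEv_tBal hH.dual C Γ φ
  have h2 := hΓ.toIsLeftTwoCocycle.dbal_twistL hH h1 b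
  rw [← hΓ.unsharpEv_sharpEv (C := hH.dual) (D := C) hH.toIsLeftBialgebroid h2 X m]
  refine congrArg _ (funext fun x => funext fun n => ?_)
  rw [← hΓ.toIsLeftTwoCocycle.sharpEv_twistL_left hH h1,
    hΓ.sharpEv_unsharpEv hH.toIsLeftBialgebroid hφ]

/-- `(b ·_Γ m)_[-1] ⊗ (b ·_Γ m)_[0] = b ·_Γ m_[-1] ⊗ m_[0]` -/
theorem ev_twistSw_twistL {φ : L → M → W} (hφ : C.TwBal hH Γ φ) (b : B) (m : M) :
    ev (C.twistSw hH Γ (C.twistL Γ b m)) φ =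
      ev (C.twistSw hH Γ m) fun X n => φ (hH.regular.twistL Γ b X) n := by
  have h1 : H.DBal C.l fun x n => hH.dual.unsharpEv C Γ x n φ := unsharpEv_tBal hH.dual C Γ φ
  have h2 := hΓ.toIsLeftTwoCocycle.dbal_twistL hH h1 b
  rw [ev_twistSw, hΓ.ev_sw_twistL hH.toIsLeftBialgebroid h1]
  simp only [← hΓ.toIsLeftTwoCocycle.twistL_regular hH]
  rw [← hΓ.ev_twistSw_sharpEv hH h2]
  simp only [← hΓ.toIsLeftTwoCocycle.sharpEv_twistL_left hH h1]
  exact ev_congr fun X n => hΓ.sharpEv_unsharpEv hH.toIsLeftBialgebroid hφ _ _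

theorem ev_twistSw_twistR {φ : L → M → W} (hφ : C.TwBal hH Γ φ) (b : B) (m : M) :
    ev (C.twistSw hH Γ (C.twistR Γ b m)) φ =
      ev (C.twistSw hH Γ m) fun X n => φ (hH.regular.twistR Γ b X) n := by
  have h1 : H.DBal C.l fun x n => hH.dual.unsharpEv C Γ x n φ := unsharpEv_tBal hH.dual C Γ φ
  have h2 := hΓ.toIsLeftTwoCocycle.dbal_twistR hH h1 b
  rw [ev_twistSw, hΓ.ev_sw_twistR hH.toIsLeftBialgebroid h1]
  simp only [← hΓ.toIsLeftTwoCocycle.twistR_regular hH]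
  rw [← hΓ.ev_twistSw_sharpEv hH h2]
  simp only [← hΓ.toIsLeftTwoCocycle.sharpEv_twistR_left hH h1]
  exact ev_congr fun X n => hΓ.sharpEv_unsharpEv hH.toIsLeftBialgebroid hφ _ _

/-- With the test function written as a pullback along `Γ^#`, the two sides contain `Γ(b, X₋ *
n₍₋₁₎)` and `Γ(X₋ * n₍₋₁₎, b)`. Replacing the product by `1` makes both `ε(b)`. -/
theorem ev_twistSw_takeuchi {φ : L → M → W} (hφ : C.TwBal hH Γ φ) (b : B) (m : M) :
    ev (C.twistSw hH Γ m) (fun X n => φ (hH.dual.twistL Γ b X) n) =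
      ev (C.twistSw hH Γ m) fun X n => φ X (C.twistR Γ b n) := by
  have hB := hH.toIsLeftBialgebroid
  have h1 : H.DBal C.l fun x n => hH.dual.unsharpEv C Γ x n φ := unsharpEv_tBal hH.dual C Γ φ
  have h0 : ∀ X n, hH.dual.sharpEv C Γ X n (fun x n => hH.dual.unsharpEv C Γ x n φ) = φ X n :=
    hΓ.sharpEv_unsharpEv hB hφ
  simp only [← h0]
  generalize (fun x n => hH.dual.unsharpEv C Γ x n φ) = χ at h1
  obtain ⟨f, rfl⟩ := h1.exists_eq
  have hb : ∀ b X p, f (H.mul (H.t b) X) p = f X (C.l b p) := h1.bal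
  have e1 : ∀ X n, hH.dual.sharpEv C Γ (hH.dual.twistL Γ b X) n (fun x n => f x n) =
      ev (hH.dual.sw X) fun q x => ev (C.sw n) fun Y p =>
        f (H.mul x (H.t (Γ (H.s b) (H.gmul Γ q Y)))) p := by
    intro X n
    rw [sharpEv, hΓ.ev_sw_twistL (C := hH.dual) hB (hΓ.sharpEv_bal_inner (C := hH.dual) hB h1 n)]
    simp only [LinearMap.comp_apply, LinearMap.flip_apply, hΓ.cocycle]
  have e2 : ∀ X n, hH.dual.sharpEv C Γ X (C.twistR Γ b n) (fun x n => f x n) =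
      ev (hH.dual.sw X) fun q x => ev (C.sw n) fun Y p =>
        f (H.mul x (H.t (Γ (H.gmul Γ q Y) (H.s b)))) p := by
    intro X n
    rw [sharpEv, ev_comm, hΓ.ev_sw_twistR hB (hΓ.sharpEv_bal_outer (C := hH.dual) hB h1 X),
      ev_comm]
    simp only [LinearMap.comp_apply, LinearMap.flip_apply, hΓ.cocycle]
  simp only [e1, e2]
  rw [hΓ.ev_twistSw_gmul (Ψ := fun A x p => f (H.mul x (H.t (Γ (H.s b) A))) p),
    hΓ.ev_twistSw_gmul (Ψ := fun A x p => f (H.mul x (H.t (Γ A (H.s b)))) p)]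
  · simp only [hΓ.one_left, hΓ.one_right]
  · exact { bal₁ := fun c A x p => by
              simp only [hΓ.linear, hH.t_mul, hH.mul_assoc, LinearMap.comp_apply,
                LinearMap.flip_apply]
            bal₂ := fun c A x p => by simp only [hH.mul_assoc, LinearMap.comp_apply, hb] }
  · exact { bal₁ := fun c A x p => by
              simp only [← hΓ.balanced, hH.s_t_comm]
              simp only [hΓ.linear, hH.t_mul, hH.mul_assoc, LinearMap.comp_apply,
                LinearMap.flip_apply]
            bal₂ := fun c A x p => by simp only [hH.mul_assoc, LinearMap.comp_apply, hb] }

/-- Since `s(Γ(X₊, X₋)) = X₊ * X₋`, the cocycle identity produces `Γ(X₊, X₋ * n₍₋₁₎)`, which becomes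
`Γ(X₊, 1) = ε(X₊)`. -/
theorem ev_twistSw_counit (m : M) : ev (C.twistSw hH Γ m) (fun X n =>
    C.twistL Γ (ev (hH.dual.sw X) fun q p => Γ p q) n) = m := by
  have e1 : ∀ X n, C.twistL Γ (ev (hH.dual.sw X) fun q p => Γ p q) n =
      ev (hH.dual.sw X) fun q p => ev (C.sw n) fun Y n' => C.l (Γ p (H.gmul Γ q Y)) n' := by
    intro X n
    rw [twistL_eq_ev, ← hΓ.toIsLeftTwoCocycle.ev_dual_gmul hH X]
    simp only [map_ev, linearMap_ev_apply, hΓ.cocycle]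
    rw [ev_comm]
  simp only [e1]
  rw [hΓ.ev_twistSw_gmul (Ψ := fun A p n => C.l (Γ p A) n)]
  · simp only [hΓ.one_right]
    exact ev_sw_counit m
  · exact { bal₁ := fun c A x p => by
              simp only [hΓ.balanced, LinearMap.comp_apply, LinearMap.flip_apply]
            bal₂ := fun c A x p => by simp only [hΓ.linear, LinearMap.comp_apply, C.mul_l] }

end IsInvertibleLeftTwoCocycle

namespace IsInvertibleLeftTwoCocycle

variable {Γ : L →ₗ[k] L →ₗ[k] B} (hΓ : H.IsInvertibleLeftTwoCocycle Γ)
  (hH : H.IsLeftHopfAlgebroid) {C : H.LeftComodule M} {D : H.LeftComodule N}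
  {E : H.LeftComodule P}
include hΓ

/-- The cotwisted coaction of `Γ(m₍₋₁₎, n₍₋₁₎) f(m₍₀₎, n₍₀₎)`. -/
theorem ev_twistSw_sharp {f : M →ₗ[k] N →ₗ[k] P} (hf : C.IsCobilinear D E f) {φ : L → P → W}
    (hφ : E.TwBal hH Γ φ) (m : M) (n : N) :
    ev (E.twistSw hH Γ (C.sharpEv D Γ m n fun p q => f p q)) φ =
      ev (C.twistSw hH Γ m) fun X p => ev (D.twistSw hH Γ n) fun Y q =>
        φ (H.twistMul Γ X Y) (C.sharpEv D Γ p q fun p q => f p q) := by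
  have hB := hH.toIsLeftBialgebroid
  have h1 : H.DBal E.l fun x n => hH.dual.unsharpEv E Γ x n φ := unsharpEv_tBal hH.dual E Γ φ
  have h0 : ∀ X n, hH.dual.sharpEv E Γ X n (fun x n => hH.dual.unsharpEv E Γ x n φ) = φ X n :=
    hΓ.sharpEv_unsharpEv hB hφ
  rw [ev_twistSw, hΓ.ev_sw_sharpEv hB hf h1]
  obtain ⟨g, hg⟩ := h1.exists_eq
  have hg' : ∀ x n, hH.dual.unsharpEv E Γ x n φ = g x n := fun x n =>
    congrFun (congrFun hg x) n
  simp only [hg'] at h0 h1 ⊢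
  simp only [← h0]
  have hb : ∀ b X p, g (H.mul (H.t b) X) p = g X (E.l b p) := h1.bal
  have e1 : ∀ X p Y q, hH.dual.sharpEv E Γ (H.twistMul Γ X Y)
      (C.sharpEv D Γ p q fun p q => f p q) (fun x n => g x n) =
      ev (hH.dual.sw X) fun a x => ev (C.sw p) fun Z p' => ev (hH.dual.sw Y) fun c y =>
        ev (D.sw q) fun T q' =>
          g (H.gmul Γ x (H.mul y (H.t (Γ (H.gmul Γ c (H.gmul Γ a Z)) T)))) (f p' q') := by
    intro X p Y q
    rw [hH.twistMul_eq_dual hΓ.toIsLeftTwoCocycle, sharpEv, ev_comm,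
      hΓ.ev_sw_sharpEv hB hf (hΓ.sharpEv_bal_outer (C := hH.dual) hB h1 _)]
    have e2 : ∀ U p, ev (hH.dual.sw (hH.dual.sharpEv hH.dual Γ Y X fun y x => H.gmul Γ x y))
        (fun A V => g (hH.dual.l (Γ A U) V) p) = ev (hH.dual.sw Y) fun c y =>
          ev (hH.dual.sw X) fun a x => g (hH.dual.l (Γ (H.gmul Γ c a) U) (H.gmul Γ x y)) p :=
      fun U p => hΓ.ev_sw_sharpEv hB (hH.isCobilinear_gmul_flip hΓ.toIsLeftTwoCocycle)
        (β := fun A V => g (hH.dual.l (Γ A U) V) p)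
        { bal := fun b A V => by
            simp only [hΓ.linear, hH.t_mul, hH.mul_assoc, LinearMap.comp_apply,
              LinearMap.flip_apply] } Y X
    simp only [e2]
    simp only [LinearMap.comp_apply, LinearMap.flip_apply, hΓ.cocycle, hΓ.gmul_assoc hB,
      hΓ.gmul_mul_t hB]
    refine .trans ?_ (ev_comm _ _ _)
    refine ev_congr fun Z p' => ?_
    refine .trans ?_ (ev_comm _ _ _)
    refine .trans (ev_comm _ _ _) ?_
    refine ev_congr fun c y => ?_
    rw [ev_comm]
  simp only [e1]
  have h3 : ∀ A x p' q, H.DBal hH.dual.l fun c y => ev (D.sw q) fun T q' =>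
      g (H.gmul Γ x (H.mul y (H.t (Γ (H.gmul Γ c A) T)))) (f p' q') := fun A x p' q =>
    { bal := fun b c y => by
        simp only [hΓ.gmul_t_mul hB, hΓ.linear, hH.t_mul, hH.mul_assoc, LinearMap.comp_apply,
          LinearMap.flip_apply] }
  have h4 : Bal₃ k (fun b X => H.mul (H.t b) X) (fun b X => hH.dual.l b X)
      (fun b X => hH.dual.r b X) (fun b m => C.l b m) fun A x p' =>
      ev (D.twistSw hH Γ n) fun Y q => ev (hH.dual.sw Y) fun c y => ev (D.sw q) fun T q' =>
        g (H.gmul Γ x (H.mul y (H.t (Γ (H.gmul Γ c A) T)))) (f p' q') :=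
    { bal₁ := fun b A x p' => by
        refine ev_congr fun Y q => ?_
        simp only [← hΓ.gmul_bal_t hB]
        rw [LeftComodule.ev_sw_takeuchi (C := hH.dual) (h3 A x p' q)]
        simp only [LinearMap.comp_apply, LinearMap.flip_apply, hH.mul_assoc, hΓ.gmul_bal_t hB]
      bal₂ := fun b A x p' => by
        simp only [LinearMap.comp_apply, hΓ.gmul_t_mul hB, hf.map_l, hb] }
  -- In `e1` the coefficients of `m` enter `Γ` only as `X₋ * p₍₋₁₎`, which becomes `1`. What is left
  -- of `n` is then `Γ^#` of its cotwisted coaction.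
  refine .trans ?_ (.trans (hΓ.ev_twistSw_gmul hH h4 m).symm ?_)
  · simp only [hΓ.gmul_one_right hB]
    rw [ev_comm (C.sw m) (D.sw n), ev_comm (C.sw m) (D.twistSw hH Γ n)]
    have h5 : H.DBal D.l fun y q' => ev (C.sw m) fun X p' => g (H.gmul Γ X y) (f p' q') :=
      { bal := fun b y q' => by
          simp only [← hf.bal, ← hΓ.gmul_bal_t hB]
          exact ev_sw_takeuchi (C := C) (β := fun X p' => g (H.gmul Γ X y) (f p' q'))
            { bal := fun c X p => by simp only [hΓ.gmul_t_mul hB, hf.map_l, hb] } b m }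
    rw [← hΓ.ev_twistSw_sharpEv hH h5]
    refine ev_congr fun Y q => ?_
    rw [sharpEv]
    refine .trans ?_ (ev_comm _ _ _)
    refine ev_congr fun c y => ?_
    rw [ev_comm]
    rfl
  · refine ev_congr fun X p => ?_
    refine .trans ?_ (ev_comm _ _ _)
    refine ev_congr fun a x => ?_
    rw [ev_comm]

/-! ### Compatibility of the cotwisted coaction with comodule maps -/

/-- By coassociativity the coaction of `M` is itself a family of comodule maps to the regular
comodule, so naturality of the cotwisted coaction applies to it. -/
theorem ev_sw_ev_twistSw {γ : L → L → M → W}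
    (hγ : Bal₃ k (hH.dual.twistR Γ) (hH.regular.twistL Γ) (fun b X => H.mul (H.t b) X)
      (fun b m => C.l b m) γ) (m : M) :
    ev (C.sw m) (fun Z n => ev (hH.regular.twistSw hH Γ Z) fun X Y => γ X Y n) =
      ev (C.twistSw hH Γ m) fun X p => ev (C.sw p) fun Z n => γ X Z n :=
  hΓ.ev_twistSw_comm hH (C := C) (D := hH.regular) (τ := C.sw) (e := fun b => H.mul (H.t b))
    (e' := fun b m => C.l b m) (fun b => hH.isColinear_t_mul b)
    (fun _ hχ b m => ev_sw_l hχ b m) (fun _ hγ m => ev_sw_coassoc hγ m) hγ m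

theorem ev_pm_ev_twistSw {γ : L → L → L → W}
    (hγ : Bal₃ k (hH.dual.twistR Γ) (hH.regular.twistL Γ) (fun b X => hH.dual.l b X)
      (fun b X => H.mul (H.t b) X) γ) (X : L) :
    ev (hH.dual.sw X) (fun q p => ev (hH.regular.twistSw hH Γ p) fun Y Z => γ Y Z q) =
      ev (hH.regular.twistSw hH Γ X) fun Y Z => ev (hH.dual.sw Z) fun q p => γ Y p q := by
  have hτ : ∀ (χ : L → L → W), Bilin k χ → ∀ X, ev (((TensorProduct.comm k L L).toLinearMap ∘ₗ
      hH.dual.sw) X) χ = ev (hH.dual.sw X) fun q p => χ p q := fun χ hχ X =>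
    hχ.ev_comm_map (hH.dual.sw X)
  have key := hΓ.ev_twistSw_comm hH (C := hH.regular) (D := hH.regular)
    (τ := (TensorProduct.comm k L L).toLinearMap ∘ₗ hH.dual.sw) (e := fun b => hH.dual.l b)
    (e' := fun b X => H.mul (H.t b) X) (fun b => hH.isColinear_mul_t b) ?_ ?_ hγ X
  · obtain ⟨f, rfl⟩ := hγ.exists_eq
    rw [hτ _ {}] at key
    refine key.trans (ev_congr fun Y Z => ?_)
    exact hτ _ {} Z
  · intro χ hχ b X
    refine (hτ _ hχ.toBilin _).trans ?_
    obtain ⟨f, rfl⟩ := hχ.exists_eq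
    refine .trans ?_ (hτ _ {} X).symm
    have hb : ∀ b X Y, f (H.mul X (H.t b)) Y = f X (H.mul (H.t b) Y) := hχ.bal
    refine (hH.isColinear_s_mul b).ev_sw' X (β := fun q p => f p q) ?_
    exact { bal := fun c q p => by simp only [LinearMap.comp_apply, LinearMap.flip_apply, hb] }
  · intro γ hγ X
    obtain ⟨f, rfl⟩ := hγ.exists_eq
    have hb₁ : ∀ b X Y Z, f (H.mul (H.t b) X) Y Z = f X (H.mul (H.s b) Y) Z := hγ.bal₁
    have hb₂ : ∀ b X Y Z, f X (H.mul Y (H.t b)) Z = f X Y (H.mul (H.t b) Z) := hγ.bal₂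
    rw [hτ _ {}]
    refine (hH.ev_sw_ev_dual (γ := fun P q p => f P p q) ?_ X).symm.trans
      (ev_congr fun P Q => (hτ _ {} Q).symm)
    exact { bal₁ := fun b q p P => by
              simp only [LinearMap.comp_apply, LinearMap.flip_apply, hb₂]
            bal₂ := fun b q p P => by simp only [hb₁] }

theorem ev_sw_ev_twistSw_dual {γ : L → L → L → W}
    (hγ : Bal₃ k (hH.dual.twistR Γ) (hH.dual.twistL Γ) (fun b X => H.mul (H.s b) X)
      (fun b X => H.mul (H.t b) X) γ) (X : L) :
    ev (H.sw X) (fun P Q => ev (hH.dual.twistSw hH Γ Q) fun Y Z => γ Y Z P) =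
      ev (hH.dual.twistSw hH Γ X) fun Y Z => ev (H.sw Z) fun P Q => γ Y Q P := by
  have hτ : ∀ (χ : L → L → W), Bilin k χ → ∀ X, ev (((TensorProduct.comm k L L).toLinearMap ∘ₗ
      H.sw) X) χ = ev (H.sw X) fun q p => χ p q := fun χ hχ X =>
    hχ.ev_comm_map (H.sw X)
  have key := hΓ.ev_twistSw_comm hH (C := hH.dual) (D := hH.dual)
    (τ := (TensorProduct.comm k L L).toLinearMap ∘ₗ H.sw) (e := fun b => H.mul (H.s b))
    (e' := fun b X => H.mul (H.t b) X) (fun b => hH.isColinear_s_mul b) ?_ ?_ hγ X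
  · obtain ⟨f, rfl⟩ := hγ.exists_eq
    rw [hτ _ {}] at key
    refine key.trans (ev_congr fun Y Z => ?_)
    exact hτ _ {} Z
  · intro χ hχ b X
    rw [hτ _ hχ.toBilin]
    obtain ⟨f, rfl⟩ := hχ.exists_eq
    refine .trans ?_ (hτ _ {} X).symm
    have hb : ∀ b X Y, f (H.mul (H.s b) X) Y = f X (H.mul (H.t b) Y) := hχ.bal
    exact hH.ev_sw_mul_t (β := fun P Q => f Q P)
      { bal := fun c q p => by simp only [LinearMap.comp_apply, hb] } b X
  · intro γ hγ X
    obtain ⟨f, rfl⟩ := hγ.exists_eq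
    have hb₁ : ∀ b X Y Z, f (H.mul (H.t b) X) Y Z = f X (hH.dual.l b Y) Z := hγ.bal₁
    have hb₂ : ∀ b X Y Z, f X (H.mul (H.s b) Y) Z = f X Y (H.mul (H.t b) Z) := hγ.bal₂
    rw [hτ _ {}]
    refine (hH.ev_sw_ev_dual (γ := fun P q p => f q p P) ?_ X).trans
      (ev_congr fun P Q => (hτ _ {} Q).symm)
    exact { bal₁ := hb₁
            bal₂ := hb₂ }

/-! ### Coassociativity and the right counit -/

theorem ev_twistSw_coassoc {γ : L → L → M → W}
    (hγ : Bal₃ k (hH.dual.twistR Γ) (hH.regular.twistL Γ) (hH.dual.twistR Γ) (C.twistL Γ) γ)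
    (m : M) :
    ev (C.twistSw hH Γ m) (fun X n => ev (hH.regular.twistSw hH Γ X) fun Y Z => γ Y Z n) =
      ev (C.twistSw hH Γ m) fun X n => ev (C.twistSw hH Γ n) fun Y p => γ X Y p := by
  have hB := hH.toIsLeftBialgebroid
  obtain ⟨f, rfl⟩ := hγ.exists_eq
  have hb₁ : ∀ b X Y Z, f (hH.dual.twistR Γ b X) Y Z = f X (hH.regular.twistL Γ b Y) Z := hγ.bal₁
  have hb₂ : ∀ b X Y Z, f X (hH.dual.twistR Γ b Y) Z = f X Y (C.twistL Γ b Z) := hγ.bal₂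
  have h1 : ∀ Y, C.TwBal hH Γ fun Z n => f Y Z n := fun Y => { bal := fun b X Z => hb₂ b Y X Z }
  -- The last two variables of `f` are pulled back along the inverse of `Γ^#`; `e1` recovers `f`.
  -- The pullback replaces one cotwisted coaction by the original one, with which the other is known
  -- to commute.
  let g : L → L → M → W := fun Y z n => hH.dual.unsharpEv C Γ z n fun Z n => f Y Z n
  have hg : ∀ Y, H.DBal C.l (g Y) := fun Y => unsharpEv_tBal hH.dual C Γ _
  have hgb : ∀ b Y z n, g (hH.dual.twistR Γ b Y) z n = g Y (hH.regular.twistL Γ b z) n := by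
    intro b Y z n
    simp only [g, hb₁]
    exact (hΓ.unsharpEv_twistL hH (h1 Y) b z n).symm
  have hg3 : Bal₃ k (hH.dual.twistR Γ) (hH.regular.twistL Γ) (fun b X => H.mul (H.t b) X)
      (fun b m => C.l b m) g :=
    { add₁ := fun Y Y' z n => by simp only [g, map_add, LinearMap.add_apply, unsharpEv_fun_add]
      smul₁ := fun c Y z n => by
        simp only [g, map_smul, LinearMap.smul_apply, unsharpEv_fun_smul]
      add₂ := fun Y => (hg Y).add_left
      smul₂ := fun c Y => (hg Y).smul_left c
      add₃ := fun Y => (hg Y).add_right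
      smul₃ := fun c Y => (hg Y).smul_right c
      bal₁ := hgb
      bal₂ := fun b Y => (hg Y).bal b }
  have e1 : ∀ Y Z n, hH.dual.sharpEv C Γ Z n (g Y) = f Y Z n := fun Y Z n =>
    hΓ.sharpEv_unsharpEv hB (h1 Y) Z n
  have e2 := hΓ.ev_sw_ev_twistSw hH hg3 m
  simp only [ev_twistSw C hH Γ (fun Y p => f _ Y p)]
  refine .trans ?_ e2
  clear_value g
  obtain ⟨g, rfl⟩ := hg3.exists_eq
  have hb : ∀ b Y X p, g Y (H.mul (H.t b) X) p = g Y X (C.l b p) := fun b Y => (hg Y).bal b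
  have hz : ∀ n, hH.regular.TwBal hH Γ fun Y z => g Y z n := fun n =>
    { bal := fun b Y z => hgb b Y z n }
  have hz' : ∀ c n, hH.regular.TwBal hH Γ fun Y z => g Y (H.mul z (H.t c)) n := fun c n =>
    { bal := fun b Y z => by
        rw [← hΓ.toIsLeftTwoCocycle.twistL_mul_t hH]
        exact hgb b Y _ n }
  rw [← hΓ.ev_twistSw_sharpEv hH (φ := fun Z n =>
    ev (hH.regular.twistSw hH Γ Z) fun X Y => g X Y n)]
  · simp only [← e1]
    refine ev_congr fun X n => ?_
    refine (hΓ.ev_pm_ev_twistSw hH (γ := fun Y z q => ev (C.sw n) fun P p =>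
      g Y (H.mul z (H.t (Γ q P))) p) ?_ X).symm.trans ?_
    · exact { bal₁ := fun b Y z q => ev_congr fun P p => (hz' _ p).bal b Y z
              bal₂ := fun b Y z q => by
                simp only [hΓ.linear, hH.t_mul, hH.mul_assoc, LinearMap.comp_apply,
                  LinearMap.flip_apply] }
    · refine ev_congr fun q x => ?_
      rw [ev_comm]
      refine ev_congr fun P p => ?_
      exact (hΓ.ev_twistSw_colinear hH (hH.isColinear_mul_t (Γ q P)) (hz p) x).symm
  · exact { bal := fun b Z n => by
              refine (hΓ.ev_twistSw_colinear hH (hH.isColinear_t_mul b) (hz n) Z).trans ?_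
              simp only [hb] }

theorem ev_twistSw_counit_right (X : L) :
    ev (hH.regular.twistSw hH Γ X) (fun P Q =>
      hH.dual.twistR Γ (ev (hH.dual.sw Q) fun q p => Γ p q) P) = X := by
  have hB := hH.toIsLeftBialgebroid
  have h1 : ∀ w r, H.DBal hH.dual.l fun q z => H.mul z (H.t (Γ (H.mul q w) r)) := fun w r =>
    { bal := fun b q z => by
        simp only [hΓ.linear, hH.t_mul, hH.mul_assoc, LinearMap.comp_apply,
          LinearMap.flip_apply] }
  have h2 : ∀ z q, H.DBal hH.dual.l fun r y => H.mul z (H.t (Γ (H.mul q y) r)) := fun z q =>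
    { bal := fun b r y => by
        simp only [← hΓ.balanced, hH.mul_assoc, LinearMap.comp_apply, LinearMap.flip_apply] }
  have h3 : ∀ Y, H.DBal hH.dual.l fun q z => ev (hH.dual.sw Y) fun r y =>
      H.mul z (H.t (Γ (H.mul q y) r)) := fun Y =>
    { bal := fun b q z => ev_congr fun r y => (h1 y r).bal b q z }
  have hφ : H.DBal H.leftS fun Z Y => ev (hH.dual.sw Z) fun q z => ev (hH.dual.sw Y) fun r y =>
      H.mul z (H.t (Γ (H.mul q y) r)) :=
    { bal := fun b Z Y => by
        refine (ev_sw_r (C := hH.dual) (h3 Y) b Z).trans (ev_congr fun q z => ?_)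
        refine .trans ?_ ((hH.isColinear_s_mul b).ev_sw' Y (h2 z q)).symm
        simp only [hH.mul_assoc] }
  -- The expression is `Γ^#` of `Z ⊗ Y ↦ Z₊ t(Γ(Z₋ Y₊, Y₋))`. Summed over the cotwisted coproduct of
  -- `X` it therefore becomes the value on the ordinary `Δ(X)`, where translation pairs cancel to
  -- `X₊ t(ε(X₋)) = X`.
  have e1 : ∀ P Q, hH.dual.twistR Γ (ev (hH.dual.sw Q) fun q p => Γ p q) P =
      hH.dual.sharpEv hH.regular Γ P Q fun Z Y => ev (hH.dual.sw Z) fun q z =>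
        ev (hH.dual.sw Y) fun r y => H.mul z (H.t (Γ (H.mul q y) r)) := by
    intro P Q
    rw [twistR_eq_ev, ← hΓ.toIsLeftTwoCocycle.ev_dual_gmul hH Q]
    simp only [map_ev, linearMap_ev_apply, hΓ.cocycle]
    simp only [gmul_eq_ev, sharpEv]
    have h4 : ∀ a Y p Z, ev (hH.dual.sw (hH.dual.l (Γ a Y) p)) (fun q z =>
        ev (hH.dual.sw Z) fun r y => H.mul z (H.t (Γ (H.mul q y) r))) =
        ev (hH.dual.sw p) fun q z => ev (hH.dual.sw Z) fun r y =>
          H.mul z (H.t (Γ (H.mul (H.mul (H.s (Γ a Y)) q) y) r)) := fun a Y p Z =>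
      ev_sw_l (C := hH.dual) (h3 Z) _ _
    simp only [h4]
    simp only [ev_comm (hH.regular.sw Q) (hH.dual.sw _)]
    rw [← LeftComodule.ev_sw_coassoc (C := hH.dual) (γ := fun a q z => ev (hH.regular.sw Q) fun Y Z =>
      ev (hH.dual.sw Z) fun r y => H.mul z (H.t (Γ (H.mul (H.mul (H.s (Γ a Y)) q) y) r)))]
    · have h5 : ∀ Y r y z, H.DBal H.leftS fun a q =>
          H.mul z (H.t (Γ (H.mul (H.mul (H.s (Γ a Y)) q) y) r)) := fun Y r y z =>
        { bal := fun b a q => by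
            simp only [hΓ.linear, hH.s_mul, hH.mul_assoc, LinearMap.comp_apply] }
      refine ev_congr fun q z => ?_
      have h6 := hH.ev_sw_ev_dual (γ := fun Y r y => ev (H.sw q) fun a q =>
        H.mul z (H.t (Γ (H.mul (H.mul (H.s (Γ a Y)) q) y) r)))
        { bal₁ := fun b r y Y => by
            simp only [← hΓ.balanced, hH.mul_assoc, LinearMap.comp_apply, LinearMap.flip_apply]
          bal₂ := fun b r y Y => by
            simp only [← hΓ.balanced]
            rw [hH.ev_sw_takeuchi (h5 Y r y z)]
            simp only [hH.mul_assoc] } Q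
      refine .trans ?_ (h6.symm.trans ?_)
      · refine ev_congr fun r y => ?_
        simp only [map_ev, linearMap_ev_apply, LinearMap.comp_apply, LinearMap.flip_apply,
          hH.mul_assoc]
        exact ev_comm _ _ _
      · refine .trans ?_ (ev_comm _ _ _)
        exact ev_congr fun Y Z => ev_comm _ _ _
    · exact { bal₁ := fun b a q z => by
                simp only [hΓ.linear, hH.s_mul, hH.mul_assoc]
              bal₂ := fun b a q z => by
                simp only [← hH.mul_assoc, hH.s_t_comm]
                simp only [hΓ.linear, hH.t_mul, hH.mul_assoc, LinearMap.comp_apply,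
                  LinearMap.flip_apply] }
  simp only [e1]
  refine (hΓ.ev_twistSw_sharpEv (C := hH.regular) hH hφ X).trans ?_
  refine (ev_congr fun Z Y => ev_comm _ _ _).trans ?_
  refine (hH.ev_sw_ev_dual (γ := fun P r y => ev (hH.dual.sw P) fun q z =>
    H.mul z (H.t (Γ (H.mul q y) r))) ?_ X).trans ?_
  · exact { bal₁ := fun b r y P => ev_congr fun q z => (h2 z q).bal b r y
            bal₂ := fun b r y P => by
              refine .trans ?_ (ev_sw_r (C := hH.dual) (h1 y r) b P).symm
              simp only [hH.mul_assoc] }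
  · refine (ev_congr fun r x => ?_).trans (ev_sw_counit (C := hH.dual) X)
    simp only [hH.ev_dual_sw (h1 _ r)]
    refine (hH.ev_sw_pm_one (β := fun z q => H.mul z (H.t (Γ q r))) ?_ x).trans ?_
    · exact { bal := fun b z q => by simp only [hΓ.linear, hH.t_mul, hH.mul_assoc] }
    · simp only [hΓ.one_left, LinearMap.comp_apply, LinearMap.flip_apply]

end IsInvertibleLeftTwoCocycle

/-! ### The cotwist as a left bialgebroid and the twisted comodules -/

namespace IsLeftTwoCocycle

variable {Γ : L →ₗ[k] L →ₗ[k] B} (hΓ : H.IsLeftTwoCocycle Γ)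
  (hH : H.IsLeftHopfAlgebroid) {C : H.LeftComodule M}
include hΓ hH

theorem twistMul_s_s (a b : B) :
    H.twistMul Γ (H.s a) (H.s b) = H.s (Γ (H.s a) (H.s b)) := by
  rw [hH.twistMul_s_left hΓ, hΓ.twistL_regular hH, hΓ.gmul_s_s hH.toIsLeftBialgebroid]

theorem twistMul_t_t (a b : B) :
    H.twistMul Γ (H.t b) (H.t a) = H.t (Γ (H.s a) (H.s b)) := by
  rw [hH.twistMul_t_left hΓ, twistR_eq_ev, hH.ev_dual_sw, hH.ev_pm_t]
  · simp only [LinearMap.comp_apply, LinearMap.flip_apply, hH.one_mul]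
  all_goals
    exact { bal := fun c X Y => by
              simp only [hΓ.linear, LinearMap.comp_apply, LinearMap.flip_apply, hH.t_mul,
                hH.mul_assoc] }

theorem twistMul_s_t_comm (a b : B) :
    H.twistMul Γ (H.s a) (H.t b) = H.twistMul Γ (H.t b) (H.s a) := by
  have hB := hH.toIsLeftBialgebroid
  rw [hH.twistMul_s_left hΓ, hH.twistMul_s_right hΓ, hΓ.twistL_regular hH, hΓ.twistR_regular hH]
  have h1 := hΓ.gmul_mul_t hB b (H.s a) H.one
  have h2 := hΓ.gmul_t_mul hB b H.one (H.s a)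
  rw [hH.one_mul, hΓ.gmul_one_right hB] at h1
  rw [hH.mul_one, hΓ.gmul_one_left hB] at h2
  rw [h1, h2, hH.s_t_comm]

/-- Passage between `L^Γ ⋄_{B^Γ} M` and the tensor product over `B^Γ` of the dual comodule with `M`,
on the level of test functions. -/
theorem dbal_cotwist_iff {φ : L → M → W} :
    (H.cotwist Γ).DBal (C.twistLₗ Γ) φ ↔ C.TwBal hH Γ φ := by
  have h : (fun (b : B) X => (H.cotwist Γ).mul ((H.cotwist Γ).t b) X) = hH.dual.twistR Γ := by
    funext b X
    exact hH.twistMul_t_left hΓ b X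
  rw [DBal, h]
  rfl

theorem leftS_cotwist : (H.cotwist Γ).leftS = hH.regular.twistLₗ Γ := by
  ext b X
  exact hH.twistMul_s_left hΓ b X

theorem dbal_cotwist_leftS_iff {φ : L → L → W} :
    (H.cotwist Γ).DBal (H.cotwist Γ).leftS φ ↔ hH.regular.TwBal hH Γ φ := by
  rw [hΓ.leftS_cotwist hH, hΓ.dbal_cotwist_iff hH]

theorem dbal₃_cotwist_iff {γ : L → L → M → W} :
    (H.cotwist Γ).DBal₃ (C.twistLₗ Γ) γ ↔
      Bal₃ k (hH.dual.twistR Γ) (hH.regular.twistL Γ) (hH.dual.twistR Γ) (C.twistL Γ) γ := by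
  have h : (fun (b : B) X => (H.cotwist Γ).mul ((H.cotwist Γ).t b) X) = hH.dual.twistR Γ := by
    funext b X
    exact hH.twistMul_t_left hΓ b X
  have h' : (fun (b : B) X => (H.cotwist Γ).mul ((H.cotwist Γ).s b) X) = hH.regular.twistL Γ := by
    funext b X
    exact hH.twistMul_s_left hΓ b X
  rw [DBal₃, h, h']
  rfl

theorem ev_sharpRaw_comm_pm {φ : L → L → W} (hφ : H.DBal H.leftS φ) (z : L ⊗[k] L) :
    ev (sharpRaw Γ ((TensorProduct.comm k L L).toLinearMap ∘ₗ H.pm) (H.mul.flip ∘ₗ H.t) H.sw z)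
      φ = ev z fun X Y => hH.dual.sharpEv hH.regular Γ X Y φ := by
  rw [ev_sharpRaw _ _ _ _ hφ.toBilin]
  refine ev_congr fun X Y => ?_
  have h := hΓ.sharpEv_bal_inner (C := hH.dual) (D := hH.regular) hH.toIsLeftBialgebroid hφ Y
  exact (h.toBilin.ev_comm_map (H.pm X)).trans (hH.ev_dual_sw h X).symm

theorem twistTensorRel_cotwist :
    (H.twistRing Γ).diamondRel (H.twistRing Γ).leftS = hH.dual.twistTensorRel hH.regular Γ := by
  have h1 : ∀ b X, (H.twistRing Γ).mul ((H.twistRing Γ).t b) X = hH.dual.twistR Γ b X :=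
    hH.twistMul_t_left hΓ
  have h2 : ∀ b X, (H.twistRing Γ).leftS b X = hH.regular.twistL Γ b X :=
    hH.twistMul_s_left hΓ
  simp only [RingData.diamondRel, twistTensorRel, h1, h2]

end IsLeftTwoCocycle

namespace IsInvertibleLeftTwoCocycle

variable {Γ : L →ₗ[k] L →ₗ[k] B} (hΓ : H.IsInvertibleLeftTwoCocycle Γ)
  (hH : H.IsLeftHopfAlgebroid) {C : H.LeftComodule M} {D : H.LeftComodule N}
  {E : H.LeftComodule P}
include hΓ hH

theorem diamondSharp_mkQ (z : L ⊗[k] L) : H.diamondSharp Γ ((H.cotwist Γ).cls z) =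
    H.cls (sharpRaw Γ hH.dual.sw hH.dual.l hH.regular.sw z) := by
  have h0 : ∀ z, H.cls (sharpRaw Γ ((TensorProduct.comm k L L).toLinearMap ∘ₗ H.pm)
      (H.mul.flip ∘ₗ H.t) H.sw z) = H.cls (sharpRaw Γ hH.dual.sw hH.dual.l hH.regular.sw z) := by
    intro z
    refine mkQ_diamondRel_eq fun β hβ => ?_
    rw [hΓ.ev_sharpRaw_comm_pm hH hβ, ev_sharpRaw _ _ _ _ hβ.toBilin]
    rfl
  refine (induced_mkQ ?_ z).trans (h0 z)
  refine le_trans (hΓ.twistTensorRel_cotwist hH).le ?_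
  intro z hz
  have h1 := hΓ.twistTensorRel_le (C := hH.dual) (D := hH.regular) hH.toIsLeftBialgebroid hz
  rw [Submodule.mem_comap]
  exact (Submodule.Quotient.mk_eq_zero _).1 ((h0 z).trans ((Submodule.Quotient.mk_eq_zero _).2 h1))

theorem diamondSharp_bijective : Function.Bijective (H.diamondSharp Γ) := by
  have h := hΓ.invertible L L hH.dual hH.regular
  have h1 : ∀ z, hH.dual.sharp hH.regular Γ ((hH.dual.twistTensorRel hH.regular Γ).mkQ z) =
      H.cls (sharpRaw Γ hH.dual.sw hH.dual.l hH.regular.sw z) :=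
    hΓ.sharp_mkQ hH.toIsLeftBialgebroid
  constructor
  · intro x y hxy
    obtain ⟨x, rfl⟩ := Submodule.mkQ_surjective _ x
    obtain ⟨y, rfl⟩ := Submodule.mkQ_surjective _ y
    replace hxy := (hΓ.diamondSharp_mkQ hH x).symm.trans (hxy.trans (hΓ.diamondSharp_mkQ hH y))
    rw [← h1, ← h1] at hxy
    have := (Submodule.Quotient.eq _).1 (h.1 hxy)
    rw [← hΓ.twistTensorRel_cotwist hH] at this
    exact (Submodule.Quotient.eq _).2 this
  · intro y
    obtain ⟨x, rfl⟩ := h.2 y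
    obtain ⟨x, rfl⟩ := Submodule.mkQ_surjective _ x
    exact ⟨(H.cotwist Γ).cls x, (hΓ.diamondSharp_mkQ hH x).trans (h1 x).symm⟩

/-- `diamondSharp` is `Γ^#` for the dual and regular comodules, so its inverse on `Δ(X)` is the
cotwisted regular coaction. -/
theorem comul_cotwist (X : L) :
    (H.cotwist Γ).comul X = (H.cotwist Γ).cls (hH.regular.twistSw hH Γ X) := by
  refine (hΓ.diamondSharp_bijective hH).1 ?_
  refine (apply_inverse (hΓ.diamondSharp_bijective hH) _).trans ?_
  rw [hΓ.diamondSharp_mkQ hH, ← cls_sw]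
  refine mkQ_diamondRel_eq fun β hβ => ?_
  rw [ev_sharpRaw _ _ _ _ hβ.toBilin]
  exact (hΓ.ev_twistSw_sharpEv (C := hH.regular) hH hβ X).symm

theorem ev_cotwist_sw {φ : L → L → W} (hφ : hH.regular.TwBal hH Γ φ) (X : L) :
    ev ((H.cotwist Γ).sw X) φ = ev (hH.regular.twistSw hH Γ X) φ :=
  ev_sw_of_comul ((hΓ.dbal_cotwist_leftS_iff hH).2 hφ) (hΓ.comul_cotwist hH X)

theorem counit_cotwist (X : L) :
    (H.cotwist Γ).counit X = ev (hH.dual.sw X) fun q p => Γ p q := by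
  refine (lift_eq_ev Γ (H.pm X)).trans (hH.ev_dual_sw (β := fun q p => Γ p q) ?_ X).symm
  exact { bal := fun b q p => by
            simp only [LinearMap.comp_apply, LinearMap.flip_apply, hΓ.balanced] }

theorem counit_cotwist_twistR (b : B) (X : L) : (H.cotwist Γ).counit (hH.dual.twistR Γ b X) =
    Γ (H.s ((H.cotwist Γ).counit X)) (H.s b) := by
  rw [hΓ.counit_cotwist hH, hΓ.counit_cotwist hH, hΓ.ev_sw_twistR (C := hH.dual)
    hH.toIsLeftBialgebroid]
  · rw [← hΓ.toIsLeftTwoCocycle.ev_dual_gmul hH]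
    simp only [map_ev, linearMap_ev_apply, hΓ.cocycle]
  · exact { bal := fun b q p => by
              simp only [LinearMap.comp_apply, LinearMap.flip_apply, hΓ.balanced] }

theorem ev_rep_mkQ {φ : L → M → W} (hφ : C.TwBal hH Γ φ) (z : L ⊗[k] M) :
    ev (rep ((H.cotwist Γ).diamondRel (C.twistLₗ Γ))
      (((H.cotwist Γ).diamondRel (C.twistLₗ Γ)).mkQ z)) φ = ev z φ :=
  ((hΓ.dbal_cotwist_iff hH).2 hφ).ev_congr (mkQ_rep _ _)

/-- The dual coaction of `s(b)` is `1 ⊗ s(b)`, so `Γ^#` fixes the class of `s(b) ⊗ m`. -/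
theorem unsharpEv_s {φ : L → M → W} (hφ : C.TwBal hH Γ φ) (b : B) (m : M) :
    hH.dual.unsharpEv C Γ (H.s b) m φ = φ (H.s b) m := by
  have hB := hH.toIsLeftBialgebroid
  have h := hΓ.sharpEv_unsharpEv (C := hH.dual) (D := C) hB hφ (H.s b) m
  rw [sharpEv_of_sw_left (b := H.oneB) (m' := H.s b) (unsharpEv_tBal hH.dual C Γ φ)
    hΓ.toIsLeftTwoCocycle hB, hΓ.twistL_one hB] at h
  · exact h
  · intro β hβ
    rw [hH.ev_dual_sw hβ, hH.ev_pm_s (IsLeftHopfAlgebroid.barBal_swap hβ), hH.s_one]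
  · intro c
    simp only [LinearMap.comp_apply, LinearMap.flip_apply, hH.s_t_comm]

theorem ev_twistSw_of_sw {φ : L → M → W} (hφ : C.TwBal hH Γ φ) {b : B} {m m' : M}
    (h : ∀ β : L → M → W, H.DBal C.l β → ev (C.sw m) β = β (H.s b) m') :
    ev (C.twistSw hH Γ m) φ = φ (H.s b) m' := by
  rw [ev_twistSw, h _ (unsharpEv_tBal hH.dual C Γ φ), hΓ.unsharpEv_s hH hφ]

theorem ev_twistSw_mul {φ : L → L → W} (hφ : hH.regular.TwBal hH Γ φ) (X Y : L) :
    ev (hH.regular.twistSw hH Γ (H.twistMul Γ X Y)) φ =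
      ev (hH.regular.twistSw hH Γ X) fun P Q => ev (hH.regular.twistSw hH Γ Y) fun R T =>
        φ (H.twistMul Γ P R) (H.twistMul Γ Q T) := by
  have := hΓ.ev_twistSw_sharp hH (hH.isCobilinear_circₗ hΓ.toIsLeftTwoCocycle) hφ X Y
  simpa only [← hH.twistMul_eq hΓ.toIsLeftTwoCocycle] using this

theorem twBal_mul_right {φ : L → L → W} (hφ : hH.regular.TwBal hH Γ φ) (Y : L) :
    hH.regular.TwBal hH Γ fun P Q => ev (hH.regular.twistSw hH Γ Y) fun R T =>
      φ (H.twistMul Γ P R) (H.twistMul Γ Q T) := by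
  obtain ⟨f, rfl⟩ := hφ.exists_eq
  have hb : ∀ b X p, f (hH.dual.twistR Γ b X) p = f X (hH.regular.twistL Γ b p) := hφ.bal
  have h := hΓ.toIsLeftTwoCocycle
  exact { bal := fun b P Q => by
            simp only [← hH.twistMul_t_left h, ← hH.twistMul_s_left h] at hb ⊢
            simp only [hH.twistMul_assoc h, hb]
          add_left := by intros; simp [-map_ev]
          add_right := by intros; simp
          smul_left := by intros; simp
          smul_right := by intros; simp }

/-- `Δ^Γ(t(b) ·_Γ X) = X_[1] ⊗ t(b) ·_Γ X_[2]` -/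
theorem ev_twistSw_t_mul {φ : L → L → W} (hφ : hH.regular.TwBal hH Γ φ) (b : B) (X : L) :
    ev (hH.regular.twistSw hH Γ (hH.dual.twistR Γ b X)) φ =
      ev (hH.regular.twistSw hH Γ X) fun P Q => φ P (hH.dual.twistR Γ b Q) := by
  have h := hΓ.toIsLeftTwoCocycle
  rw [← hH.twistMul_t_left h, hΓ.ev_twistSw_mul hH hφ,
    hΓ.ev_twistSw_of_sw hH (hΓ.twBal_mul_right hH hφ X) (b := H.oneB) (m' := H.t b)]
  · simp only [hH.s_one, hH.one_twistMul h, hH.twistMul_t_left h]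
  · intro β hβ
    rw [hH.s_one]
    exact hH.ev_sw_t hβ b

/-- The comodule `M^Γ` over the cotwist, with twisted `B^Γ`-actions. -/
@[reducible] def twist (C : H.LeftComodule M) : (H.cotwist Γ).LeftComodule M where
  l := C.twistLₗ Γ
  r := C.twistRₗ Γ
  coact := ((H.cotwist Γ).diamondRel (C.twistLₗ Γ)).mkQ ∘ₗ C.twistSw hH Γ
  one_l m := hΓ.twistL_one hH.toIsLeftBialgebroid m
  mul_l a b m := hΓ.twistL_mulB hH.toIsLeftBialgebroid a b m
  one_r m := hΓ.twistR_one hH.toIsLeftBialgebroid m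
  mul_r a b m := hΓ.twistR_mulB hH.toIsLeftBialgebroid a b m
  l_r a b m := hΓ.twistL_twistR hH.toIsLeftBialgebroid a b m
  coact_l b m := by
    have h := hΓ.toIsLeftTwoCocycle
    refine mkQ_diamondRel_eq fun β hβ => ?_
    rw [hβ.toBilin.ev_rTensor]
    have hφ := (h.dbal_cotwist_iff hH).1 hβ
    refine (hΓ.ev_twistSw_twistL hH hφ b m).trans ?_
    obtain ⟨f, rfl⟩ := hβ.exists_eq
    have hb : ∀ b X p, f (hH.dual.twistR Γ b X) p = f X (C.twistL Γ b p) := hφ.bal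
    simp only [← hH.twistMul_s_left h]
    refine (hΓ.ev_rep_mkQ hH ?_ _).symm
    exact { bal := fun c X n => by
              simp only [← hb, ← hH.twistMul_t_left h]
              rw [← hH.twistMul_assoc h, h.twistMul_s_t_comm hH, hH.twistMul_assoc h] }
  coact_r b m := by
    have h := hΓ.toIsLeftTwoCocycle
    refine mkQ_diamondRel_eq fun β hβ => ?_
    rw [hβ.toBilin.ev_rTensor]
    have hφ := (h.dbal_cotwist_iff hH).1 hβ
    refine (hΓ.ev_twistSw_twistR hH hφ b m).trans ?_
    obtain ⟨f, rfl⟩ := hβ.exists_eq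
    have hb : ∀ b X p, f (hH.dual.twistR Γ b X) p = f X (C.twistL Γ b p) := hφ.bal
    simp only [← hH.twistMul_s_right h]
    refine (hΓ.ev_rep_mkQ hH ?_ _).symm
    exact { bal := fun c X n => by
              simp only [← hb, ← hH.twistMul_t_left h]
              rw [hH.twistMul_assoc h] }
  takeuchi b m := by
    have h := hΓ.toIsLeftTwoCocycle
    refine mkQ_diamondRel_eq fun β hβ => ?_
    rw [hβ.toBilin.ev_rTensor, hβ.toBilin.ev_lTensor]
    have hφ := (h.dbal_cotwist_iff hH).1 hβ
    obtain ⟨f, rfl⟩ := hβ.exists_eq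
    have hb : ∀ b X p, f (hH.dual.twistR Γ b X) p = f X (C.twistL Γ b p) := hφ.bal
    refine (hΓ.ev_rep_mkQ hH ?_ _).trans (.trans ?_ (hΓ.ev_rep_mkQ hH ?_ _).symm)
    · exact { bal := fun c X n => by
                change f (H.twistMul Γ (hH.dual.twistR Γ c X) (H.t b)) n =
                  f (H.twistMul Γ X (H.t b)) (C.twistL Γ c n)
                rw [← hb, ← hH.twistMul_t_left h, ← hH.twistMul_t_left h, hH.twistMul_assoc h] }
    · refine .trans ?_ (hΓ.ev_twistSw_takeuchi hH hφ b m)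
      refine ev_congr fun X n => ?_
      exact congrArg (fun X => f X n) (hH.twistMul_t_right h b X)
    · exact { bal := fun c X n => by
                change f _ (C.twistR Γ b n) = f X (C.twistR Γ b (C.twistL Γ c n))
                rw [hb, h.twistL_twistR hH.toIsLeftBialgebroid] }
  coassoc m := by
    have h := hΓ.toIsLeftTwoCocycle
    refine mkQ_diamondRel₃_eq fun γ hγ => ?_
    have hγ' := (h.dbal₃_cotwist_iff hH).1 hγ
    obtain ⟨f, rfl⟩ := hγ.exists_eq
    have hb₁ : ∀ b X Y Z, f (hH.dual.twistR Γ b X) Y Z = f X (hH.regular.twistL Γ b Y) Z :=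
      hγ'.bal₁
    have hb₂ : ∀ b X Y Z, f X (hH.dual.twistR Γ b Y) Z = f X Y (C.twistL Γ b Z) := hγ'.bal₂
    have h1 : ∀ n, hH.regular.TwBal hH Γ fun Y Z => f Y Z n := fun n =>
      { bal := fun b X Y => hb₁ b X Y n }
    have h2 : ∀ X, C.TwBal hH Γ fun Y n => f X Y n := fun X => { bal := fun b Y n => hb₂ b X Y n }
    rw [ev_assoc_rTensor, ev_lTensor_ev]
    refine (hΓ.ev_rep_mkQ hH ?_ _).trans (.trans ?_ (hΓ.ev_rep_mkQ hH ?_ _).symm)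
    · exact { bal := fun b X n => by
                simp only [hΓ.ev_cotwist_sw hH (h1 _)]
                rw [hΓ.ev_twistSw_t_mul hH (h1 n)]
                simp only [hb₂] }
    · simp only [hΓ.ev_cotwist_sw hH (h1 _)]
      refine (hΓ.ev_twistSw_coassoc hH hγ' m).trans (ev_congr fun X n => ?_)
      exact (hΓ.ev_rep_mkQ hH (h2 X) _).symm
    · exact { bal := fun b X n => by
                refine (hΓ.ev_rep_mkQ hH (h2 _) _).trans (.trans ?_
                  (hΓ.ev_rep_mkQ hH (h2 _) _).symm)
                simp only [hb₁]
                exact (hΓ.ev_twistSw_twistL hH (h2 X) b n).symm }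
  counit_coact m := by
    have h := hΓ.toIsLeftTwoCocycle
    rw [lift_eq_ev]
    refine (hΓ.ev_rep_mkQ hH ?_ _).trans ?_
    · exact { bal := fun b X n => by
                change C.twistL Γ ((H.cotwist Γ).counit _) n =
                  C.twistL Γ ((H.cotwist Γ).counit _) (C.twistL Γ b n)
                rw [hΓ.counit_cotwist_twistR hH, h.twistL_mulB hH.toIsLeftBialgebroid] }
    · refine .trans (ev_congr fun X n => ?_) (hΓ.ev_twistSw_counit hH m)
      rw [← hΓ.counit_cotwist hH]
      rfl

end IsInvertibleLeftTwoCocycle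

namespace LeftComodule

variable (C : H.LeftComodule M) (Γ : L →ₗ[k] L →ₗ[k] B)

@[simp] theorem twistL_add_left (a b : B) (m : M) :
    C.twistL Γ (a + b) m = C.twistL Γ a m + C.twistL Γ b m :=
  LinearMap.map_add₂ (C.twistLₗ Γ) a b m
@[simp] theorem twistL_smul_left (c : k) (b : B) (m : M) :
    C.twistL Γ (c • b) m = c • C.twistL Γ b m := LinearMap.map_smul₂ (C.twistLₗ Γ) c b m
@[simp] theorem twistR_add_left (a b : B) (m : M) :
    C.twistR Γ (a + b) m = C.twistR Γ a m + C.twistR Γ b m :=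
  LinearMap.map_add₂ (C.twistRₗ Γ) a b m
@[simp] theorem twistR_smul_left (c : k) (b : B) (m : M) :
    C.twistR Γ (c • b) m = c • C.twistR Γ b m := LinearMap.map_smul₂ (C.twistRₗ Γ) c b m

end LeftComodule

namespace IsInvertibleLeftTwoCocycle

variable {Γ : L →ₗ[k] L →ₗ[k] B} (hΓ : H.IsInvertibleLeftTwoCocycle Γ)
  (hH : H.IsLeftHopfAlgebroid) {C : H.LeftComodule M} {D : H.LeftComodule N}
  {E : H.LeftComodule P}
include hΓ hH

theorem dbal₃_cotwist_leftS_iff {γ : L → L → L → W} :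
    (H.cotwist Γ).DBal₃ (H.cotwist Γ).leftS γ ↔ Bal₃ k (hH.dual.twistR Γ)
      (hH.regular.twistL Γ) (hH.dual.twistR Γ) (hH.regular.twistL Γ) γ := by
  rw [hΓ.leftS_cotwist hH, hΓ.dbal₃_cotwist_iff hH]

theorem counit_cotwist_twistL_regular (b : B) (X : L) :
    (H.cotwist Γ).counit (hH.regular.twistL Γ b X) =
      Γ (H.s b) (H.s ((H.cotwist Γ).counit X)) := by
  rw [hΓ.counit_cotwist hH, hΓ.counit_cotwist hH, hΓ.ev_dual_twistL hH]
  · rw [← hΓ.toIsLeftTwoCocycle.ev_dual_gmul hH]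
    simp only [map_ev, hΓ.cocycle, hΓ.toIsLeftTwoCocycle.twistL_regular hH]
  · exact { bal := fun b q p => by
              simp only [LinearMap.comp_apply, LinearMap.flip_apply, hΓ.balanced] }

/-- The product formula gives `Γ(X₊, Y₊ * Y₋ * X₋)`, and `Y₊ * Y₋ = s(ε^Γ(Y))`. The value depends on
`Y` only through its counit, which yields both character laws. -/
theorem counit_cotwist_mul (X Y : L) : (H.cotwist Γ).counit (H.twistMul Γ X Y) =
    ev (hH.dual.sw X) fun q p => Γ p (H.gmul Γ (H.s ((H.cotwist Γ).counit Y)) q) := by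
  have hB := hH.toIsLeftBialgebroid
  have h := hΓ.toIsLeftTwoCocycle
  rw [hΓ.counit_cotwist hH, hΓ.counit_cotwist hH, ← h.ev_dual_gmul hH,
    hH.twistMul_eq_dual h]
  refine (h.ev_sw_sharpEv hB (hH.isCobilinear_gmul_flip h) (β := fun q p => Γ p q) ?_ Y X).trans ?_
  · exact { bal := fun b q p => by
              simp only [LinearMap.comp_apply, LinearMap.flip_apply, hΓ.balanced] }
  · have hadd : ∀ q z, H.gmul Γ (ev (hH.dual.sw Y) z) q = ev (hH.dual.sw Y) fun t r =>
        H.gmul Γ (z t r) q := fun q z => map_ev ((H.gmulₗ Γ).flip q) _ _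
    simp only [hadd, map_ev]
    rw [ev_comm]
    refine ev_congr fun q p => ev_congr fun t r => ?_
    rw [LinearMap.flip_apply, gmulₗ_apply, ← hΓ.cocycle, h.gmul_assoc hB]

/-- The coring and Takeuchi laws are properties of the cotwisted coaction of the regular comodule.
Multiplicativity of `Δ^Γ` is its compatibility with `Γ^#`, applied to `circₗ`. -/
theorem isLeftBialgebroid_cotwist : (H.cotwist Γ).IsLeftBialgebroid := by
  have hB := hH.toIsLeftBialgebroid
  have h := hΓ.toIsLeftTwoCocycle
  have hmul : (H.cotwist Γ).mul = H.twistMul Γ := rfl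
  have hs : (H.cotwist Γ).s = H.s := rfl
  have ht : (H.cotwist Γ).t = H.t := rfl
  have hmulB : ∀ a b, (H.cotwist Γ).mulB a b = Γ (H.s a) (H.s b) := fun _ _ => rfl
  have hφ : ∀ {β : L → L → (H.cotwist Γ).Diamond},
      (H.cotwist Γ).DBal (H.cotwist Γ).leftS β → hH.regular.TwBal hH Γ β :=
    (h.dbal_cotwist_leftS_iff hH).1
  refine
    { mulB_assoc := fun a b c => ?_
      oneB_mul := fun a => ?_
      mulB_one := fun a => ?_
      mul_assoc := hH.twistMul_assoc h
      one_mul := hH.one_twistMul h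
      mul_one := hH.twistMul_one h
      s_mul := fun a b => (h.twistMul_s_s hH a b).symm
      s_one := hH.s_one
      t_mul := fun a b => (h.twistMul_t_t hH a b).symm
      t_one := hH.t_one
      s_t_comm := h.twistMul_s_t_comm hH
      comul_s := fun b X => ?_
      comul_t := fun b X => ?_
      coassoc := fun X => ?_
      counit_s := fun b X => ?_
      counit_t := fun b X => ?_
      counit_left := fun X => ?_
      counit_right := fun X => ?_
      takeuchi := fun b X => ?_
      comul_one := ?_
      comul_mul := fun X Y => ?_
      counit_one := ?_
      counit_mul_s := fun X Y => ?_
      counit_mul_t := fun X Y => ?_ }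
  · simp only [hmulB, ← h.gmul_s_s hB, hΓ.cocycle]
  · rw [hmulB]
    change Γ (H.s H.oneB) _ = _
    rw [hH.s_one, hΓ.one_left, hB.counit_s_self]
  · rw [hmulB]
    change Γ _ (H.s H.oneB) = _
    rw [hH.s_one, hΓ.one_right, hB.counit_s_self]
  · rw [hΓ.comul_cotwist hH]
    refine mkQ_diamondRel_eq fun β hβ => ?_
    rw [hβ.toBilin.ev_rTensor]
    have hφ := hφ hβ
    rw [hmul, hs, hH.twistMul_s_left h, hΓ.ev_twistSw_twistL hH hφ]
    simp only [hH.twistMul_s_left h]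
    refine (hΓ.ev_cotwist_sw hH ?_ X).symm
    obtain ⟨f, rfl⟩ := hβ.exists_eq
    have hb : ∀ b X p, f (hH.dual.twistR Γ b X) p = f X (hH.regular.twistL Γ b p) := hφ.bal
    exact { bal := fun c P Q => by
              simp only [← hb, ← hH.twistMul_s_left h b, ← hH.twistMul_t_left h]
              rw [← hH.twistMul_assoc h, h.twistMul_s_t_comm hH, hH.twistMul_assoc h] }
  · rw [hΓ.comul_cotwist hH]
    refine mkQ_diamondRel_eq fun β hβ => ?_
    rw [hβ.toBilin.ev_lTensor]
    have hφ := hφ hβ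
    rw [hmul, ht, hH.twistMul_t_left h, hΓ.ev_twistSw_t_mul hH hφ]
    simp only [hH.twistMul_t_left h]
    refine (hΓ.ev_cotwist_sw hH ?_ X).symm
    obtain ⟨f, rfl⟩ := hβ.exists_eq
    have hb : ∀ b X p, f (hH.dual.twistR Γ b X) p = f X (hH.regular.twistL Γ b p) := hφ.bal
    exact { bal := fun c P Q => by
              simp only [← hH.twistMul_s_left h, ← hH.twistMul_t_left h] at hb ⊢
              have e : H.twistMul Γ (H.s c) (H.twistMul Γ (H.t b) Q) =
                  H.twistMul Γ (H.t b) (H.twistMul Γ (H.s c) Q) := by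
                rw [← hH.twistMul_assoc h, h.twistMul_s_t_comm hH, hH.twistMul_assoc h]
              rw [hb, e] }
  · refine mkQ_diamondRel₃_eq fun γ hγ => ?_
    have hγ' := (hΓ.dbal₃_cotwist_leftS_iff hH).1 hγ
    obtain ⟨f, rfl⟩ := hγ.exists_eq
    have hb₁ : ∀ b X Y Z, f (hH.dual.twistR Γ b X) Y Z = f X (hH.regular.twistL Γ b Y) Z :=
      hγ'.bal₁
    have hb₂ : ∀ b X Y Z, f X (hH.dual.twistR Γ b Y) Z = f X Y (hH.regular.twistL Γ b Z) :=
      hγ'.bal₂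
    have h1 : ∀ n, hH.regular.TwBal hH Γ fun Y Z => f Y Z n := fun n =>
      { bal := fun b X Y => hb₁ b X Y n }
    have h2 : ∀ X, hH.regular.TwBal hH Γ fun Y n => f X Y n := fun X =>
      { bal := fun b Y n => hb₂ b X Y n }
    rw [ev_assoc_rTensor, ev_lTensor_ev]
    simp only [hΓ.ev_cotwist_sw hH (h1 _), hΓ.ev_cotwist_sw hH (h2 _)]
    rw [hΓ.ev_cotwist_sw hH, hΓ.ev_cotwist_sw hH, hΓ.ev_twistSw_coassoc hH hγ' X]
    · exact { bal := fun b X n => by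
                simp only [hb₁, hΓ.ev_twistSw_twistL hH (h2 _)] }
    · exact { bal := fun b X n => by
                rw [hΓ.ev_twistSw_t_mul hH (h1 n)]
                simp only [hb₂] }
  · exact (congrArg _ (hH.twistMul_s_left h b X)).trans
      (hΓ.counit_cotwist_twistL_regular hH b X)
  · exact (congrArg _ (hH.twistMul_t_left h b X)).trans (hΓ.counit_cotwist_twistR hH b X)
  · rw [lift_eq_ev]
    simp only [LinearMap.comp_apply, hmul, hs, hH.twistMul_s_left h]
    rw [hΓ.ev_cotwist_sw hH]
    · simp only [hΓ.counit_cotwist hH]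
      exact hΓ.ev_twistSw_counit hH X
    · exact { bal := fun b P Q => by
                rw [hΓ.counit_cotwist_twistR hH, h.twistL_mulB hB] }
  · rw [lift_eq_ev]
    simp only [LinearMap.comp_apply, LinearMap.flip_apply, hmul, ht, hH.twistMul_t_left h]
    rw [hΓ.ev_cotwist_sw hH]
    · simp only [hΓ.counit_cotwist hH]
      exact hΓ.ev_twistSw_counit_right hH X
    · exact { bal := fun b P Q => by
                rw [hΓ.counit_cotwist_twistL_regular hH, h.twistR_mulB hB] }
  · refine mkQ_diamondRel_eq fun β hβ => ?_
    rw [hβ.toBilin.ev_rTensor, hβ.toBilin.ev_lTensor]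
    have hφ := hφ hβ
    obtain ⟨f, rfl⟩ := hβ.exists_eq
    have hb : ∀ b X p, f (hH.dual.twistR Γ b X) p = f X (hH.regular.twistL Γ b p) := hφ.bal
    simp only [LinearMap.flip_apply, hmul, ht, hs, hH.twistMul_t_right h, hH.twistMul_s_right h]
    rw [hΓ.ev_cotwist_sw hH, hΓ.ev_cotwist_sw hH]
    · exact hΓ.ev_twistSw_takeuchi hH hφ b X
    · exact { bal := fun c X n => by
                rw [hb, h.twistL_twistR hH.toIsLeftBialgebroid] }
    · exact { bal := fun c X n => by
                rw [← hb, ← hH.twistMul_t_left h, ← hH.twistMul_t_left h,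
                  ← hH.twistMul_t_right h, ← hH.twistMul_t_right h, hH.twistMul_assoc h] }
  · rw [hΓ.comul_cotwist hH]
    refine mkQ_diamondRel_eq fun β hβ => ?_
    rw [hβ.toBilin.ev_tmul]
    refine (hΓ.ev_twistSw_of_sw (C := hH.regular) hH (hφ hβ) (b := H.oneB) (m := H.one)
      (m' := H.one) fun β hβ => ?_).trans ?_
    · rw [hH.s_one]
      exact hB.ev_sw_one hβ
    · rw [hH.s_one]
      rfl
  · rw [hΓ.comul_cotwist hH]
    refine mkQ_diamondRel_eq fun β hβ => ?_
    rw [lift_map₂_eq_ev]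
    simp only [ev_ev, hβ.toBilin.ev_tmul]
    have hφ := hφ hβ
    rw [hmul, hΓ.ev_twistSw_mul hH hφ]
    refine (hΓ.ev_cotwist_sw hH (hΓ.twBal_mul_right hH hφ Y) X).symm.trans ?_
    rw [ev_comm, ev_comm ((H.cotwist Γ).sw X)]
    refine (hΓ.ev_cotwist_sw hH ?_ Y).symm
    obtain ⟨f, rfl⟩ := hβ.exists_eq
    have hb : ∀ b X p, f (H.twistMul Γ (H.t b) X) p = f X (H.twistMul Γ (H.s b) p) := by
      intro b X p
      rw [hH.twistMul_t_left h, hH.twistMul_s_left h]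
      exact hφ.bal b X p
    have h1 : ∀ R T, hH.regular.TwBal hH Γ fun P Q =>
        f (H.twistMul Γ P R) (H.twistMul Γ Q T) := fun R T =>
      { bal := fun b P Q => by
          simp only [← hH.twistMul_t_left h, ← hH.twistMul_s_left h, hH.twistMul_assoc h, hb] }
    have h2 := fun b R T => hΓ.ev_twistSw_takeuchi hH (h1 R T) b X
    simp only [← hH.twistMul_t_right h, ← hH.twistMul_s_right h, hH.twistMul_assoc h] at h2
    exact { bal := fun b R T => by
              simp only [← hH.twistMul_t_left h, ← hH.twistMul_s_left h]
              exact (hΓ.ev_cotwist_sw hH (h1 _ _) X).trans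
                ((h2 b R T).trans (hΓ.ev_cotwist_sw hH (h1 _ _) X).symm) }
  · rw [hΓ.counit_cotwist hH, hH.ev_dual_sw]
    · refine (hH.ev_pm_one ?_).trans ?_
      · exact { bal := fun b q p => hΓ.balanced b q p }
      · rw [hΓ.one_left, hB.counit_one]
        rfl
    · exact { bal := fun b q p => by
                simp only [LinearMap.comp_apply, LinearMap.flip_apply, hΓ.balanced] }
  · have e1 : (H.cotwist Γ).counit (H.twistMul Γ X (H.s ((H.cotwist Γ).counit Y))) =
        ev (hH.dual.sw X) fun q p => Γ p (H.gmul Γ (H.s ((H.cotwist Γ).counit Y)) q) := by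
      rw [hH.twistMul_s_right h, hΓ.counit_cotwist hH, hΓ.ev_dual_twistR hH]
      · simp only [hΓ.twistR_regular hH, ← hΓ.cocycle]
      · exact { bal := fun b q p => by
                  simp only [LinearMap.comp_apply, LinearMap.flip_apply, hΓ.balanced] }
    exact (hΓ.counit_cotwist_mul hH X Y).trans e1.symm
  · have e1 : (H.cotwist Γ).counit (H.twistMul Γ X (H.t ((H.cotwist Γ).counit Y))) =
        ev (hH.dual.sw X) fun q p => Γ p (H.gmul Γ (H.s ((H.cotwist Γ).counit Y)) q) := by
      rw [hH.twistMul_t_right h, hΓ.counit_cotwist hH, hΓ.ev_sw_twistL (C := hH.dual) hB]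
      exact { bal := fun b q p => by
                simp only [LinearMap.comp_apply, LinearMap.flip_apply, hΓ.balanced] }
    exact (hΓ.counit_cotwist_mul hH X Y).trans e1.symm

end IsInvertibleLeftTwoCocycle

end BialgebroidData

theorem Bal.flip {B : Type*} {r : B → M → M} {l : B → N → N} {β : N → M → W}
    (h : Bal k l r β) : Bal k r l fun x y => β y x where
  add_left x x' y := h.add_right y x x'
  smul_left c x y := h.smul_right c y x
  add_right x y y' := h.add_left y y' x
  smul_right c x y := h.smul_left c y x
  bal b x y := (h.bal b y x).symm

theorem mkQ_balRel_comm {B : Type*} {r : B → M → M} {l : B → N → N} {z w : M ⊗[k] N}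
    (h : (balRel k r l).mkQ z = (balRel k r l).mkQ w) :
    (balRel k l r).mkQ (TensorProduct.comm k M N z) =
      (balRel k l r).mkQ (TensorProduct.comm k M N w) := by
  refine mkQ_balRel_eq fun β hβ => ?_
  rw [hβ.toBilin.ev_comm_map, hβ.toBilin.ev_comm_map]
  exact hβ.flip.ev_congr h

/-! ### The canonical map and the translation map of the cotwist -/

namespace BialgebroidData

variable {H : BialgebroidData k B L}

open LeftComodule

namespace IsInvertibleLeftTwoCocycle

variable {Γ : L →ₗ[k] L →ₗ[k] B} (hΓ : H.IsInvertibleLeftTwoCocycle Γ)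
  (hH : H.IsLeftHopfAlgebroid) {C : H.LeftComodule M} {D : H.LeftComodule N}
  {E : H.LeftComodule P}
include hΓ hH

/-- Unfolding both copies of `Γ^#` and using the cocycle identity leaves `Γ(X₋ * p₍₋₁₎, n₍₋₁₎)`. The
first argument becomes `1`, and the remaining `ε(n₍₋₁₎)` is absorbed by the counit law of `N`. -/
theorem ev_twistSw_sharpEv_sharpEv {f : M →ₗ[k] N →ₗ[k] P} (hf : C.IsCobilinear D E f)
    {φ : L → P → W} (hφ : H.DBal E.l φ) (m : M) (n : N) :
    ev (C.twistSw hH Γ m) (fun X p =>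
        hH.dual.sharpEv E Γ X (C.sharpEv D Γ p n fun p q => f p q) φ) =
      ev (C.sw m) fun X p => φ X (f p n) := by
  have hB := hH.toIsLeftBialgebroid
  obtain ⟨g, rfl⟩ := hφ.exists_eq
  have hb : ∀ b X p, g (H.mul (H.t b) X) p = g X (E.l b p) := hφ.bal
  have e1 : ∀ X p, hH.dual.sharpEv E Γ X (C.sharpEv D Γ p n fun p q => f p q)
      (fun x e => g x e) = ev (hH.dual.sw X) fun q x => ev (C.sw p) fun Z p' =>
        ev (D.sw n) fun T n' => g (H.mul x (H.t (Γ (H.gmul Γ q Z) T))) (f p' n') := by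
    intro X p
    rw [sharpEv, ev_comm, hΓ.ev_sw_sharpEv hB hf (hΓ.sharpEv_bal_outer (C := hH.dual) hB hφ X)]
    simp only [LinearMap.comp_apply, LinearMap.flip_apply, hΓ.cocycle]
    refine .trans ?_ (ev_comm _ _ _)
    refine ev_congr fun Z p' => ?_
    rw [ev_comm]
  simp only [e1]
  rw [hΓ.ev_twistSw_gmul (Ψ := fun A x p => ev (D.sw n) fun T n' =>
    g (H.mul x (H.t (Γ A T))) (f p n'))]
  · simp only [hΓ.one_left]
    rw [ev_comm]
    have h1 : ∀ n', H.DBal C.l fun X p => g X (f p n') := fun n' =>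
      { bal := fun b X p => by simp only [hf.map_l, hb] }
    refine (ev_congr fun T n' => ev_sw_takeuchi (h1 n') _ m).trans ?_
    rw [ev_comm]
    refine ev_congr fun X p => ?_
    simp only [hf.bal]
    exact map_ev_sw_counit (g X ∘ₗ f p) n
  · exact { bal₁ := fun c A x p => by
              simp only [hΓ.linear, hH.t_mul, hH.mul_assoc, LinearMap.comp_apply,
                LinearMap.flip_apply]
            bal₂ := fun c A x p => by
              simp only [hH.mul_assoc, LinearMap.comp_apply, hb, hf.map_l] }

theorem twBal_mul_sharpEv {φ : L → L → W} (hφ : H.DBal H.leftS φ) (Y : L) :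
    hH.regular.TwBal hH Γ fun P Q => hH.dual.sharpEv hH.regular Γ P (H.twistMul Γ Q Y) φ := by
  have h := hΓ.toIsLeftTwoCocycle
  exact { bal := fun b P Q => by
            rw [hΓ.sharpEv_twistR (C := hH.dual) (D := hH.regular) hH.toIsLeftBialgebroid hφ,
              ← hH.twistMul_s_left h, ← hH.twistMul_s_left h, hH.twistMul_assoc h] }

/-- The canonical map of the cotwist, composed with `Γ^#`. -/
theorem ev_cotwist_sw_mul_sharpEv {φ : L → L → W} (hφ : H.DBal H.leftS φ) (X Y : L) :
    ev ((H.cotwist Γ).sw X) (fun P Q =>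
        hH.dual.sharpEv hH.regular Γ P (H.twistMul Γ Q Y) φ) =
      hH.dual.sharpEv hH.dual Γ Y X fun y x => H.lamEv φ x y := by
  have hB := hH.toIsLeftBialgebroid
  have h := hΓ.toIsLeftTwoCocycle
  rw [hΓ.ev_cotwist_sw hH (hΓ.twBal_mul_sharpEv hH hφ Y)]
  simp only [hH.twistMul_eq h]
  rw [hΓ.ev_twistSw_sharpEv_sharpEv hH (hH.isCobilinear_circₗ h) hφ]
  obtain ⟨g, rfl⟩ := hφ.exists_eq
  have hb : ∀ b X p, g (H.mul (H.t b) X) p = g X (H.mul (H.s b) p) := hφ.bal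
  have h1 : ∀ Z, H.DBal H.leftS fun P Q => g P (H.mul Q Z) := fun Z =>
    { bal := fun b P Q => by simp only [hb, LinearMap.comp_apply, hH.mul_assoc] }
  simp only [hH.circₗ_apply, sharpEv, map_ev]
  refine (ev_congr fun P Q => ev_comm (hH.dual.sw Y) (hH.dual.sw Q) _).trans ?_
  refine (hH.ev_sw_ev_dual (γ := fun P q p => ev (hH.dual.sw Y) fun t r =>
    g P (H.mul p (hH.dual.l (Γ t q) r))) ?_ X).trans ?_
  rotate_left
  · rw [ev_comm (hH.dual.sw Y)]
    refine ev_congr fun q p => ?_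
    rw [ev_comm]
    rfl
  · exact { bal₁ := fun b q p P => by
              simp only [← hΓ.balanced]
              refine (LeftComodule.ev_sw_takeuchi (C := hH.dual)
                (β := fun t r => g P (H.mul p (hH.dual.l (Γ t q) r))) ?_ b Y).trans ?_
              · exact { bal := fun c t r => by
                          simp only [hΓ.linear, hH.t_mul, hH.mul_assoc, LinearMap.comp_apply,
                            LinearMap.flip_apply] }
              · simp only [LinearMap.comp_apply, LinearMap.flip_apply, hH.mul_assoc]
            bal₂ := fun b q p P => by simp only [hb, hH.mul_assoc] }

theorem barRel_cotwist : (H.cotwist Γ).barRel =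
    balRel k (hH.dual.twistL Γ) (hH.dual.twistR Γ) := by
  have h := hΓ.toIsLeftTwoCocycle
  have h1 : (fun (b : B) X => (H.cotwist Γ).mul X ((H.cotwist Γ).t b)) = hH.dual.twistL Γ := by
    funext b X
    exact hH.twistMul_t_right h b X
  have h2 : (fun (b : B) X => (H.cotwist Γ).mul ((H.cotwist Γ).t b) X) = hH.dual.twistR Γ := by
    funext b X
    exact hH.twistMul_t_left h b X
  rw [← h1, ← h2]
  rfl

/-- A commutative square joining the canonical maps of `L^Γ` and `L` by two maps `Γ^#`, both
bijective for invertible `Γ`. The flips are there because `L ⊗_{B̄} L` is the tensor square of the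
dual comodule with its factors exchanged. -/
theorem diamondSharp_lam_cotwist (z : L ⊗[k] L) :
    H.diamondSharp Γ ((H.cotwist Γ).lam ((H.cotwist Γ).barRel.mkQ z)) =
      H.lam (H.barRel.mkQ (TensorProduct.comm k L L
        (sharpRaw Γ hH.dual.sw hH.dual.l hH.dual.sw (TensorProduct.comm k L L z)))) := by
  have hB := hH.toIsLeftBialgebroid
  rw [(hΓ.isLeftBialgebroid_cotwist hH).lam_mkQ, hB.lam_mkQ, hΓ.diamondSharp_mkQ hH]
  refine mkQ_diamondRel_eq fun β hβ => ?_
  have h1 : hH.dual.TBal hH.dual fun y x => H.lamEv β x y := (hB.lamEv_barBal hβ).flip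
  have h2 : Bilin k fun m n => hH.dual.sharpEv hH.regular Γ m n β := {}
  have h3 : Bilin k fun m n => hH.dual.sharpEv hH.dual Γ m n fun y x => H.lamEv β x y := {}
  rw [ev_sharpRaw _ _ _ _ hβ.toBilin, ev_lamRaw hβ.toBilin,
    (lamEv_bilin hβ.toBilin).ev_comm_map, ev_sharpRaw _ _ _ _ h1.toBilin]
  refine (ev_lamRaw h2 z).trans (.trans ?_ (h3.ev_comm_map z).symm)
  exact ev_congr fun X Y => hΓ.ev_cotwist_sw_mul_sharpEv hH hβ X Y

theorem isLeftHopfAlgebroid_cotwist : (H.cotwist Γ).IsLeftHopfAlgebroid where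
  toIsLeftBialgebroid := hΓ.isLeftBialgebroid_cotwist hH
  lam_bijective := by
    have hB := hH.toIsLeftBialgebroid
    have h := hΓ.invertible L L hH.dual hH.dual
    have h1 := fun z => hΓ.sharp_mkQ (C := hH.dual) (D := hH.dual) hB z
    have hc : ∀ z : L ⊗[k] L, TensorProduct.comm k L L (TensorProduct.comm k L L z) = z :=
      fun z => (TensorProduct.comm k L L).symm_apply_apply z
    constructor
    · intro x y hxy
      obtain ⟨x, rfl⟩ := Submodule.mkQ_surjective _ x
      obtain ⟨y, rfl⟩ := Submodule.mkQ_surjective _ y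
      have e1 := congrArg (H.diamondSharp Γ) hxy
      rw [hΓ.diamondSharp_lam_cotwist hH, hΓ.diamondSharp_lam_cotwist hH] at e1
      have e2 := mkQ_balRel_comm (hH.lam_bijective.1 e1)
      rw [hc, hc] at e2
      have e3 := h.1 ((h1 _).trans (e2.trans (h1 _).symm))
      have e4 := mkQ_balRel_comm e3
      rw [hc, hc] at e4
      refine (Submodule.Quotient.eq _).2 ?_
      rw [hΓ.barRel_cotwist hH]
      exact (Submodule.Quotient.eq _).1 e4
    · intro y
      obtain ⟨w, hw⟩ := hH.lam_bijective.2 (H.diamondSharp Γ y)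
      obtain ⟨w, rfl⟩ := Submodule.mkQ_surjective _ w
      obtain ⟨z, hz⟩ := h.2 ((hH.dual.tensorRel hH.dual).mkQ (TensorProduct.comm k L L w))
      obtain ⟨z, rfl⟩ := Submodule.mkQ_surjective _ z
      refine ⟨(H.cotwist Γ).barRel.mkQ (TensorProduct.comm k L L z),
        (hΓ.diamondSharp_bijective hH).1 ?_⟩
      rw [hΓ.diamondSharp_lam_cotwist hH, hc, ← hw]
      have e1 := mkQ_balRel_comm ((h1 z).symm.trans hz)
      rw [hc] at e1
      exact congrArg H.lam e1

/-- By uniqueness of the translation map it is enough to apply the new canonical map. Through `Γ^#`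
this becomes the old canonical map on `X₊ ⊗ X₋`, which gives `X ⊗ 1`. -/
theorem ev_cotwist_pm {β : L → L → W} (hβ : (H.cotwist Γ).BarBal β) (X : L) :
    ev ((H.cotwist Γ).pm X) β = ev (hH.dual.twistSw hH Γ X) fun q p => β p q := by
  have hB := hH.toIsLeftBialgebroid
  rw [← hβ.toBilin.ev_comm_map]
  refine (hΓ.isLeftHopfAlgebroid_cotwist hH).ev_pm_eq (fun β hβ => ?_) hβ
  rw [(lamEv_bilin hβ.toBilin).ev_comm_map]
  have hφ := (hΓ.toIsLeftTwoCocycle.dbal_cotwist_leftS_iff hH).1 hβ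
  have h0 := fun X Y => hΓ.sharpEv_unsharpEv (C := hH.dual) (D := hH.regular) hB hφ X Y
  have h1 : H.DBal H.leftS fun x n => hH.dual.unsharpEv hH.regular Γ x n β :=
    unsharpEv_tBal hH.dual hH.regular Γ β
  have e1 : ∀ p q, (H.cotwist Γ).lamEv β p q =
      hH.dual.sharpEv hH.dual Γ q p fun y x =>
        H.lamEv (fun x n => hH.dual.unsharpEv hH.regular Γ x n β) x y := by
    intro p q
    rw [← hΓ.ev_cotwist_sw_mul_sharpEv hH h1]
    exact ev_congr fun P Q => (h0 _ _).symm
  simp only [e1]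
  have h2 := (hB.lamEv_barBal h1).flip
  rw [hΓ.ev_twistSw_sharpEv (C := hH.dual) hH h2, hH.ev_dual_sw h2]
  refine (hH.ev_pm_lam h1 X).trans ?_
  rw [← h0]
  refine .symm ((sharpEv_of_sw_right (C := hH.dual) (D := hH.regular) h1 hΓ.toIsLeftTwoCocycle
    hB (b := H.oneB) (n' := H.one) (fun β hβ => ?_) X).trans ?_)
  · rw [hH.s_one]
    exact hB.ev_sw_one hβ
  · rw [hΓ.twistR_one hB]

end IsInvertibleLeftTwoCocycle

theorem LeftComodule.ext_of_ev_sw {C D : H.LeftComodule M} (hl : C.l = D.l) (hr : C.r = D.r)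
    (h : ∀ m (β : L → M → (L ⊗[k] M) ⧸ H.diamondRel D.l), H.DBal D.l β →
      ev (C.sw m) β = ev (D.sw m) β) : C = D := by
  cases C with | mk l r coact =>
  cases D with | mk l' r' coact' =>
  subst hl hr
  have : coact = coact' := by
    ext m
    refine (mkQ_rep _ (coact m)).symm.trans (.trans ?_ (mkQ_rep _ (coact' m)))
    exact mkQ_diamondRel_eq (h m)
  subst this
  rfl

namespace IsInvertibleLeftTwoCocycle

variable {Γ : L →ₗ[k] L →ₗ[k] B} (hΓ : H.IsInvertibleLeftTwoCocycle Γ)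
  (hH : H.IsLeftHopfAlgebroid) {C : H.LeftComodule M} {D : H.LeftComodule N}
  {E : H.LeftComodule P}
include hΓ hH

theorem ev_twist_sw {φ : L → M → W} (hφ : C.TwBal hH Γ φ) (m : M) :
    ev ((hΓ.twist hH C).sw m) φ = ev (C.twistSw hH Γ m) φ :=
  hΓ.ev_rep_mkQ hH hφ _

theorem regular_cotwist :
    (hΓ.isLeftBialgebroid_cotwist hH).regular = hΓ.twist hH hH.regular := by
  have h := hΓ.toIsLeftTwoCocycle
  refine LeftComodule.ext_of_ev_sw (h.leftS_cotwist hH) ?_ fun X β hβ => ?_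
  · ext b X
    exact hH.twistMul_s_right h b X
  · have hφ := (h.dbal_cotwist_iff hH).1 hβ
    exact (hΓ.ev_cotwist_sw hH hφ X).trans (hΓ.ev_twist_sw hH hφ X).symm

/-- Together with `regular_cotwist` this is an equality of comodules, so general results for the
dual comodule of a Hopf algebroid, applied to `L^Γ`, can be read as results on the twist of the dual
of `L`. -/
theorem dual_cotwist :
    (hΓ.isLeftHopfAlgebroid_cotwist hH).dual = hΓ.twist hH hH.dual := by
  have h := hΓ.toIsLeftTwoCocycle
  have hl : (hΓ.isLeftHopfAlgebroid_cotwist hH).dual.l = (hΓ.twist hH hH.dual).l := by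
    ext b X
    exact hH.twistMul_t_right h b X
  refine LeftComodule.ext_of_ev_sw hl ?_ fun X β hβ => ?_
  · ext b X
    exact hH.twistMul_t_left h b X
  · have hφ := (h.dbal_cotwist_iff hH).1 hβ
    have hβ' : (H.cotwist Γ).DBal (hΓ.isLeftHopfAlgebroid_cotwist hH).dual.l β :=
      ⟨hβ.toBilin, fun b x y => (hβ.bal b x y).trans
        (congrArg (β x) (LinearMap.congr_fun₂ hl b y).symm)⟩
    rw [(hΓ.isLeftHopfAlgebroid_cotwist hH).ev_dual_sw hβ', hΓ.ev_twist_sw hH hφ]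
    exact hΓ.ev_cotwist_pm hH (IsLeftHopfAlgebroid.barBal_swap hβ') X

theorem map_twistL {f : M →ₗ[k] N} (hf : C.IsColinear D f) (b : B) (m : M) :
    f (C.twistL Γ b m) = D.twistL Γ b (f m) := by
  rw [twistL_eq_ev, twistL_eq_ev, map_ev, hf.ev_sw' m]
  · simp only [hf.map_l]
  · exact { bal := fun c X n => by
              rw [← hΓ.balanced, hH.s_t_comm, hΓ.linear, D.mul_l] }

theorem isColinear_twist {f : M →ₗ[k] N} (hf : C.IsColinear D f) :
    (hΓ.twist hH C).IsColinear (hΓ.twist hH D) f where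
  map_l := hΓ.map_twistL hH hf
  ev_sw m β hβ := by
    have hφ := (hΓ.toIsLeftTwoCocycle.dbal_cotwist_iff hH).1 hβ
    rw [hΓ.ev_twist_sw hH hφ, hΓ.ev_twistSw_colinear hH hf hφ]
    refine (hΓ.ev_twist_sw hH ?_ m).symm
    obtain ⟨g, rfl⟩ := hβ.exists_eq
    have hb : ∀ b X p, g (hH.dual.twistR Γ b X) p = g X (D.twistL Γ b p) := hφ.bal
    exact { bal := fun b X p => by simp only [hb, hΓ.map_twistL hH hf] }

/-- If `f` is a comodule map `M ⊗_B N → P`, then `f ∘ Γ^#` is a comodule map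
`M^Γ ⊗_{B^Γ} N^Γ → P^Γ`. -/
theorem isCobilinear_twist {f g : M →ₗ[k] N →ₗ[k] P} (hf : C.IsCobilinear D E f)
    (hg : ∀ m n, g m n = C.sharpEv D Γ m n fun p q => f p q) :
    (hΓ.twist hH C).IsCobilinear (hΓ.twist hH D) (hΓ.twist hH E) g := by
  have hB := hH.toIsLeftBialgebroid
  have h := hΓ.toIsLeftTwoCocycle
  have hbal : ∀ b m n, g (C.twistR Γ b m) n = g m (D.twistL Γ b n) := by
    intro b m n
    rw [hg, hg]
    exact h.sharpEv_twistR hB hf.tBal b m n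
  have hmap : ∀ b m n, g (C.twistL Γ b m) n = E.twistL Γ b (g m n) := by
    intro b m n
    rw [hg, hg, twistL_eq_ev Γ E, h.ev_sw_sharpEv hB hf, sharpEv,
      h.ev_sw_twistL hB (h.sharpEv_bal_inner hB hf.tBal n)]
    · simp only [hΓ.cocycle, hf.map_l]
    · exact { bal := fun c X n => by
                rw [← hΓ.balanced, hH.s_t_comm, hΓ.linear, E.mul_l] }
  refine ⟨hbal, hmap, fun m n β hβ => ?_⟩
  have hφ := (h.dbal_cotwist_iff hH).1 hβ
  rw [hΓ.ev_twist_sw hH hφ, hg, hΓ.ev_twistSw_sharp hH hf hφ]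
  simp only [← hg]
  obtain ⟨u, rfl⟩ := hβ.exists_eq
  have hb : ∀ b X p, u (H.twistMul Γ (H.t b) X) p = u X (E.twistL Γ b p) := by
    intro b X p
    rw [hH.twistMul_t_left h]
    exact hφ.bal b X p
  have h1 : ∀ Y q, C.TwBal hH Γ fun X p => u (H.twistMul Γ X Y) (g p q) := fun Y q =>
    { bal := fun b X p => by
        simp only [← hH.twistMul_t_left h, hH.twistMul_assoc h, hb, hmap] }
  refine (hΓ.ev_twist_sw hH ?_ m).symm.trans ?_
  · exact { bal := fun b X p => ev_congr fun Y q => (h1 Y q).bal b X p }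
  · refine (ev_comm _ _ _).trans (.trans ?_ (ev_comm _ _ _))
    refine (hΓ.ev_twist_sw hH ?_ n).symm
    have h2 := fun b Y q => hΓ.ev_twistSw_takeuchi hH (h1 Y q) b m
    simp only [← hH.twistMul_t_right h, hH.twistMul_assoc h, hbal] at h2
    exact { bal := fun b Y q => by
              rw [← hH.twistMul_t_left h]
              exact (hΓ.ev_twist_sw hH (h1 _ _) m).trans
                ((h2 b Y q).trans (hΓ.ev_twist_sw hH (h1 _ _) m).symm) }

theorem isCobilinear_gmul_twist : (hΓ.twist hH hH.regular).IsCobilinear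
    (hΓ.twist hH hH.regular) (hΓ.twist hH hH.regular) (H.gmulₗ Γ) := by
  refine hΓ.isCobilinear_twist hH hH.isCobilinear_mul fun X Y => ?_
  rw [gmulₗ_apply, gmul_eq_ev, sharpEv]
  simp only [LinearMap.comp_apply, hH.mul_assoc]
  rfl

end IsInvertibleLeftTwoCocycle

/-! ### The composite cocycle -/

namespace IsInvertibleLeftTwoCocycle

variable {Γ : L →ₗ[k] L →ₗ[k] B} (hΓ : H.IsInvertibleLeftTwoCocycle Γ)
  (hH : H.IsLeftHopfAlgebroid) {C : H.LeftComodule M} {D : H.LeftComodule N}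
  {E : H.LeftComodule P} {S : L →ₗ[k] L →ₗ[k] B} (hS : (H.cotwist Γ).IsLeftTwoCocycle S)
include hΓ hH hS

theorem linear_twistR (b : B) (X Y : L) :
    S (hH.dual.twistR Γ b X) Y = Γ (H.s (S X Y)) (H.s b) := by
  rw [← hH.twistMul_t_left hΓ.toIsLeftTwoCocycle]
  exact hS.linear b X Y

theorem balanced_twistL (b : B) (X Y : L) :
    S (hH.dual.twistL Γ b X) Y = S X (hH.dual.twistR Γ b Y) := by
  rw [← hH.twistMul_t_left hΓ.toIsLeftTwoCocycle, ← hH.twistMul_t_right hΓ.toIsLeftTwoCocycle]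
  exact hS.balanced b X Y

theorem sharpEv_twist {ψ : M → N → W} (hψ : C.TwistBal D Γ ψ) (m : M) (n : N) :
    (hΓ.twist hH C).sharpEv (hΓ.twist hH D) S m n ψ =
      ev (C.twistSw hH Γ m) fun X p => ev (D.twistSw hH Γ n) fun Y q =>
        ψ (C.twistL Γ (S X Y) p) q := by
  have h := hΓ.toIsLeftTwoCocycle
  have hB := hΓ.isLeftBialgebroid_cotwist hH
  have h1 := (h.dbal_cotwist_iff hH).1
    (hS.sharpEv_bal_outer (C := hΓ.twist hH C) (D := hΓ.twist hH D) hB hψ m)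
  rw [sharpEv, ev_comm, hΓ.ev_twist_sw hH h1, ev_comm]
  refine hΓ.ev_twist_sw hH ?_ m
  obtain ⟨g, rfl⟩ := hψ.exists_eq
  exact { bal := fun b X p => by
            refine ev_congr fun Y q => ?_
            change g (C.twistL Γ _ p) q = g (C.twistL Γ _ (C.twistL Γ b p)) q
            rw [hΓ.linear_twistR hH hS, h.twistL_mulB hH.toIsLeftBialgebroid]
          add_left := by intros; simp [-map_ev]
          smul_left := by intros; simp
          add_right := by intros; simp
          smul_right := by intros; simp }

theorem twistBal_self : hH.regular.TwistBal hH.regular Γ fun X Y => Γ X Y :=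
  { bal := fun b X Y => by
      have h := hΓ.toIsLeftTwoCocycle
      rw [h.twistR_regular hH, h.twistL_regular hH, hΓ.cocycle] }

/-- The coproduct of `L^Γ` is the coaction of the twisted regular comodule, so the composite is
`Σ^#` there followed by `Γ`. -/
theorem comp_apply (X Y : L) : H.comp S Γ X Y = (hΓ.twist hH hH.regular).sharpEv
    (hΓ.twist hH hH.regular) S X Y fun x y => Γ x y := by
  rw [← hΓ.regular_cotwist hH]
  change TensorProduct.lift Γ (sharpRaw S (H.cotwist Γ).sw (H.cotwist Γ).leftS
    (H.cotwist Γ).sw (X ⊗ₜ[k] Y)) = _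
  rw [sharpRaw_tmul]
  simp only [map_ev, TensorProduct.lift.tmul]
  rfl

theorem comp_eq_ev (X Y : L) : H.comp S Γ X Y =
    ev (hH.regular.twistSw hH Γ X) fun A P => ev (hH.regular.twistSw hH Γ Y) fun R Q =>
      Γ (hH.regular.twistL Γ (S A R) P) Q := by
  rw [hΓ.comp_apply hH hS, hΓ.sharpEv_twist hH hS (hΓ.twistBal_self hH hS)]

/-- The operation `(Σ ∘ Γ)^#` is `Γ^# ∘ Σ^#`. -/
theorem sharpEv_comp {φ : M → N → W} (hφ : C.TBal D φ) (m : M) (n : N) :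
    C.sharpEv D (H.comp S Γ) m n φ = (hΓ.twist hH C).sharpEv (hΓ.twist hH D) S m n
      fun p q => C.sharpEv D Γ p q φ := by
  have h := hΓ.toIsLeftTwoCocycle
  have hB := hH.toIsLeftBialgebroid
  rw [hΓ.sharpEv_twist hH hS (h.sharpEv_twistBal hB hφ)]
  have h1 := fun n => h.sharpEv_bal_inner (C := C) (D := D) hB hφ n
  simp only [sharpEv, h.ev_sw_twistL hB (h1 _), ← h.twistL_regular hH]
  simp only [hΓ.comp_eq_ev hH hS]
  obtain ⟨g, rfl⟩ := hφ.exists_eq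
  have hb : ∀ b p q, g (C.r b p) q = g p (D.l b q) := hφ.bal
  simp only [map_ev, linearMap_ev_apply]
  have h2 : ∀ b Y q, H.DBal C.l fun X p => g (C.l (Γ (hH.regular.twistL Γ b X) Y) p) q :=
    fun b Y q =>
    { bal := fun c X p => by simp only [h.twistL_t_mul hH, hΓ.linear, C.mul_l] }
  have h3 : ∀ R Q q, Bal₃ k (hH.dual.twistR Γ) (hH.regular.twistL Γ) (fun b X => H.mul (H.t b) X)
      (fun b m => C.l b m) fun A X p =>
        g (C.l (Γ (hH.regular.twistL Γ (S A R) X) Q) p) q := fun R Q q =>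
    { bal₁ := fun b A X p => by
        rw [hΓ.linear_twistR hH hS, h.twistL_mulB hB]
      bal₂ := fun b A X p => (h2 (S A R) Q q).bal b X p }
  -- On the left each variable is first coacted upon and its coefficient then cotwisted; on the
  -- right the cotwisted coaction comes first. `ev_sw_ev_twistSw` exchanges the two, first for `m`,
  -- then for `n`.
  refine .trans (b := ev (D.sw n) fun Y q => ev (hH.regular.twistSw hH Γ Y) fun R Q =>
    ev (C.twistSw hH Γ m) fun A p => ev (C.sw p) fun X p =>
      g (C.l (Γ (hH.regular.twistL Γ (S A R) X) Q) p) q) ?_ (.trans (b :=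
        ev (D.twistSw hH Γ n) fun R q => ev (D.sw q) fun Q q =>
    ev (C.twistSw hH Γ m) fun A p => ev (C.sw p) fun X p =>
      g (C.l (Γ (hH.regular.twistL Γ (S A R) X) Q) p) q) ?_ ?_)
  · rw [ev_comm]
    refine ev_congr fun Y q => ?_
    refine (ev_congr fun X p => ev_comm _ _ _).trans ?_
    rw [ev_comm]
    refine ev_congr fun R Q => ?_
    exact hΓ.ev_sw_ev_twistSw hH (h3 R Q q) m
  · refine hΓ.ev_sw_ev_twistSw hH ?_ n
    exact { bal₁ := fun b R Q q => by
              have h4 : C.TwBal hH Γ fun A p => ev (C.sw p) fun X p =>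
                  g (C.l (Γ (hH.regular.twistL Γ (S A R) X) Q) p) q :=
                { bal := fun b A p => by
                    rw [h.ev_sw_twistL hB (h2 _ _ _)]
                    refine ev_congr fun X p => ?_
                    rw [hΓ.linear_twistR hH hS, h.twistL_mulB hB, h.twistL_regular hH b] }
              simp only [← hΓ.balanced_twistL hH hS]
              rw [hΓ.ev_twistSw_takeuchi hH h4]
              refine ev_congr fun A p => ?_
              rw [h.ev_sw_twistR hB (h2 _ _ _)]
              refine ev_congr fun X p => ?_
              rw [← h.twistR_regular hH, h.twistL_twistR hB, h.twistR_regular hH, ← hΓ.cocycle,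
                h.twistL_regular hH b]
            bal₂ := fun b R Q q => by
              refine ev_congr fun A p => ?_
              simp only [← hΓ.balanced, ← h.twistL_mul_t hH]
              rw [LeftComodule.ev_sw_takeuchi (C := C) (h2 (S A R) Q q)]
              simp only [C.l_r, hb] }
  · rw [ev_comm (C.twistSw hH Γ m)]
    refine ev_congr fun R q => ?_
    rw [ev_comm]
    refine ev_congr fun A p => ?_
    rw [ev_comm]

theorem gmul_comp (X Y : L) : H.gmul (H.comp S Γ) X Y = (hΓ.twist hH hH.regular).sharpEv
    (hΓ.twist hH hH.regular) S X Y fun x y => H.gmul Γ x y := by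
  have hB := hH.toIsLeftBialgebroid
  have h : ∀ (Θ : L →ₗ[k] L →ₗ[k] B) X Y, H.gmul Θ X Y =
      hH.regular.sharpEv hH.regular Θ X Y fun x y => H.mul x y := by
    intro Θ X Y
    rw [gmul_eq_ev, sharpEv]
    simp only [LinearMap.comp_apply, hH.mul_assoc]
    rfl
  rw [h, hΓ.sharpEv_comp hH hS hB.isCobilinear_mul.tBal]
  simp only [h]

theorem counit_gmul_comp (X Y : L) : H.counit (H.gmul (H.comp S Γ) X Y) = H.comp S Γ X Y := by
  rw [hΓ.gmul_comp hH hS, map_sharpEv, hΓ.comp_apply hH hS]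
  simp only [hΓ.counit_gmul hH.toIsLeftBialgebroid]

theorem comp_s_left (b : B) (X : L) : H.comp S Γ (H.s b) X =
    H.counit ((hΓ.twist hH hH.regular).twistL S b X) := by
  have h := hΓ.toIsLeftTwoCocycle
  have hB := hH.toIsLeftBialgebroid
  have hB' := hΓ.isLeftBialgebroid_cotwist hH
  rw [hΓ.comp_apply hH hS]
  refine (sharpEv_of_sw_left (b := b) (m' := H.one) (hΓ.twistBal_self hH hS) hS hB'
    (fun β hβ => ?_) (fun c => ?_) X).trans (hΓ.one_left _)
  · rw [← hΓ.regular_cotwist hH] at hβ ⊢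
    exact hB'.ev_sw_s hβ b
  · change hH.regular.twistL Γ c H.one = hH.regular.twistR Γ c H.one
    rw [h.twistL_regular hH, h.twistR_regular hH, h.gmul_one_left hB, h.gmul_one_right hB]

theorem comp_s_right (b : B) (X : L) : H.comp S Γ X (H.s b) =
    H.counit ((hΓ.twist hH hH.regular).twistR S b X) := by
  have hB' := hΓ.isLeftBialgebroid_cotwist hH
  rw [hΓ.comp_apply hH hS]
  refine (sharpEv_of_sw_right (b := b) (n' := H.one) (hΓ.twistBal_self hH hS) hS hB'
    (fun β hβ => ?_) X).trans (hΓ.one_right _)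
  rw [← hΓ.regular_cotwist hH] at hβ ⊢
  exact hB'.ev_sw_s hβ b

/-- The product `gmul` of the composite is `Σ^#` of the associative product `gmul Γ`, a comodule map
on the twisted regular comodule. Hence it is associative, and applying the counit turns this into
the cocycle identity. -/
theorem isLeftTwoCocycle_comp : H.IsLeftTwoCocycle (H.comp S Γ) := by
  have h := hΓ.toIsLeftTwoCocycle
  have hB := hH.toIsLeftBialgebroid
  have hB' := hΓ.isLeftBialgebroid_cotwist hH
  have hg := hΓ.isCobilinear_gmul_twist hH
  refine ⟨fun b X Y => ?_, fun b X Y => ?_, fun X Y Z => ?_, fun X => ?_, fun X => ?_⟩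
  · rw [hΓ.comp_apply hH hS, hΓ.comp_apply hH hS]
    refine ((hΓ.isColinear_twist hH (hB.isColinear_mul_t b)).sharpEv_left
      (D := hΓ.twist hH hH.regular) (φ := fun x y => Γ x y) (hΓ.twistBal_self hH hS) hS hB' X Y).trans (.trans ?_
        ((hΓ.isColinear_twist hH (hB.isColinear_t_mul b)).sharpEv
          (C := hΓ.twist hH hH.regular) (φ := fun x y => Γ x y) (hΓ.twistBal_self hH hS) hS hB' X Y).symm)
    refine congrArg _ (funext fun x => funext fun y => ?_)
    exact hΓ.balanced b x y
  · rw [hΓ.comp_apply hH hS, hΓ.comp_apply hH hS]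
    refine ((hΓ.isColinear_twist hH (hB.isColinear_t_mul b)).sharpEv_left
      (D := hΓ.twist hH hH.regular) (φ := fun x y => Γ x y) (hΓ.twistBal_self hH hS) hS hB' X Y).trans ?_
    simp only [hΓ.linear]
    exact (map_sharpEv (f := H.mulB.flip b) ..).symm
  · rw [← hΓ.counit_gmul_comp hH hS, ← hΓ.counit_gmul_comp hH hS (H.gmul _ X Y)]
    simp only [hΓ.gmul_comp hH hS]
    exact congrArg H.counit (hS.sharpEv_assoc hB' hg hg hg.tBal hg.tBal
      (h.gmul_assoc hB) X Y Z).symm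
  · rw [← hH.s_one, hΓ.comp_s_left hH hS]
    exact congrArg H.counit (hS.twistL_one hB' X)
  · rw [← hH.s_one, hΓ.comp_s_right hH hS]
    exact congrArg H.counit (hS.twistR_one hB' X)

omit hS in
-- Since `ε(s(a) * P) = Γ(s(a), P)`, commuting the coaction with the cotwisted coaction produces the
-- `Γ`-twisted action. It is used with `c = Σ(b, -)` and `c = Σ(-, b)`, for the two sided actions of
-- the composite.
theorem ev_sw_counit_twistL {c : L →ₗ[k] B}
    (hc : ∀ b A, c (hH.dual.twistR Γ b A) = Γ (H.s (c A)) (H.s b)) (m : M) :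
    ev (C.sw m) (fun X n => C.l (H.counit (ev (hH.regular.twistSw hH Γ X) fun A P =>
      hH.regular.twistL Γ (c A) P)) n) =
    ev (C.twistSw hH Γ m) fun A p => C.twistL Γ (c A) p := by
  have h := hΓ.toIsLeftTwoCocycle
  have hB := hH.toIsLeftBialgebroid
  simp only [map_ev, linearMap_ev_apply]
  refine (hΓ.ev_sw_ev_twistSw hH (γ := fun A P n =>
    C.l (H.counit (hH.regular.twistL Γ (c A) P)) n) ?_ m).trans ?_
  · exact { bal₁ := fun b A P n => by rw [hc, h.twistL_mulB hB]
            bal₂ := fun b A P n => by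
              rw [h.twistL_t_mul hH, hH.counit_t, C.mul_l] }
  · refine ev_congr fun A p => ?_
    rw [twistL_eq_ev Γ C]
    simp only [h.twistL_regular hH, h.counit_gmul hB]

end IsInvertibleLeftTwoCocycle

theorem ext_of_ev_sw {A A' : BialgebroidData k B L} (h : A.toRingData = A'.toRingData)
    (hsw : ∀ X (β : L → L → A'.Diamond), A'.DBal A'.leftS β →
      ev (A.sw X) β = ev (A'.sw X) β) (hε : A.counit = A'.counit) : A = A' := by
  obtain ⟨R, c, e⟩ := A
  obtain ⟨R', c', e'⟩ := A'
  obtain rfl : R = R' := h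
  obtain rfl : e = e' := hε
  have : c = c' := LinearMap.ext fun X =>
    (cls_sw (H := ⟨R, c, e⟩) X).symm.trans (.trans
      (mkQ_diamondRel_eq (H := ⟨R, c', e⟩) (l := R.leftS) (hsw X))
      (cls_sw (H := ⟨R, c', e⟩) X))
  rw [this]

/-! ### Invertibility of the composite cocycle -/

namespace IsInvertibleLeftTwoCocycle

variable {Γ : L →ₗ[k] L →ₗ[k] B} (hΓ : H.IsInvertibleLeftTwoCocycle Γ)
  (hH : H.IsLeftHopfAlgebroid) {C : H.LeftComodule M} {D : H.LeftComodule N}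
  {E : H.LeftComodule P} {S : L →ₗ[k] L →ₗ[k] B}

section

variable (hS : (H.cotwist Γ).IsLeftTwoCocycle S)
include hΓ hH hS

theorem linear_s_left (a b : B) (X : L) : S (H.s a) (hH.dual.twistR Γ b X) =
    Γ (H.s (S (H.s a) X)) (H.s b) := by
  have h := hΓ.toIsLeftTwoCocycle
  rw [← hΓ.balanced_twistL hH hS, ← hH.twistMul_t_right h, h.twistMul_s_t_comm hH,
    hH.twistMul_t_left h, hΓ.linear_twistR hH hS]

theorem twistL_twist (b : B) (m : M) : (hΓ.twist hH C).twistL S b m =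
    ev (C.twistSw hH Γ m) fun X p => C.twistL Γ (S (H.s b) X) p := by
  rw [twistL_eq_ev]
  refine hΓ.ev_twist_sw hH ?_ m
  exact { bal := fun c X p => by
            change C.twistL Γ _ p = C.twistL Γ _ (C.twistL Γ c p)
            rw [← hΓ.twistL_mulB hH.toIsLeftBialgebroid]
            exact congrArg (fun b => C.twistL Γ b p) (hΓ.linear_s_left hH hS b c X) }

theorem twistR_twist (b : B) (m : M) : (hΓ.twist hH C).twistR S b m =
    ev (C.twistSw hH Γ m) fun X p => C.twistL Γ (S X (H.s b)) p := by
  rw [twistR_eq_ev]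
  refine hΓ.ev_twist_sw hH ?_ m
  exact { bal := fun c X p => by
            change C.twistL Γ _ p = C.twistL Γ _ (C.twistL Γ c p)
            rw [← hΓ.twistL_mulB hH.toIsLeftBialgebroid]
            exact congrArg (fun b => C.twistL Γ b p) (hΓ.linear_twistR hH hS c X (H.s b)) }

theorem twistL_comp (b : B) (m : M) :
    C.twistL (H.comp S Γ) b m = (hΓ.twist hH C).twistL S b m := by
  rw [twistL_eq_ev, hΓ.twistL_twist hH hS]
  simp only [hΓ.comp_s_left hH hS, hΓ.twistL_twist hH hS]
  exact hΓ.ev_sw_counit_twistL hH (c := S (H.s b)) (hΓ.linear_s_left hH hS b) m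

theorem twistR_comp (b : B) (m : M) :
    C.twistR (H.comp S Γ) b m = (hΓ.twist hH C).twistR S b m := by
  rw [twistR_eq_ev, hΓ.twistR_twist hH hS]
  simp only [hΓ.comp_s_right hH hS, hΓ.twistR_twist hH hS]
  exact hΓ.ev_sw_counit_twistL hH (c := S.flip (H.s b))
    (fun c X => hΓ.linear_twistR hH hS c X (H.s b)) m

theorem twistTensorRel_comp : C.twistTensorRel D (H.comp S Γ) =
    (hΓ.twist hH C).twistTensorRel (hΓ.twist hH D) S := by
  simp only [twistTensorRel, hΓ.twistL_comp hH hS, hΓ.twistR_comp hH hS]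

/-- The twisted actions of `Σ ∘ Γ` on `M` are the `Σ`-twisted actions on `M^Γ`, so the domains agree
and `sharpEv_comp` becomes a factorization of maps between the quotients. -/
theorem sharp_comp (z : M ⊗[k] N) :
    C.sharp D (H.comp S Γ) ((C.twistTensorRel D (H.comp S Γ)).mkQ z) =
      C.sharp D Γ ((hΓ.twist hH C).sharp (hΓ.twist hH D) S
        (((hΓ.twist hH C).twistTensorRel (hΓ.twist hH D) S).mkQ z)) := by
  have h := hΓ.toIsLeftTwoCocycle
  have hB := hH.toIsLeftBialgebroid
  rw [(hΓ.isLeftTwoCocycle_comp hH hS).sharp_mkQ hB,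
    hS.sharp_mkQ (hΓ.isLeftBialgebroid_cotwist hH)]
  refine .trans ?_ (h.sharp_mkQ hB _).symm
  refine mkQ_balRel_eq fun β hβ => ?_
  have h1 : (hΓ.twist hH C).TBal (hΓ.twist hH D) fun m n => C.sharpEv D Γ m n β :=
    h.sharpEv_twistBal hB hβ
  rw [ev_sharpRaw _ _ _ _ hβ.toBilin, ev_sharpRaw _ _ _ _ hβ.toBilin]
  refine .trans ?_ (ev_sharpRaw _ _ _ _ h1.toBilin z).symm
  exact ev_congr fun m n => hΓ.sharpEv_comp hH hS hβ m n

end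

variable (hS : (H.cotwist Γ).IsInvertibleLeftTwoCocycle S)
include hΓ hH hS

theorem isInvertibleLeftTwoCocycle_comp : H.IsInvertibleLeftTwoCocycle (H.comp S Γ) where
  toIsLeftTwoCocycle := hΓ.isLeftTwoCocycle_comp hH hS.toIsLeftTwoCocycle
  invertible := by
    intro M N _ _ _ _ C D
    have h := hS.toIsLeftTwoCocycle
    have h1 := hΓ.invertible M N C D
    have h2 := hS.invertible M N (hΓ.twist hH C) (hΓ.twist hH D)
    constructor
    · intro x y hxy
      obtain ⟨x, rfl⟩ := Submodule.mkQ_surjective _ x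
      obtain ⟨y, rfl⟩ := Submodule.mkQ_surjective _ y
      rw [hΓ.sharp_comp hH h, hΓ.sharp_comp hH h] at hxy
      refine (Submodule.Quotient.eq _).2 ?_
      rw [hΓ.twistTensorRel_comp hH h]
      exact (Submodule.Quotient.eq _).1 (h2.1 (h1.1 hxy))
    · intro y
      obtain ⟨x, rfl⟩ := h1.2 y
      obtain ⟨z, rfl⟩ := h2.2 x
      obtain ⟨z, rfl⟩ := Submodule.mkQ_surjective _ z
      exact ⟨_, hΓ.sharp_comp hH h z⟩

end IsInvertibleLeftTwoCocycle

/-! ### Comparison of the two cotwists -/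

namespace IsLeftTwoCocycle

variable {Γ : L →ₗ[k] L →ₗ[k] B} (hΓ : H.IsLeftTwoCocycle Γ) (hH : H.IsLeftHopfAlgebroid)
include hΓ hH

theorem circₗ_twistR (b : B) (X Y : L) : hH.circₗ Γ X (hH.dual.twistR Γ b Y) =
    hH.circₗ Γ (hH.dual.twistL Γ b X) Y := by
  rw [hH.circₗ_apply, hH.circₗ_apply]
  exact hΓ.sharpEv_twistR hH.toIsLeftBialgebroid hH.isCobilinear_mul_flip.tBal b Y X

/-- `X ↦ X ·_Γ t(b)` is left colinear. -/
theorem ev_sw_dual_twistL {β : L → L → W} (hβ : H.DBal H.leftS β) (b : B) (X : L) :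
    ev (H.sw (hH.dual.twistL Γ b X)) β =
      ev (H.sw X) fun P Q => β P (hH.dual.twistL Γ b Q) := by
  obtain ⟨f, rfl⟩ := hβ.exists_eq
  have hb : ∀ b X Y, f (H.mul (H.t b) X) Y = f X (H.mul (H.s b) Y) := hβ.bal
  simp only [twistL_eq_ev, map_ev, ev_ev]
  refine .trans ?_ (hH.ev_sw_ev_dual
    (γ := fun P q p => f P (hH.dual.l (Γ (H.s b) q) p)) ?_ X).symm
  · exact ev_congr fun q p => hH.ev_sw_mul_t hβ _ p
  · exact { bal₁ := fun c q p P => by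
              rw [← hΓ.balanced, hH.s_t_comm, hΓ.linear]
              simp only [hH.t_mul, hH.mul_assoc, LinearMap.comp_apply, LinearMap.flip_apply]
            bal₂ := fun c q p P => by
              simp only [hb, hH.mul_assoc, LinearMap.comp_apply, LinearMap.flip_apply] }

end IsLeftTwoCocycle

namespace IsInvertibleLeftTwoCocycle

variable {Γ : L →ₗ[k] L →ₗ[k] B} (hΓ : H.IsInvertibleLeftTwoCocycle Γ)
  (hH : H.IsLeftHopfAlgebroid) {S : L →ₗ[k] L →ₗ[k] B}

section

variable (hS : (H.cotwist Γ).IsLeftTwoCocycle S)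
include hΓ hH hS

theorem comp_s_s (a b : B) : H.comp S Γ (H.s a) (H.s b) = S (H.s a) (H.s b) := by
  have hB' := hΓ.isLeftBialgebroid_cotwist hH
  rw [hΓ.comp_s_left hH hS, ← hΓ.regular_cotwist hH]
  refine .trans (congrArg H.counit ?_) (hH.counit_s_self _)
  exact (hS.twistL_regular (hΓ.isLeftHopfAlgebroid_cotwist hH) a (H.s b)).trans
    (hS.gmul_s_s hB' a b)

theorem circₗ_comp (X Y : L) : hH.circₗ (H.comp S Γ) X Y =
    (hΓ.twist hH hH.dual).sharpEv (hΓ.twist hH hH.dual) S Y X fun y x => hH.circₗ Γ x y := by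
  simp only [hH.circₗ_apply]
  exact hΓ.sharpEv_comp hH hS hH.isCobilinear_mul_flip.tBal Y X

/-- `Γ` acts on the regular legs and `Σ` on the cotwisted dual legs. These coactions commute, so `Γ`
can be applied inside `Σ^#`, where it completes `circₗ` to the product of `L^Γ`. -/
theorem sharpEv_circₗ_comp (X Y : L) :
    hH.regular.sharpEv hH.regular Γ X Y (fun x y => hH.circₗ (H.comp S Γ) x y) =
      (hΓ.twist hH hH.dual).sharpEv (hΓ.twist hH hH.dual) S Y X
        fun y x => H.twistMul Γ x y := by
  have h := hΓ.toIsLeftTwoCocycle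
  have hB := hH.toIsLeftBialgebroid
  have hΘ := hΓ.isLeftTwoCocycle_comp hH hS
  have h1 : hH.dual.TwistBal hH.dual Γ fun y x => hH.circₗ Γ x y :=
    { bal := fun b y x => h.circₗ_twistR hH b x y }
  have h2 : hH.dual.TwistBal hH.dual Γ fun y x => H.twistMul Γ x y :=
    { bal := fun b y x => by
        rw [← hH.twistMul_t_left h, ← hH.twistMul_t_right h, hH.twistMul_assoc h] }
  rw [hΓ.sharpEv_twist hH hS h2]
  refine .trans (b := ev (H.sw X) fun P p => ev (H.sw Y) fun R q =>
    ev (hH.dual.twistSw hH Γ q) fun T q' => ev (hH.dual.twistSw hH Γ p) fun A p' =>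
      H.mul (H.s (Γ P R)) (hH.circₗ Γ p' (hH.dual.twistL Γ (S T A) q'))) ?_ ?_
  · rw [sharpEv]
    refine ev_congr fun P p => ev_congr fun R q => ?_
    refine (hH.circₗ_s_mul hΘ _ _ _).trans ?_
    rw [hΓ.circₗ_comp hH hS, hΓ.sharpEv_twist hH hS h1]
    simp only [map_ev]
  have h3 : ∀ A p' P R, hH.dual.TwBal hH Γ fun T q' =>
      H.mul (H.s (Γ P R)) (hH.circₗ Γ p' (hH.dual.twistL Γ (S T A) q')) := fun A p' P R =>
    { bal := fun b T q' => by
        simp only [hΓ.linear_twistR hH hS, h.twistL_mulB hB] }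
  refine .trans (b := ev (hH.dual.twistSw hH Γ X) fun A p => ev (H.sw p) fun P p' =>
    ev (H.sw Y) fun R q => ev (hH.dual.twistSw hH Γ q) fun T q' =>
      H.mul (H.s (Γ P R)) (hH.circₗ Γ p' (hH.dual.twistL Γ (S T A) q'))) ?_ ?_
  · refine .trans ?_ (hΓ.ev_sw_ev_twistSw_dual hH (γ := fun A p' P => ev (H.sw Y) fun R q =>
      ev (hH.dual.twistSw hH Γ q) fun T q' =>
        H.mul (H.s (Γ P R)) (hH.circₗ Γ p' (hH.dual.twistL Γ (S T A) q'))) ?_ X)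
    · refine ev_congr fun P p => ?_
      refine .trans (ev_congr fun R q => ?_) (ev_comm _ _ _)
      exact ev_comm _ _ _
    · exact { bal₁ := fun b A p' P => by
                refine ev_congr fun R q => ?_
                simp only [← hΓ.balanced_twistL hH hS, ← h.circₗ_twistR hH]
                rw [hΓ.ev_twistSw_takeuchi hH (h3 A p' P R)]
                simp only [h.twistL_twistR hB]
              bal₂ := fun b A p' P => by
                simp only [hH.circₗ_s_mul h, hΓ.linear, hH.s_mul, hH.mul_assoc] }
  -- The exchange just made for `X` is repeated for `Y`; what remains is to recognise the regular
  -- `Γ^#` as the product of `L^Γ`.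
  refine .trans (b := ev (hH.dual.twistSw hH Γ Y) fun T q => ev (H.sw q) fun R q' =>
    ev (hH.dual.twistSw hH Γ X) fun A p => ev (H.sw p) fun P p' =>
      H.mul (H.s (Γ P R)) (hH.circₗ Γ p' (hH.dual.twistL Γ (S T A) q'))) ?_ ?_
  · refine .trans ?_ (hΓ.ev_sw_ev_twistSw_dual hH (γ := fun T q' R =>
      ev (hH.dual.twistSw hH Γ X) fun A p => ev (H.sw p) fun P p' =>
        H.mul (H.s (Γ P R)) (hH.circₗ Γ p' (hH.dual.twistL Γ (S T A) q'))) ?_ Y)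
    · refine .trans (ev_congr fun A p => ev_comm _ _ _) ?_
      rw [ev_comm]
      refine ev_congr fun R q => ?_
      refine .trans (ev_congr fun A p => ev_comm _ _ _) ?_
      rw [ev_comm]
    · exact { bal₁ := fun b T q' R => by
                simp only [hΓ.linear_twistR hH hS, h.twistL_mulB hB]
              bal₂ := fun b T q' R => by
                refine ev_congr fun A p => ?_
                simp only [← hΓ.map_twistL hH (hH.isColinear_s_mul b), ← hH.circₗ_mul_s h,
                  ← hΓ.balanced]
                refine (hH.ev_sw_takeuchi (β := fun P p' => H.mul (H.s (Γ P R))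
                  (hH.circₗ Γ p' (hH.dual.twistL Γ (S T A) q'))) ?_ b p).symm
                exact { bal := fun c P p' => by
                          simp only [hΓ.linear, hH.s_mul, hH.mul_assoc, LinearMap.comp_apply,
                            hH.circₗ_s_mul h] } }
  refine ev_congr fun T q => ?_
  rw [ev_comm]
  refine ev_congr fun A p => ?_
  have h4 := (hH.isCobilinear_circₗ h).tBal
  rw [hH.twistMul_eq h, sharpEv, ev_comm (hH.regular.sw p)]
  refine .trans ?_ (h.ev_sw_dual_twistL hH (h.sharpEv_bal_outer hB h4 p) _ q).symm
  refine ev_congr fun R q' => ev_congr fun P p' => ?_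
  exact (hH.circₗ_s_mul h _ _ _).symm

/-- The regular `(Σ ∘ Γ)^#` splits as `Γ^#` followed by `Σ^#` on test functions. The first absorbs
into the product of `L^Γ` under the dual `Σ^#`, and the second supplies the regular `Σ^#` required
by the product of `(L^Γ)^Σ`. -/
theorem twistMul_comp (X Y : L) :
    H.twistMul (H.comp S Γ) X Y = (H.cotwist Γ).twistMul S X Y := by
  have hH' := hΓ.isLeftHopfAlgebroid_cotwist hH
  have hΘ := hΓ.isLeftTwoCocycle_comp hH hS
  rw [hH.twistMul_eq hΘ, hΓ.sharpEv_comp hH hS (hH.isCobilinear_circₗ hΘ).tBal,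
    hH'.twistMul_eq hS, hΓ.regular_cotwist hH]
  simp only [hΓ.sharpEv_circₗ_comp hH hS, hH'.circₗ_apply, hΓ.dual_cotwist hH]
  rfl

/-- Both cotwisted coproducts are moved outside the translation map of `X`. The inner `Γ` then
evaluates to `ε^Γ`, and the right counit law of `L^Γ` removes it. -/
theorem counit_cotwist_comp (X : L) :
    ev (hH.dual.sw X) (fun q p => H.comp S Γ p q) =
      ev (hH.dual.twistSw hH Γ X) fun q p => S p q := by
  have h := hΓ.toIsLeftTwoCocycle
  have hB := hH.toIsLeftBialgebroid
  have hB' := hΓ.isLeftBialgebroid_cotwist hH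
  have h1 : ∀ R Q, hH.regular.TwBal hH Γ fun A P =>
      Γ (hH.regular.twistL Γ (S A R) P) Q := fun R Q =>
    { bal := fun b A P => by rw [hΓ.linear_twistR hH hS, h.twistL_mulB hB] }
  simp only [hΓ.comp_eq_ev hH hS]
  refine (ev_congr fun q p => ev_comm _ _ _).trans ?_
  refine (hΓ.ev_sw_ev_twistSw (C := hH.dual) hH (γ := fun R Q p =>
    ev (hH.regular.twistSw hH Γ p) fun A P => Γ (hH.regular.twistL Γ (S A R) P) Q) ?_ X).trans ?_
  · exact { bal₁ := fun b R Q p => by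
              simp only [← hΓ.balanced_twistL hH hS]
              rw [hΓ.ev_twistSw_takeuchi hH (h1 R Q)]
              refine ev_congr fun A P => ?_
              rw [h.twistL_twistR hB, h.twistR_regular hH, ← hΓ.cocycle, h.twistL_regular hH b]
            bal₂ := fun b R Q p => by
              refine .trans ?_ (hΓ.ev_twistSw_colinear hH (hB.isColinear_mul_t b) (h1 R Q) p).symm
              refine ev_congr fun A P => ?_
              rw [LinearMap.flip_apply, h.twistL_mul_t hH, hΓ.balanced] }
  refine ev_congr fun R X => ?_
  refine (hΓ.ev_pm_ev_twistSw hH (γ := fun A P q => Γ (hH.regular.twistL Γ (S A R) P) q)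
    ?_ X).trans ?_
  · exact { bal₁ := fun b A P q => (h1 R q).bal b A P
            bal₂ := fun b A P q => by
              rw [LinearMap.comp_apply, LinearMap.flip_apply, h.twistL_mul_t hH, hΓ.balanced] }
  have e1 : ∀ A Z, ev (hH.dual.sw Z) (fun q p => Γ (hH.regular.twistL Γ (S A R) p) q) =
      S (hH.dual.twistR Γ ((H.cotwist Γ).counit Z) A) R := by
    intro A Z
    rw [hΓ.linear_twistR hH hS, hΓ.counit_cotwist hH, ← h.ev_dual_gmul hH, map_ev]
    simp only [h.twistL_regular hH, hΓ.cocycle]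
  simp only [e1]
  have h2 : hH.regular.TwBal hH Γ fun A Z =>
      S (hH.dual.twistR Γ ((H.cotwist Γ).counit Z) A) R :=
    { bal := fun b A Z => by
        rw [hΓ.counit_cotwist_twistL_regular hH, h.twistR_mulB hB] }
  rw [← hΓ.ev_cotwist_sw hH h2]
  have h3 := congrArg (fun X => S X R) (hB'.ev_sw_counit_right X)
  simp only [map_ev, linearMap_ev_apply] at h3
  refine .trans (ev_congr fun A Z => ?_) h3
  rw [← hH.twistMul_t_left h]
  rfl

end

variable (hS : (H.cotwist Γ).IsInvertibleLeftTwoCocycle S)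
include hΓ hH hS

/-- Both coproducts are inverse images of `Δ(X)`, one under `(Σ ∘ Γ)^#` and one under `Γ^# ∘ Σ^#`.
After writing `β` as a pullback along `(Σ ∘ Γ)^#`, both sides reduce to the value on `Δ(X)`. -/
theorem ev_twistSw_comp {β : L → L → W} (hβ : hH.regular.TwBal hH (H.comp S Γ) β) (X : L) :
    ev (hH.regular.twistSw hH (H.comp S Γ) X) β =
      ev ((hΓ.isLeftBialgebroid_cotwist hH).regular.twistSw
        (hΓ.isLeftHopfAlgebroid_cotwist hH) S X) β := by
  have h := hΓ.toIsLeftTwoCocycle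
  have hB := hH.toIsLeftBialgebroid
  have hH' := hΓ.isLeftHopfAlgebroid_cotwist hH
  have hΘ := hΓ.isInvertibleLeftTwoCocycle_comp hH hS
  have h0 := fun X Y => hΘ.sharpEv_unsharpEv (C := hH.dual) (D := hH.regular) hB hβ X Y
  have h1 : H.DBal H.leftS fun X Y => hH.dual.unsharpEv hH.regular (H.comp S Γ) X Y β :=
    unsharpEv_tBal hH.dual hH.regular (H.comp S Γ) β
  generalize (fun X Y => hH.dual.unsharpEv hH.regular (H.comp S Γ) X Y β) = χ at h0 h1
  have h2 : hH.regular.TwBal hH Γ fun X Y => hH.dual.sharpEv hH.regular Γ X Y χ :=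
    h.sharpEv_twistBal (C := hH.dual) (D := hH.regular) hB h1
  obtain rfl : β = fun X Y => hH.dual.sharpEv hH.regular (H.comp S Γ) X Y χ := by
    funext X Y
    exact (h0 X Y).symm
  rw [hΘ.ev_twistSw_sharpEv (C := hH.regular) hH h1]
  simp only [hΓ.sharpEv_comp (C := hH.dual) (D := hH.regular) hH hS.toIsLeftTwoCocycle h1]
  simp only [← hΓ.dual_cotwist hH, ← hΓ.regular_cotwist hH]
  refine .trans ?_ (hS.ev_twistSw_sharpEv (C := hH'.regular) hH'
    ((h.dbal_cotwist_leftS_iff hH).2 h2) X).symm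
  exact ((hΓ.ev_cotwist_sw hH h2 X).trans
    (hΓ.ev_twistSw_sharpEv (C := hH.regular) hH h1 X)).symm

theorem cotwist_comp : H.cotwist (H.comp S Γ) = (H.cotwist Γ).cotwist S := by
  have h := hS.toIsLeftTwoCocycle
  have hH' := hΓ.isLeftHopfAlgebroid_cotwist hH
  have hΘ := hΓ.isInvertibleLeftTwoCocycle_comp hH hS
  refine ext_of_ev_sw ?_ (fun X β hβ => ?_) (LinearMap.ext fun X => ?_)
  · change H.twistRing (H.comp S Γ) = (H.cotwist Γ).twistRing S
    have h1 : (H.comp S Γ).compl₁₂ H.s H.s = S.compl₁₂ (H.cotwist Γ).s (H.cotwist Γ).s := by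
      ext a b
      exact hΓ.comp_s_s hH h a b
    have h2 : H.twistMul (H.comp S Γ) = (H.cotwist Γ).twistMul S := by
      ext X Y
      exact hΓ.twistMul_comp hH h X Y
    rw [twistRing, twistRing, h1, h2]
    rfl
  · have hβ' := (h.dbal_cotwist_leftS_iff hH').1 hβ
    have hβ'' : hH.regular.TwBal hH (H.comp S Γ) β :=
      ⟨hβ'.toBilin, fun b X Y => by
        have := hβ'.bal b X Y
        rw [hΓ.dual_cotwist hH, hΓ.regular_cotwist hH] at this
        rwa [hΓ.twistR_comp hH h, hΓ.twistL_comp hH h]⟩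
    rw [hΘ.ev_cotwist_sw hH hβ'', hS.ev_cotwist_sw hH' hβ', hΓ.ev_twistSw_comp hH hS hβ'']
  · rw [hΘ.counit_cotwist hH, hS.counit_cotwist hH', hΓ.counit_cotwist_comp hH h,
      hΓ.dual_cotwist hH]
    refine (hΓ.ev_twist_sw (C := hH.dual) hH ?_ X).symm
    exact { bal := fun b q p => (hΓ.balanced_twistL hH h b p q).symm }

end IsInvertibleLeftTwoCocycle

end BialgebroidData
end Cotwist
end

theorem mainTheorem9 {k : Type v} [Field k] {B L : Type u} [AddCommGroup B] [Module k B]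
    [AddCommGroup L] [Module k L] (H : Cotwist.BialgebroidData k B L)
    (hH : H.IsLeftHopfAlgebroid)
    (Γ : L →ₗ[k] L →ₗ[k] B) (hΓ : H.IsInvertibleLeftTwoCocycle Γ)
    (S : L →ₗ[k] L →ₗ[k] B) (hS : (H.cotwist Γ).IsInvertibleLeftTwoCocycle S) :
    (H.cotwist Γ).IsLeftHopfAlgebroid ∧
      H.IsInvertibleLeftTwoCocycle (H.comp S Γ) ∧
      H.cotwist (H.comp S Γ) = (H.cotwist Γ).cotwist S := by
  exact ⟨hΓ.isLeftHopfAlgebroid_cotwist hH, hΓ.isInvertibleLeftTwoCocycle_comp hH hS,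
    hΓ.cotwist_comp hH hS⟩
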